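/- **Setting and assumptions.** Signs $\tau,\tau',\delta,\alpha,\sigma$ range over $\{+,-\}$, identified with $\pm1$. Let $\mathcal H=L^2(\mathbb R,dr)$ and $\hat{\mathcal H}=L^2((0,\infty),dk)\otimes\mathbb C^2$ with inner products $(d,e)_1=\int_{\mathbb R}\overline{d}\,e\,dr$ and $(f,g)_2=\sum_{\delta}\int_0^\infty\overline{f_\delta}\,g_\delta\,dk$; let $\mathcal C=C_0^\infty(\mathbb R)$ and $\hat{\mathcal C}=C_0^\infty((0,\infty))^2$. Let $$\Psi(r,k)=w(r)^{1/2}\sum_{\tau=\pm}m^\tau(r,k)e^{i\tau rk},\qquad (\mathcal Ff)(r)=\frac1{\sqrt{2\pi}}\int_0^\infty\big(\Psi(r,k)f_+(k)-\Psi(-r,k)f_-(k)\big)dk\quad (f\in\hat{\mathcal C}).$$ "(Anti)periodic" means periodic or antiperiodic. For $\gamma>0$, "$O(e^{\mp\gamma z})$ for $\mathrm{Re}\,z\to\pm\infty$" is understood with constants uniform for $\mathrm{Im}\,z$ and the other (real) variable in compact subsets of $\mathbb R$. *(A)* Let $\rho,\gamma>0$. The function $w$ is positive and even on $\mathbb R$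 and extends to a meromorphic $i\rho$-periodic function on $\mathbb C$ (regular on $\mathbb R$) whose only singularities in $0<\mathrm{Im}\,r<\rho$ are finitely many simple poles; $w(r)^{1/2}$ is the positive root on $\mathbb R$, continued analytically to $|\mathrm{Re}\,r|$ large. The $m^\pm$ are smooth on $\mathbb R^2$, satisfy $\overline{m^\tau(r,k)}=m^\tau(r,-k)$ there, and for real $k$ extend to entire functions of $r$ that are either both $i\rho$-periodic or both $i\rho$-antiperiodic (the same alternative for all $k$). There are smooth $T,R$ on $\mathbb R$ with $\overline{T(k)}=T(-k)$, $\overline{R(k)}=R(-k)$, $T(-k)T(k)+R(-k)R(k)=1$, $T(-k)R(k)+R(-k)T(k)=0$, such that $w^{1/2}m^+=T(k)+O(e^{-\gamma r})$ and $w^{1/2}m^-=O(e^{-\gamma r})$ for $\mathrm{Re}\,r\to\infty$, $w^{1/2}m^+=1+O(e^{\gamma r})$ and $w^{1/2}m^-=-R(k)+O(e^{\gamma r})$ for $\mathrm{Re}\,r\to-\infty$, and $\partial_r(w^{1/2}m^\tau)=O(e^{\mp\gamma r})$ for $\mathrm{Re}\,r\to\pm\infty$. Finally, with $M^\tau_\alpha(r,k,k')=m^+(-r,-k)m^\tau(-\alpha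 r,k')+m^-(r,-k)m^{-\tau}(\alpha r,k')$, one has $M^\alpha_\alpha(r,k,k)=M^\alpha_\alpha(-r,k,k)$ for $\alpha=\pm$, $r,k\in\mathbb R$. *(B)* Let $\kappa,\hat\gamma>0$. For real $r$, $m^\tau(r,k)=v(k)\ell^\tau(r,k)$, where $\ell^\pm(r,\cdot)$ are entire, $v$ is meromorphic on $\mathbb C$, regular on $\mathbb R$, $i\kappa$-(anti)periodic, and $\overline{v(k)}=v(-k)$ for $k\in\mathbb R$; as functions of $k$, $m^+$ is $i\kappa$-periodic and $m^-$ is $i\kappa$-antiperiodic. The dual weight $\hat w(k)=v(-k)v(k)$ (equal to $|v(k)|^2$ on $\mathbb R$) has in $0<\mathrm{Im}\,k<\kappa$ only finitely many singularities, all simple poles; they are enumerated as $2\hat L$ distinct points $k_1,\dots,k_{\hat L}$, $i\kappa-k_1,\dots,i\kappa-k_{\hat L}$, and $\hat w_j=\mathrm{Res}_{k=k_j}\hat w$. There is an entire $i\rho$-(anti)periodic function $C$ with $|C(r)|^2=1/w(r)$ for $r\in\mathbb R$ such that, for real $r$, $m^+(r,k)=C(r)+O(e^{-\hat\gamma k})$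 for $\mathrm{Re}\,k\to\infty$, $m^+(r,k)=\overline{C(r)}+O(e^{\hat\gamma k})$ for $\mathrm{Re}\,k\to-\infty$, and $m^-(r,k)=O(e^{\mp\hat\gamma k})$, $\partial_km^\tau(r,k)=O(e^{\mp\hat\gamma k})$ for $\mathrm{Re}\,k\to\pm\infty$. Finally, with $$L^{\tau,\tau'}(k,r,r')=\ell^\tau(r,k)\ell^{\tau'}(r',-k)+\ell^{-\tau}(-r,k)\ell^{-\tau'}(-r',-k),$$ one has $L^{\tau,\tau'}(k,r,r')=L^{\tau,\tau'}(-k,-r,-r')$ for all $\tau,\tau'$, $k\in\mathbb C$, $r,r'\in\mathbb R$. **Theorem.** Under these assumptions $\mathcal F$ maps $\hat{\mathcal C}$ into $\mathcal H$ and is densely defined in $\hat{\mathcal H}$; its Hilbert space adjoint $\mathcal F^*$ is defined on $\mathcal C$, where $$(\mathcal F^*h)_\delta(k)=\frac{\delta}{\sqrt{2\pi}}\int_{\mathbb R}\Psi(\delta r,-k)h(r)\,dr,\qquad \delta=\pm,\ k>0.$$ For all $f,g\in\mathcal C$, $$(\mathcal F^*f,\mathcal F^*g)_2=(f,g)_1+i\sum_{j=1}^{\hat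 L}\hat w_j\int_{\mathbb R}dr\,\overline{f(r)}\int_{\mathbb R}dr'\,g(r')\,w(r)^{1/2}w(r')^{1/2}\sum_{\tau,\tau'=\pm}\frac{e^{ik_j(\tau r-\tau'r')}}{1-\tau\tau'e^{\kappa(\tau'r'-\tau r)}}L^{\tau,\tau'}(k_j,r,r'),$$ where for each $j$ the double integral (of the sum over $\tau,\tau'$) converges absolutely. Consequently $\mathcal F^*$ is isometric (on $\mathcal C$, and equivalently on its whole domain) if and only if the residue sum $$R(r,r')=i\,w(r)^{1/2}w(r')^{1/2}\sum_{j=1}^{\hat L}\hat w_j\sum_{\tau,\tau'=\pm}\frac{e^{ik_j(\tau r-\tau'r')}}{1-\tau\tau'e^{\kappa(\tau'r'-\tau r)}}L^{\tau,\tau'}(k_j,r,r')$$ vanishes for all real $r\neq r'$. -/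

import Mathlib

open MeasureTheory Set Filter Topology
open scoped ContDiff InnerProductSpace

noncomputable section

namespace JostTransform

/-! Signs `τ, δ, … ∈ {+, -}` are elements of `ℤˣ`. -/

/-- The complex number `±1` given by a sign. -/
def sgn (τ : ℤˣ) : ℂ := ((τ : ℤ) : ℂ)

/-- The real number `±1` given by a sign. -/
def rsgn (τ : ℤˣ) : ℝ := ((τ : ℤ) : ℝ)

/-- `h (z, x) = O(exp (-σ γ z))` for `σ Re z → ∞`, with constants uniform for `Im z` and `x` in
compact subsets of `ℝ`. -/
def ExpSmall (γ : ℝ) (σ : ℤˣ) (h : ℂ → ℝ → ℂ) : Prop :=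
  ∀ K₁ K₂ : Set ℝ, IsCompact K₁ → IsCompact K₂ → ∃ A > 0, ∃ B > 0,
    ∀ z : ℂ, ∀ x ∈ K₁, z.im ∈ K₂ → B ≤ rsgn σ * z.re → ‖h z x‖ ≤ A * Real.exp (-γ * |z.re|)

/-- `F` is periodic or antiperiodic with period `p`. -/
def PeriodicOrAnti (p : ℂ) (F : ℂ → ℂ) : Prop :=
  (∀ z, F (z + p) = F z) ∨ (∀ z, F (z + p) = -F z)

/-- The positive square root `w(r)^{1/2}` at a real point `r`. -/
def sqrtWeight (w : ℂ → ℂ) (r : ℝ) : ℝ := Real.sqrt (w r).re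

/-- `s` is the analytic continuation of `w(r)^{1/2}` from the real half-lines `|r| > B` to the
half-planes `|Re r| > B`, for some `B`. -/
def IsRootNearInfinity (w s : ℂ → ℂ) : Prop :=
  ∃ B : ℝ, (∀ z : ℂ, B < |z.re| → AnalyticAt ℂ s z ∧ s z ^ 2 = w z) ∧
    ∀ r : ℝ, B < |r| → s r = sqrtWeight w r

/-- The wave function `Ψ(r,k) = w(r)^{1/2} ∑_τ m^τ(r,k) exp(iτrk)`. -/
def waveFun (w : ℂ → ℂ) (m : ℤˣ → ℂ → ℂ → ℂ) (r k : ℝ) : ℂ :=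
  sqrtWeight w r * ∑ τ : ℤˣ, m τ r k * Complex.exp (Complex.I * sgn τ * r * k)

/-- `M_α^τ(r,k,k') = m⁺(-r,-k) m^τ(-αr,k') + m⁻(r,-k) m^{-τ}(αr,k')`. -/
def coeffM (m : ℤˣ → ℂ → ℂ → ℂ) (α τ : ℤˣ) (r k k' : ℝ) : ℂ :=
  m 1 (-r) (-k) * m τ (-(sgn α * r)) k' + m (-1) r (-k) * m (-τ) (sgn α * r) k'

/-- Asymptotics in `r` of the coefficients, with `s` the continued square root of `w`. -/
structure SpatialAsymptotics (γ : ℝ) (s : ℂ → ℂ) (m : ℤˣ → ℂ → ℂ → ℂ) (T R : ℝ → ℂ) : Prop where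
  plus_right : ExpSmall γ 1 (fun r k => s r * m 1 r k - T k)
  plus_left : ExpSmall γ (-1) (fun r k => s r * m 1 r k - 1)
  minus_right : ExpSmall γ 1 (fun r k => s r * m (-1) r k)
  minus_left : ExpSmall γ (-1) (fun r k => s r * m (-1) r k + R k)
  deriv_small : ∀ τ σ : ℤˣ, ExpSmall γ σ (fun r k => deriv (fun z => s z * m τ z k) r)

/-- The assumptions on the weight function `w` and the coefficients `m^±` defining the transform.
`w : ℂ → ℂ` is the meromorphic extension of the weight function (its values at poles are
irrelevant). `m τ r k` is used for complex `r` and real `k` (here), and for real `r` and complex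
`k` (in `DualAdmissible`); its values when neither argument is real play no role. -/
structure Admissible (ρ γ : ℝ) (w : ℂ → ℂ) (m : ℤˣ → ℂ → ℂ → ℂ) (T R : ℝ → ℂ) : Prop where
  rho_pos : 0 < ρ
  gamma_pos : 0 < γ
  w_meromorphic : Meromorphic w
  w_analytic_real : ∀ r : ℝ, AnalyticAt ℂ w r
  w_pos : ∀ r : ℝ, (w r).im = 0 ∧ 0 < (w r).re
  w_even : ∀ r : ℝ, w (-r) = w r
  w_periodic : ∀ z, w (z + Complex.I * ρ) = w z
  w_simple_poles : ∀ z : ℂ, 0 < z.im → z.im < ρ → -1 ≤ meromorphicOrderAt w z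
  w_finite_poles : {z : ℂ | 0 < z.im ∧ z.im < ρ ∧ meromorphicOrderAt w z < 0}.Finite
  m_smooth : ∀ τ, ContDiff ℝ ∞ (fun p : ℝ × ℝ => m τ p.1 p.2)
  m_conj : ∀ τ, ∀ r k : ℝ, (starRingEnd ℂ) (m τ r k) = m τ r (-k)
  m_entire : ∀ τ, ∀ k : ℝ, Differentiable ℂ (fun r => m τ r k)
  m_periodic : (∀ τ, ∀ (r : ℂ) (k : ℝ), m τ (r + Complex.I * ρ) k = m τ r k) ∨
    (∀ τ, ∀ (r : ℂ) (k : ℝ), m τ (r + Complex.I * ρ) k = -m τ r k)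
  asymptotics : ∃ s, IsRootNearInfinity w s ∧ SpatialAsymptotics γ s m T R
  T_smooth : ContDiff ℝ ∞ T
  R_smooth : ContDiff ℝ ∞ R
  T_conj : ∀ k, (starRingEnd ℂ) (T k) = T (-k)
  R_conj : ∀ k, (starRingEnd ℂ) (R k) = R (-k)
  unitarity_diag : ∀ k, T (-k) * T k + R (-k) * R k = 1
  unitarity_offdiag : ∀ k, T (-k) * R k + R (-k) * T k = 0
  M_even : ∀ α, ∀ r k : ℝ, coeffM m α α r k k = coeffM m α α (-r) k k

/-- The dual weight function `ŵ(k) = v(-k) v(k)`, which is `|v(k)|²` for real `k`. -/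
def dualWeight (v : ℂ → ℂ) (k : ℂ) : ℂ := v (-k) * v k

/-- `L^{τ,τ'}(k,r,r') = ℓ^τ(r,k) ℓ^{τ'}(r',-k) + ℓ^{-τ}(-r,k) ℓ^{-τ'}(-r',-k)`. -/
def coeffL (l : ℤˣ → ℝ → ℂ → ℂ) (τ τ' : ℤˣ) (k : ℂ) (r r' : ℝ) : ℂ :=
  l τ r k * l τ' r' (-k) + l (-τ) (-r) k * l (-τ') (-r') (-k)

/-- The additional assumptions on the dependence on the spectral variable `k`. -/
structure DualAdmissible (ρ : ℝ) (w : ℂ → ℂ) (m : ℤˣ → ℂ → ℂ → ℂ) (κ γ' : ℝ) (v : ℂ → ℂ)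
    (l : ℤˣ → ℝ → ℂ → ℂ) (C : ℂ → ℂ) : Prop where
  kappa_pos : 0 < κ
  gamma_pos : 0 < γ'
  m_plus_periodic : ∀ (r : ℝ) (k : ℂ), m 1 r (k + Complex.I * κ) = m 1 r k
  m_minus_antiperiodic : ∀ (r : ℝ) (k : ℂ), m (-1) r (k + Complex.I * κ) = -m (-1) r k
  factorization : ∀ τ, ∀ (r : ℝ) (k : ℂ), AnalyticAt ℂ v k → m τ r k = v k * l τ r k
  l_entire : ∀ τ, ∀ r : ℝ, Differentiable ℂ (l τ r)
  v_meromorphic : Meromorphic v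
  v_analytic_real : ∀ k : ℝ, AnalyticAt ℂ v k
  v_periodic : PeriodicOrAnti (Complex.I * κ) v
  v_conj : ∀ k : ℝ, (starRingEnd ℂ) (v k) = v (-k)
  dual_simple_poles : ∀ z : ℂ, 0 < z.im → z.im < κ → -1 ≤ meromorphicOrderAt (dualWeight v) z
  dual_finite_poles : {z : ℂ | 0 < z.im ∧ z.im < κ ∧
    meromorphicOrderAt (dualWeight v) z < 0}.Finite
  plus_right : ExpSmall γ' 1 (fun k r => m 1 r k - C r)
  plus_left : ExpSmall γ' (-1) (fun k r => m 1 r k - (starRingEnd ℂ) (C r))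
  minus_small : ∀ σ : ℤˣ, ExpSmall γ' σ (fun k r => m (-1) r k)
  deriv_small : ∀ τ σ : ℤˣ, ExpSmall γ' σ (fun k r => deriv (fun z => m τ r z) k)
  C_entire : Differentiable ℂ C
  C_periodic : PeriodicOrAnti (Complex.I * ρ) C
  C_normSq : ∀ r : ℝ, ‖C r‖ ^ 2 = 1 / (w r).re
  L_even : ∀ τ τ', ∀ (k : ℂ) (r r' : ℝ), coeffL l τ τ' k r r' = coeffL l τ τ' (-k) (-r) (-r')

/-- The points `κ_j` together with the points `iκ - κ_j`, `j < n`, are distinct and enumerate the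
poles of the dual weight function in the strip `0 < Im k < κ`; `res j` is the residue at the
(simple) pole `κ_j`. -/
structure IsPolePairing (κ : ℝ) (v : ℂ → ℂ) {n : ℕ} (pole res : Fin n → ℂ) : Prop where
  injective : Function.Injective pole
  disjoint : ∀ i j, pole i ≠ Complex.I * κ - pole j
  poles : ∀ z : ℂ, (0 < z.im ∧ z.im < κ ∧ meromorphicOrderAt (dualWeight v) z < 0) ↔
    ∃ j, z = pole j ∨ z = Complex.I * κ - pole j
  residue : ∀ j, Tendsto (fun k => (k - pole j) * dualWeight v k) (𝓝[≠] (pole j)) (𝓝 (res j))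

/-! ### The transform and its adjoint -/

/-- The position Hilbert space `L²(ℝ, dr)`. -/
abbrev PosSpace := Lp ℂ 2 (volume : Measure ℝ)

/-- The momentum Hilbert space `L²((0,∞), dk) ⊗ ℂ²`, with components indexed by signs. -/
abbrev MomSpace := Lp (EuclideanSpace ℂ ℤˣ) 2 (volume.restrict (Ioi (0 : ℝ)))

/-- Smooth functions with compact support on `ℝ`. -/
def IsPosTest (h : ℝ → ℂ) : Prop := ContDiff ℝ ∞ h ∧ HasCompactSupport h

/-- `ℂ²`-valued smooth functions with compact support in `(0,∞)`. -/
def IsMomTest (φ : ℝ → EuclideanSpace ℂ ℤˣ) : Prop :=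
  ContDiff ℝ ∞ φ ∧ HasCompactSupport φ ∧ tsupport φ ⊆ Ioi 0

/-- The integrand `∑_δ F_δ(r,k) f_δ(k)`, where `F₊(r,k) = Ψ(r,k)` and `F₋(r,k) = -Ψ(-r,k)`. -/
def integrand (Ψ : ℝ → ℝ → ℂ) (f : ℝ → EuclideanSpace ℂ ℤˣ) (r k : ℝ) : ℂ :=
  ∑ δ : ℤˣ, sgn δ * Ψ (rsgn δ * r) k * f k δ

/-- `(2π)^{-1/2} ∫_0^∞ ∑_δ F_δ(r,k) f_δ(k) dk`. -/
def transformFun (Ψ : ℝ → ℝ → ℂ) (f : ℝ → EuclideanSpace ℂ ℤˣ) (r : ℝ) : ℂ :=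
  (1 / Real.sqrt (2 * Real.pi) : ℝ) * ∫ k in Ioi (0 : ℝ), integrand Ψ f r k

/-- `δ (2π)^{-1/2} ∫_ℝ Ψ(δr,-k) h(r) dr`. -/
def adjointFun (Ψ : ℝ → ℝ → ℂ) (h : ℝ → ℂ) (δ : ℤˣ) (k : ℝ) : ℂ :=
  sgn δ * (1 / Real.sqrt (2 * Real.pi) : ℝ) * ∫ r : ℝ, Ψ (rsgn δ * r) (-k) * h r

theorem integrand_congr {Ψ : ℝ → ℝ → ℂ} {f g : ℝ → EuclideanSpace ℂ ℤˣ}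
    (h : f =ᵐ[volume.restrict (Ioi (0 : ℝ))] g) (r : ℝ) :
    integrand Ψ f r =ᵐ[volume.restrict (Ioi (0 : ℝ))] integrand Ψ g r := by
  filter_upwards [h] with k hk
  simp only [integrand, hk]

theorem transformFun_congr {Ψ : ℝ → ℝ → ℂ} {f g : ℝ → EuclideanSpace ℂ ℤˣ}
    (h : f =ᵐ[volume.restrict (Ioi (0 : ℝ))] g) : transformFun Ψ f = transformFun Ψ g := by
  funext r
  simp only [transformFun, integral_congr_ae (integrand_congr h r)]

theorem integrand_add (Ψ : ℝ → ℝ → ℂ) (f g : ℝ → EuclideanSpace ℂ ℤˣ) (r : ℝ) :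
    integrand Ψ (f + g) r = integrand Ψ f r + integrand Ψ g r := by
  funext k
  simp [integrand, mul_add, Finset.sum_add_distrib]

theorem integrand_smul (Ψ : ℝ → ℝ → ℂ) (c : ℂ) (f : ℝ → EuclideanSpace ℂ ℤˣ) (r : ℝ) :
    integrand Ψ (c • f) r = c • integrand Ψ f r := by
  funext k
  simp only [integrand, Pi.smul_apply, PiLp.smul_apply, smul_eq_mul, Finset.mul_sum]
  exact Finset.sum_congr rfl fun δ _ => by ring

theorem transformFun_add {Ψ : ℝ → ℝ → ℂ} {f g : ℝ → EuclideanSpace ℂ ℤˣ}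
    (hf : ∀ r, IntegrableOn (integrand Ψ f r) (Ioi 0))
    (hg : ∀ r, IntegrableOn (integrand Ψ g r) (Ioi 0)) :
    transformFun Ψ (f + g) = transformFun Ψ f + transformFun Ψ g := by
  funext r
  simp only [transformFun, integrand_add, Pi.add_apply]
  rw [integral_add (hf r) (hg r), mul_add]

theorem transformFun_smul (Ψ : ℝ → ℝ → ℂ) (c : ℂ) (f : ℝ → EuclideanSpace ℂ ℤˣ) :
    transformFun Ψ (c • f) = c • transformFun Ψ f := by
  funext r
  simp only [transformFun, integrand_smul, Pi.smul_apply, smul_eq_mul]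
  rw [integral_const_mul]
  ring

/-- The domain of the transform: (classes of) test functions whose image is a well-defined square
integrable function. -/
def transformDomain (Ψ : ℝ → ℝ → ℂ) : Submodule ℂ MomSpace where
  carrier := {f | (∃ φ, IsMomTest φ ∧ f =ᵐ[volume.restrict (Ioi (0 : ℝ))] φ) ∧
    (∀ r, IntegrableOn (integrand Ψ f r) (Ioi 0)) ∧ MemLp (transformFun Ψ f) 2 volume}
  add_mem' := by
    rintro f g ⟨⟨φ, hφ, hfφ⟩, hf1, hf2⟩ ⟨⟨χ, hχ, hgχ⟩, hg1, hg2⟩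
    have hadd := Lp.coeFn_add f g
    refine ⟨⟨φ + χ, ⟨hφ.1.add hχ.1, hφ.2.1.add hχ.2.1, ?_⟩, ?_⟩, ?_, ?_⟩
    · exact (tsupport_add φ χ).trans (union_subset hφ.2.2 hχ.2.2)
    · filter_upwards [hadd, hfφ, hgχ] with k h1 h2 h3
      rw [h1, Pi.add_apply, Pi.add_apply, h2, h3]
    · intro r
      refine Integrable.congr ?_ (integrand_congr hadd r).symm
      rw [integrand_add]
      exact (hf1 r).add (hg1 r)
    · rw [transformFun_congr hadd, transformFun_add hf1 hg1]
      exact hf2.add hg2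
  zero_mem' := by
    have h0 := Lp.coeFn_zero (EuclideanSpace ℂ ℤˣ) 2 (volume.restrict (Ioi (0 : ℝ)))
    have hi : ∀ r, integrand Ψ (0 : ℝ → EuclideanSpace ℂ ℤˣ) r = 0 := by
      intro r
      funext k
      simp [integrand]
    refine ⟨⟨0, ⟨contDiff_const, HasCompactSupport.zero, by simp⟩, h0⟩, ?_, ?_⟩
    · intro r
      refine Integrable.congr ?_ (integrand_congr h0 r).symm
      rw [hi]
      exact integrable_zero _ _ _
    · rw [transformFun_congr h0]
      have : transformFun Ψ (0 : ℝ → EuclideanSpace ℂ ℤˣ) = 0 := by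
        funext r
        simp [transformFun, hi]
      rw [this]
      exact MemLp.zero
  smul_mem' := by
    rintro c f ⟨⟨φ, hφ, hfφ⟩, hf1, hf2⟩
    have hs := Lp.coeFn_smul c f
    refine ⟨⟨c • φ, ⟨contDiff_const.smul hφ.1, hφ.2.1.smul_left (f := fun _ => c), ?_⟩, ?_⟩,
      ?_, ?_⟩
    · exact (tsupport_smul_subset_right (fun _ => c) φ).trans hφ.2.2
    · filter_upwards [hs, hfφ] with k h1 h2
      rw [h1, Pi.smul_apply, Pi.smul_apply, h2]
    · intro r
      refine Integrable.congr ?_ (integrand_congr hs r).symm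
      rw [integrand_smul]
      exact (hf1 r).smul c
    · rw [transformFun_congr hs, transformFun_smul]
      exact hf2.const_smul c

/-- The transform `F` with kernel given by `Ψ`, as a partially defined operator between the
Hilbert spaces. Its Hilbert space adjoint is `(transform Ψ).adjoint`. -/
def transform (Ψ : ℝ → ℝ → ℂ) : MomSpace →ₗ.[ℂ] PosSpace where
  domain := transformDomain Ψ
  toFun :=
    { toFun := fun f => f.2.2.2.toLp
      map_add' := by
        intro f g
        rw [← MemLp.toLp_add]
        congr 1
        rw [← transformFun_add f.2.2.1 g.2.2.1]
        exact transformFun_congr (Lp.coeFn_add _ _)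
      map_smul' := by
        intro c f
        rw [RingHom.id_apply, ← MemLp.toLp_const_smul]
        congr 1
        rw [← transformFun_smul]
        exact transformFun_congr (Lp.coeFn_smul _ _) }

/-! ### The residue sum -/

/-- `w(r)^{1/2} w(r')^{1/2} ∑_{τ,τ'} exp(ik(τr-τ'r')) L^{τ,τ'}(k,r,r') /
(1 - ττ' exp(κ(τ'r'-τr)))`. -/
def residueKernel (w : ℂ → ℂ) (κ : ℝ) (l : ℤˣ → ℝ → ℂ → ℂ) (k : ℂ) (r r' : ℝ) : ℂ :=
  sqrtWeight w r * sqrtWeight w r' * ∑ τ : ℤˣ, ∑ τ' : ℤˣ,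
    Complex.exp (Complex.I * k * (sgn τ * r - sgn τ' * r')) /
      (1 - sgn τ * sgn τ' * Complex.exp (κ * (sgn τ' * r' - sgn τ * r))) * coeffL l τ τ' k r r'

/-- The residue sum `R(r,r')`; it is meaningful for `r ≠ r'`. -/
def residueSum (w : ℂ → ℂ) (κ : ℝ) (l : ℤˣ → ℝ → ℂ → ℂ) {n : ℕ} (pole res : Fin n → ℂ)
    (r r' : ℝ) : ℂ :=
  Complex.I * ∑ j, res j * residueKernel w κ l (pole j) r r'

end JostTransform

end

open JostTransform

namespace JostTransform

/-! The inner product of two adjoint transforms is an integral over `k > 0`. It is unfolded to the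
whole line and evaluated by comparing the real axis with its translate by `iκ`. The evenness of `L`
shows that `∑_δ Ψ(δr,k) Ψ(δr',-k)` equals `w(r)^{1/2} w(r')^{1/2}` times the symmetrization in `k`
of one function, `spectralDensity` (`DualAdmissible.sum_waveFun_mul_waveFun`). Hence `2π (F*f, F*g)`
is the limit, as `P → ∞`, of the integral of that function over `[-P, P]`, smeared with `f` and `g`.

For signs `τ, τ'` put `a = τr - τ'r'`. The function `ŵ L^{τ,τ'} exp(ika)` acquires the factor `ττ'
exp(-κa)` under `k ↦ k + iκ`. The contour integral over a rectangle of height `κ` is therefore `1 -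
ττ' exp(-κa)` times the bottom integral plus the vertical sides; dividing produces the denominators
of the residue sum. Evenness and quasi-periodicity turn the residue at `iκ - k_j` into the term at
`k_j` with both signs reversed (`DualAdmissible.contour_identity`). On the vertical sides the
asymptotics of `m^±` leave a Dirichlet kernel with coefficient `C(r) conj(C(r'))`, and a term
oscillating like `exp(-iP(r-r'))` with locally bounded coefficient
(`DualAdmissible.exists_norm_sub_spectralLimit_le`). In the limit the Dirichlet kernel gives `2π
(f,g)` because `w |C|² = 1`, and the oscillating term dies by the Riemann-Lebesgue lemma.

The difficulty sits on the diagonal `r = r'`, where the denominators with `τ = τ'` vanish, while no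
regularity of `ℓ^τ(r,k)` in `r` is assumed for non-real `k`. Two facts resolve it. The symmetry of
`L` makes the numerators of the two singular terms agree on the diagonal
(`DualAdmissible.coeffL_swap`). And `ℓ^τ(·,k)` is locally Hölder in the strip by a two-constants
argument: smoothness on the real axis is carried to `Im k = ±κ` by quasi-periodicity and then
interpolated inwards (`DualAdmissible.exists_holder`). So the residue kernel is `O(|r-r'|^{θ-1})`
and locally integrable. The truncation error is `O(exp(-γ'P)/|r-r'|)` and also, crudely,
`O((1+P)|r-r'|^{θ-1})`; the geometric mean of these bounds is an integrable majorant independent of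
`P`, so dominated convergence applies.

The operator-theoretic part rests on decay: the kernels approach plane waves exponentially fast, so
transforms of test functions are `O(1/(1+x²))` (`exists_norm_integral_le`), and Fubini identifies
the adjoint. For the isometry criterion, polarization together with bump functions isolates the
residue sum at each off-diagonal point, where it is continuous. Closedness of the adjoint passes
from test functions to the whole domain. -/

/-! ### Residues on rectangles -/

/-- The integral of `f` over the boundary of `[-P, P] × [0, κ]`. -/
noncomputable def rectIntegral (f : ℂ → ℂ) (P κ : ℝ) : ℂ :=
  (∫ x : ℝ in -P..P, f x) - (∫ x : ℝ in -P..P, f (x + κ * Complex.I)) +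
    Complex.I * (∫ y : ℝ in (0 : ℝ)..κ, f (P + y * Complex.I)) -
    Complex.I * ∫ y : ℝ in (0 : ℝ)..κ, f (-P + y * Complex.I)

/-- Interval integrability of `f` along the boundary of `[-P, P] × [0, κ]`. -/
structure RectIntegrable (f : ℂ → ℂ) (P κ : ℝ) : Prop where
  bottom : IntervalIntegrable (fun x : ℝ => f x) volume (-P) P
  top : IntervalIntegrable (fun x : ℝ => f (x + κ * Complex.I)) volume (-P) P
  right : IntervalIntegrable (fun y : ℝ => f (P + y * Complex.I)) volume 0 κ
  left : IntervalIntegrable (fun y : ℝ => f (-P + y * Complex.I)) volume 0 κ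

/-- The boundary of `[-P, P] × [0, κ]`. -/
def rectBoundary (P κ : ℝ) : Set ℂ :=
  {z | z.re ∈ Icc (-P) P ∧ z.im ∈ Icc 0 κ ∧ (|z.re| = P ∨ z.im = 0 ∨ z.im = κ)}

theorem rectIntegrable_of_continuousOn {f : ℂ → ℂ} {P κ : ℝ} (hP : 0 ≤ P) (hκ : 0 ≤ κ)
    (hf : ContinuousOn f (rectBoundary P κ)) : RectIntegrable f P κ := by
  constructor
  · refine (hf.comp (g := f) (f := fun x : ℝ => (x : ℂ)) (by fun_prop) ?_).intervalIntegrable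
    intro x hx
    rw [uIcc_of_le (by linarith)] at hx
    simp [rectBoundary, hx.1, hx.2, hκ]
  · refine (hf.comp (g := f) (f := fun x : ℝ => (x + κ * Complex.I : ℂ)) (by fun_prop)
      ?_).intervalIntegrable
    intro x hx
    rw [uIcc_of_le (by linarith)] at hx
    simp [rectBoundary, hx.1, hx.2, hκ]
  · refine (hf.comp (g := f) (f := fun y : ℝ => (P + y * Complex.I : ℂ)) (by fun_prop)
      ?_).intervalIntegrable
    intro x hx
    rw [uIcc_of_le hκ] at hx
    simp [rectBoundary, hx.1, hx.2, hP, abs_of_nonneg]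
  · refine (hf.comp (g := f) (f := fun y : ℝ => (-P + y * Complex.I : ℂ)) (by fun_prop)
      ?_).intervalIntegrable
    intro x hx
    rw [uIcc_of_le hκ] at hx
    simp [rectBoundary, hx.1, hx.2, hP, abs_of_nonneg]

theorem rectIntegral_add {f g : ℂ → ℂ} {P κ : ℝ} (hf : RectIntegrable f P κ)
    (hg : RectIntegrable g P κ) :
    rectIntegral (fun z => f z + g z) P κ = rectIntegral f P κ + rectIntegral g P κ := by
  simp only [rectIntegral]
  rw [intervalIntegral.integral_add hf.bottom hg.bottom,
    intervalIntegral.integral_add hf.top hg.top,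
    intervalIntegral.integral_add hf.right hg.right,
    intervalIntegral.integral_add hf.left hg.left]
  ring

theorem rectIntegral_const_mul (c : ℂ) (f : ℂ → ℂ) (P κ : ℝ) :
    rectIntegral (fun z => c * f z) P κ = c * rectIntegral f P κ := by
  simp only [rectIntegral, intervalIntegral.integral_const_mul]
  ring

theorem rectIntegral_finset_sum {ι : Type*} (s : Finset ι) {f : ι → ℂ → ℂ} {P κ : ℝ}
    (hf : ∀ i ∈ s, RectIntegrable (f i) P κ) :
    rectIntegral (fun z => ∑ i ∈ s, f i z) P κ = ∑ i ∈ s, rectIntegral (f i) P κ := by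
  simp only [rectIntegral]
  rw [intervalIntegral.integral_finsetSum fun i hi => (hf i hi).bottom,
    intervalIntegral.integral_finsetSum fun i hi => (hf i hi).top,
    intervalIntegral.integral_finsetSum fun i hi => (hf i hi).right,
    intervalIntegral.integral_finsetSum fun i hi => (hf i hi).left]
  simp only [Finset.mul_sum, Finset.sum_add_distrib, Finset.sum_sub_distrib]

theorem rectIntegral_congr {f g : ℂ → ℂ} {P κ : ℝ} (hP : 0 ≤ P) (hκ : 0 ≤ κ)
    (h : EqOn f g (rectBoundary P κ)) : rectIntegral f P κ = rectIntegral g P κ := by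
  simp only [rectIntegral]
  congr 1
  · congr 1
    · congr 1
      · refine intervalIntegral.integral_congr fun x hx => h ?_
        rw [uIcc_of_le (by linarith)] at hx
        simp [rectBoundary, hx.1, hx.2, hκ]
      · refine intervalIntegral.integral_congr fun x hx => h ?_
        rw [uIcc_of_le (by linarith)] at hx
        simp [rectBoundary, hx.1, hx.2, hκ]
    · congr 1
      refine intervalIntegral.integral_congr fun x hx => h ?_
      rw [uIcc_of_le hκ] at hx
      simp [rectBoundary, hx.1, hx.2, hP, abs_of_nonneg]
  · congr 1
    refine intervalIntegral.integral_congr fun x hx => h ?_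
    rw [uIcc_of_le hκ] at hx
    simp [rectBoundary, hx.1, hx.2, hP, abs_of_nonneg]

theorem rectIntegral_eq_zero {f : ℂ → ℂ} {P κ : ℝ} (hP : 0 ≤ P) (hκ : 0 ≤ κ)
    (hf : ∀ z : ℂ, z.re ∈ Icc (-P) P → z.im ∈ Icc 0 κ → DifferentiableAt ℂ f z) :
    rectIntegral f P κ = 0 := by
  have := Complex.integral_boundary_rect_eq_zero_of_differentiableOn f (-P : ℝ)
    (P + κ * Complex.I) (fun z hz => by
      rw [Complex.mem_reProdIm] at hz
      simp only [Complex.ofReal_re, Complex.add_re, Complex.mul_re, Complex.I_re, mul_zero,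
        Complex.I_im, mul_one, Complex.ofReal_im, Complex.add_im, Complex.mul_im] at hz
      norm_num at hz
      rw [uIcc_of_le (by linarith), uIcc_of_le hκ] at hz
      exact (hf z hz.1 hz.2).differentiableWithinAt)
  simpa [rectIntegral] using this

/-- A quarter turn of the right half-plane stays off the branch cut. This is the jump between the
logarithms used on two adjacent sides of a rectangle. -/
theorem log_I_mul {u : ℂ} (hu : 0 < u.re) :
    Complex.log (Complex.I * u) = Complex.log u + Real.pi / 2 * Complex.I := by
  have h0 : u ≠ 0 := by
    rintro rfl
    simp at hu
  have ha := (abs_lt.1 (Complex.abs_arg_lt_pi_div_two_iff.2 (Or.inl hu)))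
  rw [(Complex.log_mul_eq_add_log_iff Complex.I_ne_zero h0).2, Complex.log_I]
  · ring
  · rw [Complex.arg_I]
    constructor <;> linarith [Real.pi_pos, ha.1, ha.2]

/-- The constant `c` rotates the segment, seen from `p`, into the right half-plane, so that the
principal branch of `log (c (z - p))` is a primitive along all of it. -/
theorem integral_inv_eq_log_sub (a b c p : ℂ) (s t : ℝ) (hc : c ≠ 0)
    (h : ∀ x ∈ uIcc s t, 0 < (c * (a + x * b - p)).re) :
    b * ∫ x : ℝ in s..t, (a + x * b - p)⁻¹ =
      Complex.log (c * (a + t * b - p)) - Complex.log (c * (a + s * b - p)) := by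
  rw [← intervalIntegral.integral_const_mul]
  have hne : ∀ x ∈ uIcc s t, a + x * b - p ≠ 0 := by
    intro x hx h0
    have := h x hx
    rw [h0] at this
    simp at this
  refine intervalIntegral.integral_eq_sub_of_hasDerivAt
    (f := fun x : ℝ => Complex.log (c * (a + x * b - p))) ?_ ?_
  · intro x hx
    have h1 : HasDerivAt (fun x : ℝ => c * (a + x * b - p)) (c * b) x := by
      have h2 : HasDerivAt (fun x : ℝ => (x : ℂ)) 1 x := Complex.ofRealCLM.hasDerivAt
      simpa using (((h2.mul_const b).const_add a).sub_const p).const_mul c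
    have := h1.clog_real (Or.inl (h x hx))
    rw [mul_div_mul_left _ _ hc, div_eq_mul_inv] at this
    exact this
  · refine ContinuousOn.intervalIntegrable ?_
    exact continuousOn_const.mul (ContinuousOn.inv₀ (by fun_prop) hne)

/-- Each side has its own branch of the logarithm, with rotation `I`, `-I`, `1` or `-1`. The four
corner jumps of `πi/2` add up to `2πi`. -/
theorem rectIntegral_inv {p : ℂ} {P κ : ℝ} (hp : |p.re| < P) (hp0 : 0 < p.im) (hpκ : p.im < κ) :
    rectIntegral (fun z => (z - p)⁻¹) P κ = 2 * Real.pi * Complex.I := by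
  obtain ⟨h1, h2⟩ := abs_lt.1 hp
  have e1 := integral_inv_eq_log_sub 0 1 Complex.I p (-P) P Complex.I_ne_zero
    (fun x _ => by simp [hp0])
  have e2 := integral_inv_eq_log_sub (κ * Complex.I) 1 (-Complex.I) p (-P) P (by simp)
    (fun x _ => by simp [hpκ])
  have e3 := integral_inv_eq_log_sub P Complex.I 1 p 0 κ (by simp) (fun x _ => by simp [h2])
  have e4 := integral_inv_eq_log_sub (-P) Complex.I (-1) p 0 κ (by simp)
    (fun x _ => by simp; linarith)
  -- One comparison per corner: bottom right, top right, top left, bottom left.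
  have l1 := log_I_mul (u := P - p) (by simp [h2])
  have l2 := log_I_mul (u := -Complex.I * (P + κ * Complex.I - p)) (by simp [hpκ])
  have l3 := log_I_mul (u := -(-P + κ * Complex.I - p)) (by simp; linarith)
  have l4 := log_I_mul (u := Complex.I * (-P - p)) (by simp [hp0])
  have r2 : Complex.I * (-Complex.I * (P + κ * Complex.I - p)) = P + κ * Complex.I - p := by
    linear_combination (-(P + κ * Complex.I - p)) * Complex.I_sq
  have r3 : Complex.I * -(-P + κ * Complex.I - p) = -Complex.I * (-P + κ * Complex.I - p) := by
    ring
  have r4 : Complex.I * (Complex.I * (-P - p)) = -(-P - p) := by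
    linear_combination (-P - p) * Complex.I_sq
  rw [r2] at l2
  rw [r3] at l3
  rw [r4] at l4
  simp only [zero_add, mul_one, one_mul, Complex.ofReal_zero, zero_mul, add_zero,
    Complex.ofReal_neg, neg_one_mul, add_comm (κ * Complex.I : ℂ)] at e1 e2 e3 e4
  simp only [rectIntegral]
  rw [e1, e2, e3, e4, l1, l2, l3, l4]
  ring

/-- The difference quotient `dslope E p` is entire, so it contributes nothing, and only `E p / (z -
p)` remains. -/
theorem rectIntegral_div_sub {E : ℂ → ℂ} (hE : Differentiable ℂ E) {p : ℂ} {P κ : ℝ}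
    (hp : |p.re| < P) (hp0 : 0 < p.im) (hpκ : p.im < κ) :
    rectIntegral (fun z => (z - p)⁻¹ * E z) P κ = 2 * Real.pi * Complex.I * E p := by
  have hP : 0 ≤ P := (abs_nonneg _).trans hp.le
  have hκ : 0 ≤ κ := (hp0.trans hpκ).le
  have hne : ∀ z ∈ rectBoundary P κ, z ≠ p := by
    rintro z ⟨-, -, h⟩ rfl
    rcases h with h | h | h <;> linarith
  have hd : Differentiable ℂ (dslope E p) := fun z =>
    ((Complex.differentiableOn_dslope univ_mem).2 hE.differentiableOn).differentiableAt univ_mem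
  have hc : ContinuousOn (fun z => (z - p)⁻¹) (rectBoundary P κ) :=
    ContinuousOn.inv₀ (by fun_prop) fun z hz => sub_ne_zero.2 (hne z hz)
  have hi : RectIntegrable (fun z => E p * (z - p)⁻¹) P κ :=
    rectIntegrable_of_continuousOn hP hκ (continuousOn_const.mul hc)
  rw [rectIntegral_congr (g := fun z => dslope E p z + E p * (z - p)⁻¹) hP hκ,
    rectIntegral_add (rectIntegrable_of_continuousOn hP hκ hd.continuous.continuousOn)
      hi,
    rectIntegral_const_mul, rectIntegral_inv hp hp0 hpκ,
    rectIntegral_eq_zero hP hκ fun z _ _ => hd z]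
  · ring
  · intro z hz
    have hz' := sub_ne_zero.2 (hne z hz)
    simp only
    rw [dslope_of_ne _ (hne z hz), slope_def_field]
    field_simp
    ring

/-! ### Fourier integrals of test functions -/

theorem IsPosTest.integrable {φ : ℝ → ℂ} (hφ : IsPosTest φ) : Integrable φ :=
  hφ.1.continuous.integrable_of_hasCompactSupport hφ.2

/-- The integral is a rescaled Fourier transform of a Schwartz function. -/
theorem exists_norm_integral_exp_mul_le {φ : ℝ → ℂ} (hφ : IsPosTest φ) :
    ∃ A, 0 ≤ A ∧ ∀ r : ℝ, ‖∫ k : ℝ, Complex.exp (Complex.I * r * k) * φ k‖ ≤ A / (1 + r ^ 2) := by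
  set S := FourierTransform.fourier (hφ.2.toSchwartzMap hφ.1) with hS
  have key : ∀ r : ℝ, ∫ k : ℝ, Complex.exp (Complex.I * r * k) * φ k =
      S (-(r / (2 * Real.pi))) := by
    intro r
    rw [hS, SchwartzMap.fourier_coe, Real.fourier_real_eq_integral_exp_smul]
    refine integral_congr_ae (Eventually.of_forall fun k => ?_)
    simp only [smul_eq_mul]
    congr 2
    push_cast
    field_simp
  obtain ⟨A, hA⟩ := S.decay 0 0
  obtain ⟨D, hD⟩ := S.decay 2 0
  -- The Schwartz bounds of orders 0 and 2 are added to control `1 + r²`; the factor `(2π)²` undoes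
  -- the rescaling of the frequency.
  refine ⟨|A| + |D| * (2 * Real.pi) ^ 2, by positivity, fun r => ?_⟩
  rw [key, le_div_iff₀ (by positivity)]
  have h1 := hA.2 (-(r / (2 * Real.pi)))
  have h2 := hD.2 (-(r / (2 * Real.pi)))
  simp only [norm_iteratedFDeriv_zero, pow_zero, one_mul, norm_neg, Real.norm_eq_abs, sq_abs,
    div_pow] at h1 h2
  have hpi : 0 < (2 * Real.pi) ^ 2 := by positivity
  rw [div_mul_eq_mul_div, div_le_iff₀ hpi] at h2
  nlinarith [le_abs_self A, le_abs_self D, norm_nonneg (S (-(r / (2 * Real.pi))))]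

theorem memLp_two_of_norm_le {μ : Measure ℝ} (hμ : μ ≤ volume) {u : ℝ → ℂ}
    (hu : AEStronglyMeasurable u μ)
    {A : ℝ} (h : ∀ᵐ r ∂μ, ‖u r‖ ≤ A / (1 + r ^ 2)) : MemLp u 2 μ := by
  rw [memLp_two_iff_integrable_sq_norm hu]
  refine Integrable.mono' ((integrable_inv_one_add_sq.const_mul (A ^ 2)).mono_measure hμ)
    (hu.norm.pow 2) ?_
  filter_upwards [h] with r hr
  rw [Real.norm_of_nonneg (by positivity)]
  have h1 : ‖u r‖ ^ 2 ≤ (A / (1 + r ^ 2)) ^ 2 := by gcongr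
  refine h1.trans ?_
  rw [div_pow, div_eq_mul_inv]
  gcongr
  nlinarith [sq_nonneg r, sq_nonneg (r ^ 2)]

theorem exists_exp_neg_mul_abs_le {γ : ℝ} (hγ : 0 < γ) :
    ∃ A, 0 ≤ A ∧ ∀ r : ℝ, Real.exp (-γ * |r|) ≤ A / (1 + r ^ 2) := by
  refine ⟨1 + 2 / γ ^ 2, by positivity, fun r => ?_⟩
  rw [neg_mul, Real.exp_neg, ← one_div, div_le_div_iff₀ (Real.exp_pos _) (by positivity)]
  have h := Real.quadratic_le_exp_of_nonneg (x := γ * |r|) (by positivity)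
  have h2 : 1 + (γ * |r|) ^ 2 / 2 ≤ Real.exp (γ * |r|) := by
    have : 0 ≤ γ * |r| := by positivity
    linarith
  have h3 : 1 + r ^ 2 ≤ (1 + 2 / γ ^ 2) * (1 + (γ * |r|) ^ 2 / 2) := by
    rw [mul_pow, sq_abs]
    have e : (1 + 2 / γ ^ 2) * (1 + γ ^ 2 * r ^ 2 / 2) =
        1 + r ^ 2 + 2 / γ ^ 2 + γ ^ 2 * r ^ 2 / 2 := by
      field_simp
      ring
    rw [e]
    have : 0 ≤ 2 / γ ^ 2 + γ ^ 2 * r ^ 2 / 2 := by positivity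
    linarith
  rw [one_mul]
  exact h3.trans (by gcongr)

/-- Fourier inversion: the inner integral is `exp(ikr)` times an integrable Fourier transform, so
the truncated integrals converge to the full one. -/
theorem tendsto_integral_exp_mul_fourier {β : ℝ → ℂ} (hβ : IsPosTest β) (r : ℝ) :
    Tendsto (fun P : ℝ => ∫ k in -P..P, ∫ r' : ℝ, β r' * Complex.exp (Complex.I * k * (r - r')))
      atTop (𝓝 (2 * Real.pi * β r)) := by
  set B : ℝ → ℂ := fun k => ∫ r' : ℝ, β r' * Complex.exp (Complex.I * k * (r - r')) with hB
  set S := FourierTransform.fourier (hβ.2.toSchwartzMap hβ.1) with hS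
  have hβc : ∀ x, (hβ.2.toSchwartzMap hβ.1) x = β x := fun x => rfl
  have key : ∀ k : ℝ, B k = Complex.exp (Complex.I * k * r) * S (k / (2 * Real.pi)) := by
    intro k
    rw [hS, SchwartzMap.fourier_coe, Real.fourier_real_eq_integral_exp_smul,
      ← integral_const_mul]
    refine integral_congr_ae (Eventually.of_forall fun r' => ?_)
    simp only [smul_eq_mul, hβc]
    rw [← mul_assoc, ← Complex.exp_add, mul_comm]
    congr 2
    push_cast
    field_simp
    ring
  have hint : Integrable B := by
    have h1 : Integrable (fun k : ℝ => S (k / (2 * Real.pi))) :=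
      S.integrable.comp_div (by positivity)
    refine (h1.bdd_mul (f := fun k : ℝ => Complex.exp (Complex.I * k * r)) (c := 1)
      (by fun_prop) ?_).congr (Eventually.of_forall fun k => (key k).symm)
    refine Eventually.of_forall fun k => ?_
    rw [show Complex.I * k * r = ((k * r : ℝ) : ℂ) * Complex.I by push_cast; ring,
      Complex.norm_exp_ofReal_mul_I]
  have hlim := intervalIntegral_tendsto_integral hint tendsto_neg_atTop_atBot tendsto_id
  have hval : ∫ k, B k = 2 * Real.pi * β r := by
    have h1 : (FourierTransformInv.fourierInv S) r = β r := by
      rw [hS, FourierTransform.fourierInv_fourier_eq]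
      rfl
    rw [SchwartzMap.fourierInv_coe, Real.fourierInv_eq'] at h1
    rw [← h1]
    have h2 := Measure.integral_comp_div (fun x : ℝ => Complex.exp (↑(2 * Real.pi * inner ℝ x r) *
      Complex.I) • S x) (2 * Real.pi)
    rw [abs_of_pos (by positivity)] at h2
    have h3 : ∫ k, B k = ∫ k : ℝ, Complex.exp (↑(2 * Real.pi * inner ℝ (k / (2 * Real.pi)) r) *
      Complex.I) • S (k / (2 * Real.pi)) := by
      refine integral_congr_ae (Eventually.of_forall fun k => ?_)
      simp only [key, smul_eq_mul]
      congr 2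
      simp only [RCLike.inner_apply, conj_trivial]
      push_cast
      field_simp
    rw [h3, h2, Complex.real_smul]
    push_cast
    rfl
  rw [hval] at hlim
  exact hlim

theorem norm_exp_I_mul_ofReal (x : ℝ) : ‖Complex.exp (Complex.I * x)‖ = 1 := by
  rw [mul_comm, Complex.norm_exp_ofReal_mul_I]

theorem norm_exp_I_mul_mul_sub (k r r' : ℝ) : ‖Complex.exp (Complex.I * k * (r - r'))‖ = 1 := by
  rw [show Complex.I * k * (r - r') = Complex.I * ((k * (r - r') : ℝ) : ℂ) by push_cast; ring]
  exact norm_exp_I_mul_ofReal _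

theorem norm_intervalIntegral_exp_le {P : ℝ} (hP : 0 ≤ P) (p : ℝ × ℝ) :
    ‖∫ k in -P..P, Complex.exp (Complex.I * k * (p.1 - p.2))‖ ≤ 2 * P := by
  refine (intervalIntegral.norm_integral_le_of_norm_le_const (C := 1) fun k _ => ?_).trans ?_
  · exact (norm_exp_I_mul_mul_sub k p.1 p.2).le
  · rw [one_mul, abs_of_nonneg (by linarith)]
    linarith

theorem continuous_intervalIntegral_exp (P : ℝ) :
    Continuous fun p : ℝ × ℝ => ∫ k in -P..P, Complex.exp (Complex.I * k * (p.1 - p.2)) := by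
  apply intervalIntegral.continuous_parametric_intervalIntegral_of_continuous'
  fun_prop

theorem integrable_mul_dirichlet {α β : ℝ → ℂ} (hα : Integrable α) (hβ : Integrable β) {P : ℝ}
    (hP : 0 ≤ P) :
    Integrable (fun p : ℝ × ℝ => α p.1 * β p.2 *
      ∫ k in -P..P, Complex.exp (Complex.I * k * (p.1 - p.2))) (volume.prod volume) :=
  (hα.mul_prod hβ).mul_bdd (c := 2 * P) (continuous_intervalIntegral_exp P).aestronglyMeasurable
    (Eventually.of_forall fun p => norm_intervalIntegral_exp_le hP p)

/-- The Dirichlet kernels tend to `2π` times the delta function on the diagonal. After Fubini the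
limit is pointwise in `r` by Fourier inversion. The bound `A / (1 + k²)` on the inner integrals is
uniform in `r`, which gives the majorant `‖α r‖ A π`. -/
theorem tendsto_integral_dirichlet {α β : ℝ → ℂ} (hα : Integrable α) (hβ : IsPosTest β) :
    Tendsto (fun P : ℝ => ∫ p : ℝ × ℝ, α p.1 * β p.2 *
      (∫ k in -P..P, Complex.exp (Complex.I * k * (p.1 - p.2))) ∂(volume.prod volume)) atTop
      (𝓝 (2 * Real.pi * ∫ r, α r * β r)) := by
  set B : ℝ → ℝ → ℂ := fun r k => ∫ r' : ℝ, β r' * Complex.exp (Complex.I * k * (r - r')) with hB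
  obtain ⟨A, hA0, hA⟩ := exists_norm_integral_exp_mul_le hβ
  have hBn : ∀ r k, ‖B r k‖ ≤ A / (1 + k ^ 2) := by
    intro r k
    have : B r k = Complex.exp (Complex.I * (k * r : ℝ)) *
        ∫ r' : ℝ, Complex.exp (Complex.I * (-k : ℝ) * r') * β r' := by
      rw [← integral_const_mul]
      refine integral_congr_ae (Eventually.of_forall fun r' => ?_)
      simp only
      rw [← mul_assoc, ← Complex.exp_add, mul_comm]
      congr 2
      push_cast
      ring
    rw [this, norm_mul, norm_exp_I_mul_ofReal, one_mul]
    simpa using hA (-k)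
  have hswap : ∀ P : ℝ, 0 ≤ P → ∀ r, ∫ r', α r * β r' *
      (∫ k in -P..P, Complex.exp (Complex.I * k * (r - r'))) = α r * ∫ k in -P..P, B r k := by
    intro P hP r
    simp only [mul_assoc (α r)]
    rw [integral_const_mul]
    congr 1
    rw [intervalIntegral.integral_of_le (by linarith)]
    simp only [hB, intervalIntegral.integral_of_le (show -P ≤ P by linarith),
      ← integral_const_mul]
    rw [integral_integral_swap]
    have : Integrable (fun p : ℝ × ℝ => β p.1 * (1 : ℂ))
        (volume.prod (volume.restrict (Ioc (-P) P))) :=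
      hβ.integrable.mul_prod (integrable_const _)
    refine (this.mul_bdd (c := 1)
      (g := fun p : ℝ × ℝ => Complex.exp (Complex.I * p.2 * (r - p.1))) (by fun_prop)
      (Eventually.of_forall fun p => (norm_exp_I_mul_mul_sub _ _ _).le)).congr
      (Eventually.of_forall fun p => ?_)
    simp [Function.uncurry]
  have hlim : Tendsto (fun P : ℝ => ∫ r, α r * ∫ k in -P..P, B r k) atTop
      (𝓝 (∫ r, α r * (2 * Real.pi * β r))) := by
    refine tendsto_integral_filter_of_dominated_convergence
      (fun r => ‖α r‖ * (A * Real.pi)) ?_ ?_ (hα.norm.mul_const _) ?_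
    · filter_upwards [eventually_ge_atTop 0] with P hP
      have := (integrable_mul_dirichlet hα hβ.integrable hP).integral_prod_left
      refine this.aestronglyMeasurable.congr (Eventually.of_forall fun r => ?_)
      exact hswap P hP r
    · filter_upwards [eventually_ge_atTop 0] with P hP
      refine Eventually.of_forall fun r => ?_
      rw [norm_mul]
      gcongr
      rw [intervalIntegral.integral_of_le (by linarith)]
      have hi : Integrable (fun k : ℝ => A / (1 + k ^ 2)) := by
        simpa [div_eq_mul_inv] using integrable_inv_one_add_sq.const_mul A
      calc ‖∫ k in Ioc (-P) P, B r k‖ ≤ ∫ k in Ioc (-P) P, A / (1 + k ^ 2) :=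
            norm_integral_le_of_norm_le hi.integrableOn (Eventually.of_forall fun k => hBn r k)
        _ ≤ ∫ k, A / (1 + k ^ 2) := setIntegral_le_integral hi
            (Eventually.of_forall fun k => by positivity)
        _ = A * Real.pi := by
            simp only [div_eq_mul_inv]
            rw [integral_const_mul, integral_univ_inv_one_add_sq]
    · refine Eventually.of_forall fun r => ?_
      exact (tendsto_integral_exp_mul_fourier hβ r).const_mul (α r)
  have e : ∫ r, α r * (2 * Real.pi * β r) = 2 * Real.pi * ∫ r, α r * β r := by
    rw [← integral_const_mul]
    refine integral_congr_ae (Eventually.of_forall fun r => ?_)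
    simp only
    ring
  rw [← e]
  refine hlim.congr' ?_
  filter_upwards [eventually_ge_atTop 0] with P hP
  rw [integral_prod _ (integrable_mul_dirichlet hα hβ.integrable hP)]
  exact integral_congr_ae (Eventually.of_forall fun r => (hswap P hP r).symm)

/-- The Riemann-Lebesgue lemma for the frequency `(P, -P)` in the plane. -/
theorem tendsto_integral_exp_neg_sub (q : ℝ × ℝ → ℂ) :
    Tendsto (fun P : ℝ => ∫ p : ℝ × ℝ, q p * Complex.exp (-(Complex.I * P * (p.1 - p.2)))
      ∂(volume.prod volume)) atTop (𝓝 0) := by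
  -- The factor `1/(2π)` compensates the `2π` in the Fourier character; the functionals `P • L`
  -- leave every compact set as `P → ∞`.
  set L : StrongDual ℝ (ℝ × ℝ) := (1 / (2 * Real.pi)) •
    (ContinuousLinearMap.fst ℝ ℝ ℝ - ContinuousLinearMap.snd ℝ ℝ ℝ) with hL
  have hL0 : L ≠ 0 := by
    intro h
    have := congrArg (fun T : StrongDual ℝ (ℝ × ℝ) => T (1, 0)) h
    simp [hL, Real.pi_ne_zero] at this
  have hlim : Tendsto (fun P : ℝ => P • L) atTop (cocompact (StrongDual ℝ (ℝ × ℝ))) := by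
    rw [← Metric.cobounded_eq_cocompact, ← tendsto_norm_atTop_iff_cobounded]
    simp only [norm_smul, Real.norm_eq_abs]
    exact tendsto_abs_atTop_atTop.atTop_mul_const (norm_pos_iff.2 hL0)
  refine ((tendsto_integral_exp_smul_cocompact q
    (volume.prod volume : Measure (ℝ × ℝ))).comp hlim).congr fun P => ?_
  refine integral_congr_ae (Eventually.of_forall fun p => ?_)
  simp only [Circle.smul_def, Real.fourierChar_apply, smul_eq_mul]
  rw [mul_comm]
  congr 2
  simp [hL]
  field_simp

/-! ### Local integrability of weakly singular kernels -/

theorem integrableOn_abs_rpow {s : ℝ} (hs : -1 < s) (M : ℝ) :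
    IntegrableOn (fun x : ℝ => |x| ^ s) (Icc (-M) M) := by
  have h1 : IntegrableOn (fun x : ℝ => |x| ^ s) (Icc 0 |M|) := by
    have := (intervalIntegrable_iff_integrableOn_Icc_of_le (abs_nonneg M)).1
      (intervalIntegral.intervalIntegrable_rpow' (a := 0) (b := |M|) hs)
    refine this.congr_fun (fun x hx => ?_) measurableSet_Icc
    simp only
    rw [abs_of_nonneg hx.1]
  have h2 : IntegrableOn (fun x : ℝ => |x| ^ s) (Icc (-|M|) 0) := by
    have := h1.comp_neg
    simpa using this
  refine (h2.union h1).mono_set fun x hx => ?_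
  rcases le_total x 0 with h | h
  · exact Or.inl ⟨by linarith [le_abs_self M, hx.1], h⟩
  · exact Or.inr ⟨h, by linarith [le_abs_self M, hx.2]⟩

/-- On the square the function is the integrand of a convolution of two integrable functions,
because differences of points of `[-M, M]` lie in `[-2M, 2M]`. -/
theorem integrableOn_abs_sub_rpow {s : ℝ} (hs : -1 < s) (M : ℝ) :
    IntegrableOn (fun p : ℝ × ℝ => |p.1 - p.2| ^ s) (Icc (-M) M ×ˢ Icc (-M) M)
      (volume.prod volume) := by
  have h1 : Integrable (indicator (Icc (-M) M) (fun _ => (1 : ℝ))) :=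
    (integrable_indicator_iff measurableSet_Icc).2 (by simp [integrableOn_const_iff])
  have h2 : Integrable (indicator (Icc (-(2 * M)) (2 * M)) (fun x : ℝ => |x| ^ s)) :=
    (integrable_indicator_iff measurableSet_Icc).2 (integrableOn_abs_rpow hs _)
  have h3 := h1.convolution_integrand (ContinuousLinearMap.mul ℝ ℝ) h2
  refine h3.integrableOn.congr_fun (fun p hp => ?_) (measurableSet_Icc.prod measurableSet_Icc)
  obtain ⟨ha, hb⟩ := hp
  simp only [ContinuousLinearMap.mul_apply']
  rw [indicator_of_mem hb, indicator_of_mem, one_mul]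
  constructor <;> linarith [ha.1, ha.2, hb.1, hb.2]

/-! ### Hölder estimates by interpolation -/

/-- A polynomial multiple of a meromorphic function is analytic on a given compact set. -/
theorem exists_prod_mul_analyticAt {v : ℂ → ℂ} (hv : Meromorphic v) {K : Set ℂ}
    (hK : IsCompact K) :
    ∃ (t : Finset ℂ) (n : ℂ → ℕ), ∀ z ∈ K,
      AnalyticAt ℂ (fun y => (∏ x ∈ t, (y - x) ^ n x) * v y) z := by
  choose n hn using hv
  -- Finitely many neighbourhoods punctured at their centres cover the compact set. Only the centres
  -- can be singular, and at a centre `x` the factor `(y - x)^(n x)` removes the singularity.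
  have hU : ∀ x : ℂ, {y | y ≠ x → AnalyticAt ℂ v y} ∈ 𝓝 x := fun x =>
    eventually_nhdsWithin_iff.1 (MeromorphicAt.eventually_analyticAt ⟨n x, hn x⟩)
  obtain ⟨t, -, ht⟩ := hK.elim_nhds_subcover _ fun x _ => hU x
  refine ⟨t, n, fun z hz => ?_⟩
  have hprod : ∀ s : Finset ℂ, AnalyticAt ℂ (fun y => ∏ x ∈ s, (y - x) ^ n x) z := fun s => by
    refine Finset.analyticAt_fun_prod _ fun x _ => ?_
    fun_prop
  by_cases hzt : z ∈ t
  · have h1 := (hprod (t.erase z)).mul (hn z)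
    refine h1.congr (Eventually.of_forall fun y => ?_)
    simp only [Pi.mul_apply, smul_eq_mul]
    rw [← Finset.mul_prod_erase t (fun x => (y - x) ^ n x) hzt]
    ring
  · obtain ⟨x, hx, hzx⟩ := mem_iUnion₂.1 (ht hz)
    refine (hprod t).mul (hzx ?_)
    rintro rfl
    exact hzt hx

theorem eventually_prod_ne_zero (t : Finset ℂ) (n : ℂ → ℕ) (z : ℂ) :
    ∀ᶠ y in 𝓝[≠] z, ∏ x ∈ t, (y - x) ^ n x ≠ 0 := by
  simp only [Finset.prod_ne_zero_iff]
  rw [Filter.eventually_all_finset]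
  intro x _
  have : ∀ᶠ y in 𝓝[≠] z, y ≠ x := by
    by_cases h : z = x
    · subst h
      exact eventually_mem_nhdsWithin
    · exact eventually_nhdsWithin_of_eventually_nhds (eventually_ne_nhds h)
  filter_upwards [this] with y hy
  exact pow_ne_zero _ (sub_ne_zero.2 hy)

/-- The harmonic function on `[-B, B] × [-κ, κ]` used to interpolate between the sides. -/
noncomputable def interpExponent (B κ : ℝ) (z : ℂ) : ℝ :=
  Real.cos (Real.pi / (2 * B) * z.re) * Real.cosh (Real.pi / (2 * B) * z.im) /
    Real.cosh (Real.pi / (2 * B) * κ)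

/-- Being the real part of an entire function, the interpolating exponent can be realized as the
logarithm of the modulus of an analytic factor. -/
theorem re_cos_div_cosh (B κ : ℝ) (z : ℂ) :
    (Complex.cos ((Real.pi / (2 * B) : ℝ) * z) / (Real.cosh (Real.pi / (2 * B) * κ) : ℝ)).re =
      interpExponent B κ z := by
  rw [Complex.div_ofReal_re, interpExponent, Complex.cos_eq]
  simp [← Complex.ofReal_cos, ← Complex.ofReal_cosh, ← Complex.ofReal_sin, ← Complex.ofReal_sinh,
    -Complex.ofReal_div, -Complex.ofReal_mul]

theorem continuous_interpExponent (B κ : ℝ) : Continuous (interpExponent B κ) := by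
  unfold interpExponent
  have h1 : Continuous fun z : ℂ => Real.cosh (Real.pi / (2 * B) * z.im) :=
    Real.continuous_cosh.comp (by fun_prop)
  exact (Continuous.mul (by fun_prop) h1).div_const _

theorem interpExponent_pos {B κ : ℝ} (hB : 0 < B) {z : ℂ} (hz : |z.re| < B) :
    0 < interpExponent B κ z := by
  obtain ⟨h1, h2⟩ := abs_lt.1 hz
  have hpi := Real.pi_pos
  have e : ∀ y : ℝ, Real.pi / (2 * B) * y = Real.pi / 2 * (y / B) := fun y => by ring
  have h3 : -1 < z.re / B := by rw [lt_div_iff₀ hB]; linarith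
  have h4 : z.re / B < 1 := by rw [div_lt_iff₀ hB]; linarith
  refine div_pos (mul_pos (Real.cos_pos_of_mem_Ioo ⟨?_, ?_⟩) (Real.cosh_pos _)) (Real.cosh_pos _)
  · rw [e]; nlinarith
  · rw [e]; nlinarith

theorem interpExponent_le_one {B κ : ℝ} (z : ℂ) (hz : |z.im| = κ) : interpExponent B κ z ≤ 1 := by
  have : Real.cosh (Real.pi / (2 * B) * z.im) = Real.cosh (Real.pi / (2 * B) * κ) := by
    rw [← hz, ← Real.cosh_abs, ← Real.cosh_abs (_ * |z.im|)]
    simp [abs_mul]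
  rw [interpExponent, this, mul_div_assoc, div_self (Real.cosh_pos _).ne', mul_one]
  exact Real.cos_le_one _

theorem interpExponent_eq_zero {B κ : ℝ} (hB : 0 < B) (z : ℂ) (hz : |z.re| = B) :
    interpExponent B κ z = 0 := by
  have : Real.cos (Real.pi / (2 * B) * z.re) = 0 := by
    rw [← Real.cos_abs, abs_mul, hz, abs_of_pos (by positivity)]
    rw [show Real.pi / (2 * B) * B = Real.pi / 2 by field_simp]
    exact Real.cos_pi_div_two
  rw [interpExponent, this, zero_mul, zero_div]

/-- A two-constants estimate. Multiply `F` by an entire function of modulus `ε ^ (-h)`, where `h` is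
the interpolating exponent. On the horizontal sides `h ≤ 1`, so the factor `ε` outweighs it; on the
vertical sides `h = 0`. The maximum principle bounds the product by `A`. -/
theorem norm_le_rpow_interpExponent {F : ℂ → ℂ} {B κ ε A : ℝ} (hB : 0 < B) (hκ : 0 < κ)
    (hε : 0 < ε) (hε1 : ε ≤ 1)
    (hF : ∀ z : ℂ, |z.re| ≤ B → |z.im| ≤ κ → DifferentiableAt ℂ F z)
    (hhor : ∀ z : ℂ, |z.re| ≤ B → |z.im| = κ → ‖F z‖ ≤ A * ε)
    (hver : ∀ z : ℂ, |z.re| = B → |z.im| ≤ κ → ‖F z‖ ≤ A)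
    {z : ℂ} (hzr : |z.re| ≤ B) (hzi : |z.im| ≤ κ) : ‖F z‖ ≤ A * ε ^ interpExponent B κ z := by
  have hlog : Real.log ε ≤ 0 := Real.log_nonpos hε.le hε1
  set W : ℂ → ℂ := fun z => Complex.exp (-(Real.log ε : ℂ) *
    (Complex.cos ((Real.pi / (2 * B) : ℝ) * z) / (Real.cosh (Real.pi / (2 * B) * κ) : ℝ)))
    with hW
  have hWn : ∀ z, ‖W z‖ = Real.exp (-Real.log ε * interpExponent B κ z) := by
    intro z
    rw [hW, Complex.norm_exp, ← Complex.ofReal_neg, Complex.re_ofReal_mul, re_cos_div_cosh]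
  have hpow : ∀ z, ε ^ interpExponent B κ z = Real.exp (Real.log ε * interpExponent B κ z) :=
    fun z => Real.rpow_def_of_pos hε _
  have hWd : Differentiable ℂ W := by
    intro z
    simp only [hW]
    fun_prop
  have hcl : closure (Ioo (-B) B ×ℂ Ioo (-κ) κ) = Icc (-B) B ×ℂ Icc (-κ) κ := by
    rw [Complex.closure_reProdIm, closure_Ioo (by linarith), closure_Ioo (by linarith)]
  have hA : 0 ≤ A := (norm_nonneg _).trans (hver B (by simp [abs_of_pos hB]) (by simpa using hκ.le))
  have key := Complex.norm_le_of_forall_mem_frontier_norm_le (f := fun z => F z * W z)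
    (U := Ioo (-B) B ×ℂ Ioo (-κ) κ) (C := A) (z := z)
    (Metric.isBounded_Ioo _ _ |>.reProdIm (Metric.isBounded_Ioo _ _))
    (DifferentiableOn.diffContOnCl fun z hz => by
      rw [hcl, Complex.mem_reProdIm, mem_Icc, mem_Icc, ← abs_le, ← abs_le] at hz
      exact ((hF z hz.1 hz.2).mul (hWd z)).differentiableWithinAt) ?_
    (by rw [hcl, Complex.mem_reProdIm, mem_Icc, mem_Icc, ← abs_le, ← abs_le]; exact ⟨hzr, hzi⟩)
  · rw [norm_mul, hWn] at key
    rw [hpow]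
    have : ‖F z‖ = ‖F z‖ * Real.exp (-Real.log ε * interpExponent B κ z) *
        Real.exp (Real.log ε * interpExponent B κ z) := by
      rw [mul_assoc, ← Real.exp_add]
      simp
    rw [this]
    gcongr
  · intro y hy
    rw [Complex.frontier_reProdIm, closure_Ioo (by linarith), closure_Ioo (by linarith),
      frontier_Ioo (by linarith), frontier_Ioo (by linarith)] at hy
    rw [norm_mul, hWn]
    rcases hy with hy | hy
    · rw [Complex.mem_reProdIm, mem_Icc, ← abs_le] at hy
      have him : |y.im| = κ := by
        rcases hy.2 with h | h
        · rw [h, abs_neg, abs_of_pos hκ]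
        · rw [mem_singleton_iff.1 h, abs_of_pos hκ]
      calc ‖F y‖ * Real.exp (-Real.log ε * interpExponent B κ y)
          ≤ A * ε * Real.exp (-Real.log ε * 1) := by
            have h1 := hhor y hy.1 him
            have h2 := interpExponent_le_one (B := B) y him
            have h3 : -Real.log ε * interpExponent B κ y ≤ -Real.log ε * 1 :=
              mul_le_mul_of_nonneg_left h2 (by linarith)
            gcongr
        _ = A := by
            rw [mul_one, Real.exp_neg, Real.exp_log hε]
            field_simp
    · rw [Complex.mem_reProdIm] at hy
      have him : |y.im| ≤ κ := abs_le.2 hy.2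
      have hre : |y.re| = B := by
        rcases hy.1 with h | h
        · rw [h, abs_neg, abs_of_pos hB]
        · rw [mem_singleton_iff.1 h, abs_of_pos hB]
      rw [interpExponent_eq_zero hB y hre, mul_zero, Real.exp_zero, mul_one]
      exact hver y hre him

/-! ### Regularity of the coefficients -/

theorem ExpSmall.exists_bound {γ : ℝ} {σ : ℤˣ} {h : ℂ → ℝ → ℂ} (hh : ExpSmall γ σ h) (M N : ℝ) :
    ∃ A > 0, ∃ B > 0, ∀ z : ℂ, ∀ x : ℝ, |x| ≤ M → |z.im| ≤ N → B ≤ rsgn σ * z.re →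
      ‖h z x‖ ≤ A * Real.exp (-γ * |z.re|) := by
  obtain ⟨A, hA, B, hB, h1⟩ := hh (Icc (-M) M) (Icc (-N) N) isCompact_Icc isCompact_Icc
  exact ⟨A, hA, B, hB, fun z x hx hz => h1 z x (abs_le.1 hx) (abs_le.1 hz)⟩

theorem signs_univ : (Finset.univ : Finset ℤˣ) = {1, -1} := rfl

theorem sum_signs {E : Type*} [AddCommMonoid E] (f : ℤˣ → E) : ∑ τ, f τ = f 1 + f (-1) := by
  rw [signs_univ, Finset.sum_pair (by decide)]

section

variable {ρ γ : ℝ} {w : ℂ → ℂ} {m : ℤˣ → ℂ → ℂ → ℂ} {T R : ℝ → ℂ}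
  {κ γ' : ℝ} {v : ℂ → ℂ} {l : ℤˣ → ℝ → ℂ → ℂ} {C : ℂ → ℂ}

/-! ### Uniform asymptotics for large real part of the spectral variable -/

theorem DualAdmissible.exists_asymptotics (hB : DualAdmissible ρ w m κ γ' v l C) (M N : ℝ) :
    ∃ A > 0, ∃ B > 0, ∀ z : ℂ, ∀ r : ℝ, |r| ≤ M → |z.im| ≤ N →
      (B ≤ z.re → ‖m 1 r z - C r‖ ≤ A * Real.exp (-γ' * |z.re|)) ∧
      (B ≤ -z.re → ‖m 1 r z - (starRingEnd ℂ) (C r)‖ ≤ A * Real.exp (-γ' * |z.re|)) ∧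
      (B ≤ |z.re| → ‖m (-1) r z‖ ≤ A * Real.exp (-γ' * |z.re|)) := by
  obtain ⟨A1, hA1, B1, hB1, h1⟩ := hB.plus_right.exists_bound M N
  obtain ⟨A2, hA2, B2, hB2, h2⟩ := hB.plus_left.exists_bound M N
  obtain ⟨A3, hA3, B3, hB3, h3⟩ := (hB.minus_small 1).exists_bound M N
  obtain ⟨A4, hA4, B4, hB4, h4⟩ := (hB.minus_small (-1)).exists_bound M N
  have hp : rsgn 1 = 1 := by simp [rsgn]
  have hm : rsgn (-1) = -1 := by simp [rsgn]
  refine ⟨A1 + A2 + A3 + A4, by positivity, B1 + B2 + B3 + B4, by positivity,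
    fun z r hr hz => ⟨fun hb => ?_, fun hb => ?_, fun hb => ?_⟩⟩
  · refine (h1 z r hr hz (by rw [hp]; linarith)).trans ?_
    gcongr
    linarith
  · refine (h2 z r hr hz (by rw [hm]; linarith)).trans ?_
    gcongr
    linarith
  · rcases le_abs.1 hb with hb | hb
    · refine (h3 z r hr hz (by rw [hp]; linarith)).trans ?_
      gcongr
      linarith
    · refine (h4 z r hr hz (by rw [hm]; linarith)).trans ?_
      gcongr
      linarith

theorem DualAdmissible.exists_norm_C_le (hB : DualAdmissible ρ w m κ γ' v l C) (M : ℝ) :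
    ∃ A > 0, ∀ r : ℝ, |r| ≤ M → ‖C r‖ ≤ A := by
  have hc : ContinuousOn (fun r : ℝ => C r) (Icc (-M) M) :=
    (hB.C_entire.continuous.comp Complex.continuous_ofReal).continuousOn
  obtain ⟨A, hA⟩ := isCompact_Icc.exists_bound_of_continuousOn hc
  exact ⟨|A| + 1, by positivity, fun r hr => (hA r (abs_le.1 hr)).trans (by
    linarith [le_abs_self A])⟩

theorem DualAdmissible.exists_norm_m_le (hB : DualAdmissible ρ w m κ γ' v l C) (M N : ℝ) :
    ∃ A > 0, ∃ B > 0, ∀ τ, ∀ z : ℂ, ∀ r : ℝ, |r| ≤ M → |z.im| ≤ N → B ≤ |z.re| →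
      ‖m τ r z‖ ≤ A := by
  obtain ⟨A, hA, B, hB0, h⟩ := hB.exists_asymptotics M N
  obtain ⟨A', hA', hC⟩ := hB.exists_norm_C_le M
  refine ⟨A + A', by positivity, B, hB0, fun τ z r hr hz hb => ?_⟩
  obtain ⟨h1, h2, h3⟩ := h z r hr hz
  have he : A * Real.exp (-γ' * |z.re|) ≤ A := by
    have : Real.exp (-γ' * |z.re|) ≤ 1 := by
      rw [Real.exp_le_one_iff]
      have := mul_nonneg hB.gamma_pos.le (abs_nonneg z.re)
      linarith
    nlinarith
  have hCr := hC r hr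
  rcases Int.units_eq_one_or τ with rfl | rfl
  · rcases le_abs.1 hb with hb | hb
    · have h4 := norm_sub_norm_le (m 1 r z) (C r)
      linarith [h1 hb]
    · have h4 := norm_sub_norm_le (m 1 r z) ((starRingEnd ℂ) (C r))
      rw [RCLike.norm_conj] at h4
      linarith [h2 hb]
  · linarith [h3 hb]

/-! ### Quasi-periodicity in the spectral variable -/

theorem DualAdmissible.m_add_period (hB : DualAdmissible ρ w m κ γ' v l C) (τ : ℤˣ) (r : ℝ)
    (k : ℂ) : m τ r (k + Complex.I * κ) = sgn τ * m τ r k := by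
  rcases Int.units_eq_one_or τ with rfl | rfl
  · simpa [sgn] using hB.m_plus_periodic r k
  · simpa [sgn] using hB.m_minus_antiperiodic r k

theorem DualAdmissible.exists_v_period (hB : DualAdmissible ρ w m κ γ' v l C) :
    ∃ s : ℂ, s * s = 1 ∧ ∀ k, v (k + Complex.I * κ) = s * v k := by
  rcases hB.v_periodic with h | h
  · exact ⟨1, by simp, fun k => by simp [h]⟩
  · exact ⟨-1, by simp, fun k => by simp [h]⟩

theorem DualAdmissible.analyticAt_v_add (hB : DualAdmissible ρ w m κ γ' v l C) (k : ℂ) :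
    AnalyticAt ℂ v (k + Complex.I * κ) ↔ AnalyticAt ℂ v k := by
  obtain ⟨s, hs, h⟩ := hB.exists_v_period
  constructor
  · intro ha
    have h1 : AnalyticAt ℂ (fun z => s * v (z + Complex.I * κ)) k :=
      analyticAt_const.mul (ha.comp_of_eq (by fun_prop) rfl)
    refine h1.congr (Eventually.of_forall fun z => ?_)
    simp only [h, ← mul_assoc, hs, one_mul]
  · intro ha
    have h1 : AnalyticAt ℂ (fun z => s * v (z - Complex.I * κ)) (k + Complex.I * κ) :=
      analyticAt_const.mul (ha.comp_of_eq (by fun_prop) (by ring))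
    refine h1.congr (Eventually.of_forall fun z => ?_)
    simp only
    rw [← h, sub_add_cancel]

theorem DualAdmissible.analyticAt_v_of_abs_im (hB : DualAdmissible ρ w m κ γ' v l C) {z : ℂ}
    (hz : |z.im| = κ) : AnalyticAt ℂ v z := by
  rcases abs_eq hB.kappa_pos.le |>.1 hz with h | h
  · have : z = (z.re : ℂ) + Complex.I * κ := by
      apply Complex.ext <;> simp [h]
    rw [this, hB.analyticAt_v_add]
    exact hB.v_analytic_real _
  · rw [← hB.analyticAt_v_add]
    have : z + Complex.I * κ = (z.re : ℂ) := by
      apply Complex.ext <;> simp [h]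
    rw [this]
    exact hB.v_analytic_real _

/-- A shift by `iκ` only changes signs. This carries the smoothness in `r`, known for real `k`, to
the lines `Im k = ±κ`. -/
theorem DualAdmissible.m_sub_norm_of_abs_im (hB : DualAdmissible ρ w m κ γ' v l C) (τ : ℤˣ)
    (r r' : ℝ) {z : ℂ} (hz : |z.im| = κ) :
    ‖m τ r z - m τ r' z‖ = ‖m τ r z.re - m τ r' z.re‖ := by
  have hs : ‖sgn τ‖ = 1 := by
    rcases Int.units_eq_one_or τ with rfl | rfl <;> simp [sgn]
  have key : ∀ k : ℂ, ‖m τ r (k + Complex.I * κ) - m τ r' (k + Complex.I * κ)‖ =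
      ‖m τ r k - m τ r' k‖ := by
    intro k
    rw [hB.m_add_period, hB.m_add_period, ← mul_sub, norm_mul, hs, one_mul]
  rcases abs_eq hB.kappa_pos.le |>.1 hz with h | h
  · have : z = (z.re : ℂ) + Complex.I * κ := by
      apply Complex.ext <;> simp [h]
    rw [← key z.re, ← this]
  · rw [← key z]
    have : z + Complex.I * κ = (z.re : ℂ) := by
      apply Complex.ext <;> simp [h]
    rw [this]

/-- If `v` vanished identically near one point, it would do so everywhere, and `m⁺ = v ℓ⁺` would be
zero on the real axis. But `m⁺(0,k)` tends to `C(0)`, whose squared modulus `1/w(0)` is positive. -/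
theorem DualAdmissible.v_order_ne_top (hA : Admissible ρ γ w m T R)
    (hB : DualAdmissible ρ w m κ γ' v l C) (z : ℂ) : meromorphicOrderAt v z ≠ ⊤ := by
  have hiff := hB.v_meromorphic.exists_meromorphicOrderAt_ne_top_iff_forall
  by_contra hz
  have hall : ∀ u, meromorphicOrderAt v u = ⊤ := by
    by_contra! hne
    exact (hiff.1 hne) z (not_not.1 (not_not.2 hz))
  have hv0 : ∀ k : ℝ, v k = 0 := by
    intro k
    have h1 := meromorphicOrderAt_eq_top_iff.1 (hall k)
    have h2 : Tendsto v (𝓝[≠] (k : ℂ)) (𝓝 (v k)) :=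
      (hB.v_analytic_real k).continuousAt.tendsto.mono_left nhdsWithin_le_nhds
    exact tendsto_nhds_unique h2 (tendsto_const_nhds.congr' (h1.mono fun y hy => hy.symm))
  obtain ⟨A, hA0, B, hB0, h⟩ := hB.exists_asymptotics 0 0
  have hle : ∀ᶠ k : ℝ in atTop, ‖C (0 : ℝ)‖ ≤ A * Real.exp (-γ' * k) := by
    filter_upwards [eventually_ge_atTop B] with k hk
    have h1 := (h k 0 (by simp) (by simp)).1 (by simpa using hk)
    rw [hB.factorization 1 0 k (hB.v_analytic_real k), hv0, zero_mul, zero_sub, norm_neg,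
      Complex.ofReal_re, abs_of_pos (hB0.trans_le hk)] at h1
    exact h1
  have hlim : Tendsto (fun k : ℝ => A * Real.exp (-γ' * k)) atTop (𝓝 (A * 0)) := by
    refine Tendsto.const_mul _ (Real.tendsto_exp_atBot.comp ?_)
    exact tendsto_id.const_mul_atTop_of_neg (by linarith [hB.gamma_pos])
  have h0 := ge_of_tendsto hlim hle
  rw [mul_zero, norm_le_zero_iff] at h0
  have h1 := hB.C_normSq 0
  rw [h0, norm_zero] at h1
  have := hA.w_pos 0
  have h2 : 0 < 1 / (w (0 : ℝ)).re := one_div_pos.2 this.2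
  rw [← h1] at h2
  simp at h2

/-- For `k` in the strip `|Im k| < κ`, the coefficient `ℓ^τ(r, k)` is locally Hölder continuous
in `r`. -/
theorem DualAdmissible.exists_holder (hA : Admissible ρ γ w m T R)
    (hB : DualAdmissible ρ w m κ γ' v l C) (τ : ℤˣ) {k₀ : ℂ} (hk₀ : |k₀.im| < κ) {M : ℝ}
    (hM : 0 < M) :
    ∃ θ : ℝ, 0 < θ ∧ ∃ A, 0 ≤ A ∧ ∀ r r' : ℝ, |r| ≤ M → |r'| ≤ M →
      ‖l τ r k₀ - l τ r' k₀‖ ≤ A * |r - r'| ^ θ := by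
  obtain ⟨A₁, hA₁, B₁, hB₁, hm⟩ := hB.exists_norm_m_le M (κ + 1)
  -- The rectangle contains `k₀` in its interior, and its vertical sides lie where the coefficients
  -- are bounded.
  set B : ℝ := max B₁ |k₀.re| + 1 with hBdef
  have hBB₁ : B₁ < B := (le_max_left _ _).trans_lt (by linarith)
  have hBk : |k₀.re| < B := (le_max_right B₁ _).trans_lt (by linarith)
  have hB0 : 0 < B := hB₁.trans hBB₁
  set K : Set ℂ := Icc (-B) B ×ℂ Icc (-κ) κ with hK
  have hKc : IsCompact K := isCompact_Icc.reProdIm isCompact_Icc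
  have hKmem : ∀ z : ℂ, z ∈ K ↔ |z.re| ≤ B ∧ |z.im| ≤ κ := by
    intro z
    rw [hK, Complex.mem_reProdIm, mem_Icc, mem_Icc, ← abs_le, ← abs_le]
  obtain ⟨t, n, hV⟩ := exists_prod_mul_analyticAt hB.v_meromorphic hKc
  set p : ℂ → ℂ := fun y => ∏ x ∈ t, (y - x) ^ n x with hp
  have hpc : Continuous p := by fun_prop
  obtain ⟨A₂, hA₂⟩ := hKc.exists_bound_of_continuousOn hpc.continuousOn
  -- The polynomial `p` clears the poles of `v`, so `F` is analytic on the rectangle; where `v` is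
  -- regular, `F` is `p` times a difference of values of `m`.
  set F : ℝ → ℝ → ℂ → ℂ := fun r r' z => p z * v z * (l τ r z - l τ r' z) with hF
  have hFm : ∀ r r' z, AnalyticAt ℂ v z → F r r' z = p z * (m τ r z - m τ r' z) := by
    intro r r' z hz
    rw [hB.factorization τ r z hz, hB.factorization τ r' z hz]
    simp only [hF]
    ring
  -- Lipschitz bound on the real axis
  obtain ⟨Lip, hLip⟩ := ((hA.m_smooth τ).contDiffOn (s := Icc (-M) M ×ˢ Icc (-B) B)
    ).exists_lipschitzOnWith (by simp) ((convex_Icc _ _).prod (convex_Icc _ _))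
    (isCompact_Icc.prod isCompact_Icc)
  have hlip : ∀ r r' k : ℝ, |r| ≤ M → |r'| ≤ M → |k| ≤ B →
      ‖m τ r k - m τ r' k‖ ≤ Lip * |r - r'| := by
    intro r r' k hr hr' hk
    have := hLip.dist_le_mul (r, k) ⟨abs_le.1 hr, abs_le.1 hk⟩ (r', k) ⟨abs_le.1 hr', abs_le.1 hk⟩
    simpa [dist_eq_norm, Prod.dist_eq, Real.dist_eq] using this
  -- The first summand serves the vertical sides, the second the horizontal ones. Dividing `|r -
  -- r'|` by `2M + 1` keeps the small parameter at most 1.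
  set A₃ : ℝ := |A₂| * (2 * A₁) + |A₂| * (Lip * (2 * M + 1)) with hA₃
  have hA₃0 : 0 ≤ A₃ := by positivity
  have hpb : ∀ z ∈ K, ‖p z‖ ≤ |A₂| := fun z hz => (hA₂ z hz).trans (le_abs_self _)
  have hstrip : ∀ r r' : ℝ, |r| ≤ M → |r'| ≤ M → r ≠ r' → ∀ z ∈ K,
      ‖F r r' z‖ ≤ A₃ * (|r - r'| / (2 * M + 1)) ^ interpExponent B κ z := by
    intro r r' hr hr' hne z hz
    have hε : 0 < |r - r'| / (2 * M + 1) := div_pos (abs_pos.2 (sub_ne_zero.2 hne)) (by linarith)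
    have hε1 : |r - r'| / (2 * M + 1) ≤ 1 := by
      rw [div_le_one (by linarith)]
      have := abs_sub r r'
      linarith
    refine norm_le_rpow_interpExponent hB0 hB.kappa_pos hε hε1 ?_ ?_ ?_ ((hKmem z).1 hz).1
      ((hKmem z).1 hz).2
    · intro y hy1 hy2
      exact (hV y ((hKmem y).2 ⟨hy1, hy2⟩)).differentiableAt.mul
        ((hB.l_entire τ r y).sub (hB.l_entire τ r' y))
    · intro y hy1 hy2
      rw [hFm r r' y (hB.analyticAt_v_of_abs_im hy2), norm_mul, hB.m_sub_norm_of_abs_im τ r r' hy2]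
      have h1 := hpb y ((hKmem y).2 ⟨hy1, hy2.le⟩)
      have h2 := hlip r r' y.re hr hr' hy1
      calc ‖p y‖ * ‖m τ r y.re - m τ r' y.re‖ ≤ |A₂| * (Lip * |r - r'|) := by gcongr
        _ = |A₂| * (Lip * (2 * M + 1)) * (|r - r'| / (2 * M + 1)) := by
            field_simp
        _ ≤ A₃ * (|r - r'| / (2 * M + 1)) := by
            gcongr
            rw [hA₃]
            have : 0 ≤ |A₂| * (2 * A₁) := by positivity
            linarith
    · intro y hy1 hy2
      have hyK : y ∈ K := (hKmem y).2 ⟨hy1.le, hy2⟩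
      -- A pole of `v` on a vertical side is not excluded, and there `F` is not given by `m`. The
      -- bound is proved at nearby regular points and passes to the limit by continuity of `F`.
      have hlim : Tendsto (fun u => ‖F r r' u‖) (𝓝[≠] y) (𝓝 ‖F r r' y‖) := by
        have hc : ContinuousAt (F r r') y := ((hV y hyK).differentiableAt.mul
          ((hB.l_entire τ r y).sub (hB.l_entire τ r' y))).continuousAt
        exact hc.norm.tendsto.mono_left nhdsWithin_le_nhds
      have hp2 : Tendsto (fun u => ‖p u‖ * (2 * A₁)) (𝓝[≠] y) (𝓝 (‖p y‖ * (2 * A₁))) :=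
        ((hpc.norm.tendsto y).mul_const _).mono_left nhdsWithin_le_nhds
      have hev : ∀ᶠ u in 𝓝[≠] y, ‖F r r' u‖ ≤ ‖p u‖ * (2 * A₁) := by
        have e1 : ∀ᶠ u : ℂ in 𝓝[≠] y, B₁ < |u.re| := eventually_nhdsWithin_of_eventually_nhds
          ((Complex.continuous_re.abs.tendsto y).eventually_const_lt (by simpa [hy1] using hBB₁))
        have e2 : ∀ᶠ u : ℂ in 𝓝[≠] y, |u.im| < κ + 1 := eventually_nhdsWithin_of_eventually_nhds
          ((Complex.continuous_im.abs.tendsto y).eventually_lt_const (by linarith))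
        filter_upwards [(hB.v_meromorphic y).eventually_analyticAt, e1, e2] with u hu hu1 hu2
        rw [hFm r r' u hu, norm_mul]
        have h3 := hm τ u r hr hu2.le hu1.le
        have h4 := hm τ u r' hr' hu2.le hu1.le
        have h5 := norm_sub_le (m τ r u) (m τ r' u)
        gcongr
        linarith
      refine (le_of_tendsto_of_tendsto hlim hp2 hev).trans ?_
      have h1 : ‖p y‖ * (2 * A₁) ≤ |A₂| * (2 * A₁) := by
        have := hpb y hyK
        gcongr
      have h2 : 0 ≤ |A₂| * (Lip * (2 * M + 1)) := by positivity
      linarith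
  have hKn : K ∈ 𝓝 k₀ := by
    refine mem_of_superset (((isOpen_Ioo (a := -B) (b := B)).reProdIm
      (isOpen_Ioo (a := -κ) (b := κ))).mem_nhds ?_) ?_
    · exact ⟨abs_lt.1 hBk, abs_lt.1 hk₀⟩
    · exact fun z hz => ⟨Ioo_subset_Icc_self hz.1, Ioo_subset_Icc_self hz.2⟩
  have hVne : ∀ᶠ z in 𝓝[≠] k₀, p z * v z ≠ 0 := by
    filter_upwards [eventually_prod_ne_zero t n k₀,
      (meromorphicOrderAt_ne_top_iff_eventually_ne_zero (hB.v_meromorphic k₀)).1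
        (hB.v_order_ne_top hA k₀)] with z h1 h2
    exact mul_ne_zero h1 h2
  have hre : ∀ᶠ z : ℂ in 𝓝 k₀, |z.re| < B :=
    (Complex.continuous_re.abs.tendsto k₀).eventually_lt_const hBk
  -- The product `p v` may vanish at `k₀` itself but not on a small circle around it. Dividing there
  -- and applying the maximum principle to the entire function `ℓ_r - ℓ_{r'}` recovers the value at
  -- the centre; the Hölder exponent is the minimum of the interpolating exponent on that circle.
  obtain ⟨δ, hδ, hball⟩ := Metric.nhds_basis_closedBall.eventually_iff.1
    ((eventually_nhdsWithin_iff.1 hVne).and (hre.and hKn))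
  have hsph : ∀ z ∈ Metric.sphere k₀ δ, z ≠ k₀ := by
    rintro z hz rfl
    simp [hδ.ne] at hz
  have hsc : IsCompact (Metric.sphere k₀ δ) := isCompact_sphere _ _
  have hsne : (Metric.sphere k₀ δ).Nonempty := NormedSpace.sphere_nonempty.2 hδ.le
  have hVc : ContinuousOn (fun z => ‖p z * v z‖) (Metric.sphere k₀ δ) := fun z hz =>
    (hV z (hball (Metric.sphere_subset_closedBall hz)).2.2).continuousAt.norm.continuousWithinAt
  obtain ⟨z₁, hz₁, hmin₁⟩ := hsc.exists_isMinOn hsne hVc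
  obtain ⟨z₂, hz₂, hmin₂⟩ := hsc.exists_isMinOn hsne (continuous_interpExponent B κ).continuousOn
  set c := ‖p z₁ * v z₁‖ with hc
  have hc0 : 0 < c :=
    norm_pos_iff.2 ((hball (Metric.sphere_subset_closedBall hz₁)).1 (hsph z₁ hz₁))
  set θ := interpExponent B κ z₂ with hθ
  have hθ0 : 0 < θ := interpExponent_pos hB0 (hball (Metric.sphere_subset_closedBall hz₂)).2.1
  refine ⟨θ, hθ0, A₃ / c / (2 * M + 1) ^ θ, by positivity, fun r r' hr hr' => ?_⟩
  rcases eq_or_ne r r' with rfl | hne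
  · simp [Real.zero_rpow hθ0.ne']
  have hε : 0 < |r - r'| / (2 * M + 1) := div_pos (abs_pos.2 (sub_ne_zero.2 hne)) (by linarith)
  have hε1 : |r - r'| / (2 * M + 1) ≤ 1 := by
    rw [div_le_one (by linarith)]
    have := abs_sub r r'
    linarith
  have hfin : ‖l τ r k₀ - l τ r' k₀‖ ≤ A₃ * (|r - r'| / (2 * M + 1)) ^ θ / c := by
    refine Complex.norm_le_of_forall_mem_frontier_norm_le (f := fun z => l τ r z - l τ r' z)
      (U := Metric.ball k₀ δ) Metric.isBounded_ball
      ((hB.l_entire τ r).sub (hB.l_entire τ r')).diffContOnCl ?_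
      (subset_closure (Metric.mem_ball_self hδ))
    intro z hz
    rw [frontier_ball k₀ hδ.ne'] at hz
    have h1 := hstrip r r' hr hr' hne z (hball (Metric.sphere_subset_closedBall hz)).2.2
    have h2 : c ≤ ‖p z * v z‖ := hmin₁ hz
    have h3 : θ ≤ interpExponent B κ z := hmin₂ hz
    have h4 : (|r - r'| / (2 * M + 1)) ^ interpExponent B κ z ≤ (|r - r'| / (2 * M + 1)) ^ θ :=
      Real.rpow_le_rpow_of_exponent_ge hε hε1 h3
    rw [le_div_iff₀ hc0]
    calc ‖l τ r z - l τ r' z‖ * c ≤ ‖l τ r z - l τ r' z‖ * ‖p z * v z‖ := by gcongr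
      _ = ‖F r r' z‖ := by simp only [hF, norm_mul]; ring
      _ ≤ _ := h1.trans (by gcongr)
  refine hfin.trans (le_of_eq ?_)
  rw [Real.div_rpow (abs_nonneg _) (by linarith)]
  field_simp

end

/-! ### The residue kernel -/

theorem rpow_le_mul_rpow {D x θ θ' : ℝ} (hx : 0 ≤ x) (hD : x ≤ D) (hθ' : 0 < θ') (h : θ' ≤ θ) :
    x ^ θ ≤ D ^ (θ - θ') * x ^ θ' := by
  rcases hx.eq_or_lt with rfl | hx0
  · rw [Real.zero_rpow (hθ'.trans_le h).ne', Real.zero_rpow hθ'.ne', mul_zero]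
  · rw [show x ^ θ = x ^ (θ - θ') * x ^ θ' by rw [← Real.rpow_add hx0, sub_add_cancel]]
    have := Real.rpow_le_rpow hx hD (sub_nonneg.2 h)
    gcongr

/-- Follows from `1 + x ≤ exp x`: the singularity at `t = 0` is no worse than `1/|t|`, and the
quotient stays bounded for large `|t|`. -/
theorem norm_inv_one_sub_exp_le {t : ℝ} (ht : t ≠ 0) :
    ‖(1 - Complex.exp t)⁻¹‖ ≤ (1 + |t|) / |t| := by
  have h0 : 0 < |t| := abs_pos.2 ht
  have key : |t| / (1 + |t|) ≤ |1 - Real.exp t| := by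
    rw [div_le_iff₀ (by linarith)]
    rcases lt_or_gt_of_ne ht with h | h
    · rw [abs_of_neg h, abs_of_pos (by rw [sub_pos, Real.exp_lt_one_iff]; exact h)]
      have h1 := Real.add_one_le_exp (-t)
      have h2 : Real.exp t * Real.exp (-t) = 1 := by rw [← Real.exp_add]; simp
      nlinarith [Real.exp_pos t, Real.exp_pos (-t)]
    · rw [abs_of_pos h, abs_of_neg (by rw [sub_neg, Real.one_lt_exp_iff]; exact h)]
      have h1 := Real.add_one_le_exp t
      nlinarith
  rw [norm_inv, ← Complex.ofReal_exp, ← Complex.ofReal_one, ← Complex.ofReal_sub,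
    Complex.norm_real, Real.norm_eq_abs, ← inv_div]
  exact inv_anti₀ (by positivity) key

/-- Since `1/(1 - exp(-t)) = 1 - 1/(1 - exp t)`, the two poles at `t = 0` cancel up to the
difference of the numerators. -/
theorem div_one_sub_exp_add {t : ℝ} (ht : t ≠ 0) (a b : ℂ) :
    a / (1 - Complex.exp t) + b / (1 - Complex.exp (-t)) =
      b + (a - b) * (1 - Complex.exp t)⁻¹ := by
  have hne : ∀ s : ℝ, s ≠ 0 → 1 - Complex.exp s ≠ 0 := by
    intro s hs h
    rw [sub_eq_zero, ← Complex.ofReal_exp, ← Complex.ofReal_one, Complex.ofReal_inj, eq_comm,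
      Real.exp_eq_one_iff] at h
    exact hs h
  have h1 := hne t ht
  have h2 := hne (-t) (neg_ne_zero.2 ht)
  rw [Complex.ofReal_neg] at h2
  have h3 : Complex.exp t * Complex.exp (-t) = 1 := by rw [← Complex.exp_add]; simp
  field_simp
  linear_combination -b * h3

theorem coeffL_neg_signs (l : ℤˣ → ℝ → ℂ → ℂ) (τ τ' : ℤˣ) (k : ℂ) (r r' : ℝ) :
    coeffL l (-τ) (-τ') k (-r) (-r') = coeffL l τ τ' k r r' := by
  simp only [coeffL, neg_neg]
  ring

section

variable {ρ γ : ℝ} {w : ℂ → ℂ} {m : ℤˣ → ℂ → ℂ → ℂ} {T R : ℝ → ℂ}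
  {κ γ' : ℝ} {v : ℂ → ℂ} {l : ℤˣ → ℝ → ℂ → ℂ} {C : ℂ → ℂ}

theorem DualAdmissible.coeffL_neg (hB : DualAdmissible ρ w m κ γ' v l C) (τ τ' : ℤˣ) (k : ℂ)
    (r r' : ℝ) : coeffL l τ τ' (-k) r r' = coeffL l (-τ) (-τ') k r r' := by
  rw [hB.L_even, neg_neg, ← coeffL_neg_signs, neg_neg, neg_neg]

/-- Replacing `k` by `-k` interchanges the roles of `r` and `r'` when `τ = τ'`, and by evenness of
`L` it also amounts to reversing both signs. Thus `L^{+,+}` and `L^{-,-}` coincide on the diagonal,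
which is what tames the singularity of the residue kernel. -/
theorem DualAdmissible.coeffL_swap (hB : DualAdmissible ρ w m κ γ' v l C) (τ : ℤˣ) (k : ℂ)
    (r r' : ℝ) : coeffL l (-τ) (-τ) k r r' = coeffL l τ τ k r' r := by
  rw [← hB.coeffL_neg]
  simp only [coeffL, neg_neg]
  ring

/-- Finitely many local Hölder estimates share any sufficiently small exponent, since `|r - r'|` is
bounded. The sign `σ` covers both arguments `±k₀` that occur in `L`. -/
theorem DualAdmissible.exists_uniform_holder (hA : Admissible ρ γ w m T R)
    (hB : DualAdmissible ρ w m κ γ' v l C) {k₀ : ℂ} (hk₀ : |k₀.im| < κ) {M : ℝ} (hM : 0 < M) :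
    ∃ θ : ℝ, 0 < θ ∧ θ ≤ 1 ∧ ∃ A, 0 ≤ A ∧ ∀ τ σ : ℤˣ, ∀ r : ℝ, |r| ≤ M →
      ‖l τ r (sgn σ * k₀)‖ ≤ A ∧ ∀ r' : ℝ, |r'| ≤ M →
        ‖l τ r (sgn σ * k₀) - l τ r' (sgn σ * k₀)‖ ≤ A * |r - r'| ^ θ := by
  have h1 : ∀ i : ℤˣ × ℤˣ, ∀ᶠ θ : ℝ in 𝓝[>] 0, ∃ A, 0 ≤ A ∧ ∀ r r' : ℝ, |r| ≤ M → |r'| ≤ M →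
      ‖l i.1 r (sgn i.2 * k₀) - l i.1 r' (sgn i.2 * k₀)‖ ≤ A * |r - r'| ^ θ := by
    rintro ⟨τ, σ⟩
    have hk : |(sgn σ * k₀).im| < κ := by
      rcases Int.units_eq_one_or σ with rfl | rfl <;> simpa [sgn] using hk₀
    obtain ⟨θ, hθ, A, hA0, h⟩ := hB.exists_holder hA τ hk hM
    filter_upwards [Ioc_mem_nhdsGT hθ] with θ' hθ'
    refine ⟨A * (2 * M) ^ (θ - θ'), by positivity, fun r r' hr hr' => (h r r' hr hr').trans ?_⟩
    rw [mul_assoc]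
    have := abs_sub r r'
    exact mul_le_mul_of_nonneg_left
      (rpow_le_mul_rpow (abs_nonneg _) (by linarith) hθ'.1 hθ'.2) hA0
  obtain ⟨θ, hθ, hθ0, hθ1⟩ := ((eventually_all.2 h1).and
    (Ioc_mem_nhdsGT (one_pos : (0 : ℝ) < 1))).exists
  choose A hA0 hh using hθ
  have hle : ∀ i, A i ≤ ∑ i, A i := fun i =>
    Finset.single_le_sum (fun i _ => hA0 i) (Finset.mem_univ i)
  have hS : 0 ≤ ∑ i, A i := Finset.sum_nonneg fun i _ => hA0 i
  set D := ∑ i : ℤˣ × ℤˣ, ‖l i.1 0 (sgn i.2 * k₀)‖ with hD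
  have hDle : ∀ i : ℤˣ × ℤˣ, ‖l i.1 0 (sgn i.2 * k₀)‖ ≤ D := fun i =>
    Finset.single_le_sum (f := fun i : ℤˣ × ℤˣ => ‖l i.1 0 (sgn i.2 * k₀)‖)
      (fun i _ => norm_nonneg _) (Finset.mem_univ i)
  have hD0 : 0 ≤ D := (norm_nonneg _).trans (hDle (1, 1))
  refine ⟨θ, hθ0, hθ1, (∑ i, A i) + (∑ i, A i) * M ^ θ + D, by positivity,
    fun τ σ r hr => ⟨?_, fun r' hr' => ?_⟩⟩
  · have h2 := hh (τ, σ) r 0 hr (by simpa using hM.le)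
    have h3 : A (τ, σ) * |r - 0| ^ θ ≤ (∑ i, A i) * M ^ θ := by
      rw [sub_zero]
      exact mul_le_mul (hle _) (Real.rpow_le_rpow (abs_nonneg _) hr hθ0.le) (by positivity) hS
    have h4 := norm_sub_norm_le (l τ r (sgn σ * k₀)) (l τ 0 (sgn σ * k₀))
    have h5 := hDle (τ, σ)
    simp only at h2 h5
    linarith
  · refine (hh (τ, σ) r r' hr hr').trans ?_
    have h6 := hle (τ, σ)
    have h7 : 0 ≤ (∑ i, A i) * M ^ θ := by positivity
    gcongr
    linarith

theorem DualAdmissible.continuous_l (hA : Admissible ρ γ w m T R)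
    (hB : DualAdmissible ρ w m κ γ' v l C) (τ : ℤˣ) {k₀ : ℂ} (hk₀ : |k₀.im| < κ) :
    Continuous fun r => l τ r k₀ := by
  rw [continuous_iff_continuousAt]
  intro r
  obtain ⟨θ, hθ, A, hA0, h⟩ := hB.exists_holder hA τ hk₀ (M := |r| + 1) (by positivity)
  rw [ContinuousAt, tendsto_iff_norm_sub_tendsto_zero]
  have hlim : Tendsto (fun r' : ℝ => A * |r' - r| ^ θ) (𝓝 r) (𝓝 0) := by
    have hc : Continuous fun r' : ℝ => A * |r' - r| ^ θ :=
      continuous_const.mul ((by fun_prop : Continuous fun r' : ℝ => |r' - r|).rpow_const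
        fun _ => Or.inr hθ.le)
    simpa [Real.zero_rpow hθ.ne'] using hc.tendsto r
  refine squeeze_zero' (Eventually.of_forall fun _ => norm_nonneg _) ?_ hlim
  have hev : ∀ᶠ r' : ℝ in 𝓝 r, |r'| < |r| + 1 :=
    (continuous_abs.tendsto r).eventually_lt_const (by linarith)
  filter_upwards [hev] with r' hr'
  exact h r' r hr'.le (by linarith)

theorem DualAdmissible.continuous_coeffL (hA : Admissible ρ γ w m T R)
    (hB : DualAdmissible ρ w m κ γ' v l C) (τ τ' : ℤˣ) {k₀ : ℂ} (hk₀ : |k₀.im| < κ) :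
    Continuous fun p : ℝ × ℝ => coeffL l τ τ' k₀ p.1 p.2 := by
  have hk₁ : |(-k₀).im| < κ := by simpa using hk₀
  have h1 := fun σ => hB.continuous_l hA σ hk₀
  have h2 := fun σ => hB.continuous_l hA σ hk₁
  exact (((h1 τ).comp continuous_fst).mul ((h2 τ').comp continuous_snd)).add
    (((h1 (-τ)).comp continuous_fst.neg).mul ((h2 (-τ')).comp continuous_snd.neg))

theorem Admissible.contDiff_sqrtWeight (hA : Admissible ρ γ w m T R) :
    ContDiff ℝ ∞ (sqrtWeight w) := by
  have h1 : ContDiff ℝ ∞ fun r : ℝ => (w r).re := by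
    rw [contDiff_iff_contDiffAt]
    intro r
    have h2 : ContDiffAt ℝ ∞ w (r : ℂ) := (hA.w_analytic_real r).contDiffAt.restrict_scalars ℝ
    exact Complex.reCLM.contDiff.contDiffAt.comp r
      (h2.comp r Complex.ofRealCLM.contDiff.contDiffAt)
  exact h1.sqrt fun r => (hA.w_pos r).2.ne'

theorem Admissible.continuous_sqrtWeight (hA : Admissible ρ γ w m T R) :
    Continuous (sqrtWeight w) := hA.contDiff_sqrtWeight.continuous

theorem DualAdmissible.measurable_residueKernel (hA : Admissible ρ γ w m T R)
    (hB : DualAdmissible ρ w m κ γ' v l C) {k₀ : ℂ} (hk₀ : |k₀.im| < κ) :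
    Measurable fun p : ℝ × ℝ => residueKernel w κ l k₀ p.1 p.2 := by
  have h1 := fun τ τ' => (hB.continuous_coeffL hA τ τ' hk₀).measurable
  have h2 := hA.continuous_sqrtWeight.measurable
  unfold residueKernel
  fun_prop

theorem DualAdmissible.continuousAt_residueKernel (hA : Admissible ρ γ w m T R)
    (hB : DualAdmissible ρ w m κ γ' v l C) {k₀ : ℂ} (hk₀ : |k₀.im| < κ) {p : ℝ × ℝ}
    (hp : p.1 ≠ p.2) : ContinuousAt (fun p : ℝ × ℝ => residueKernel w κ l k₀ p.1 p.2) p := by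
  have h2 := hA.continuous_sqrtWeight
  unfold residueKernel
  refine ContinuousAt.mul (by fun_prop) (tendsto_finsetSum _ fun τ _ =>
    tendsto_finsetSum _ fun τ' _ => ContinuousAt.mul (ContinuousAt.div (by fun_prop)
      (by fun_prop) ?_) (hB.continuous_coeffL hA τ τ' hk₀).continuousAt)
  have hκ := hB.kappa_pos.ne'
  have hne : ∀ s : ℝ, s ≠ 0 → (1 : ℂ) - Complex.exp s ≠ 0 := by
    intro s hs h
    rw [sub_eq_zero, ← Complex.ofReal_exp, ← Complex.ofReal_one, Complex.ofReal_inj, eq_comm,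
      Real.exp_eq_one_iff] at h
    exact hs h
  have hpos : ∀ s : ℝ, (1 : ℂ) + Complex.exp s ≠ 0 := by
    intro s h
    rw [← Complex.ofReal_exp, ← Complex.ofReal_one, ← Complex.ofReal_add,
      Complex.ofReal_eq_zero] at h
    linarith [Real.exp_pos s]
  -- The two denominators with equal signs vanish only on the diagonal; the two with opposite signs
  -- are `1 + exp` of a real number and never vanish.
  have hp1 := hne (κ * (p.2 - p.1)) (mul_ne_zero hκ (sub_ne_zero.2 hp.symm))
  have hp2 := hne (κ * (-p.2 + p.1)) (mul_ne_zero hκ (by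
    rw [neg_add_eq_sub]
    exact sub_ne_zero.2 hp))
  have hp3 := hpos (κ * (-p.2 - p.1))
  have hp4 := hpos (κ * (p.2 + p.1))
  push_cast at hp1 hp2 hp3 hp4
  rcases Int.units_eq_one_or τ with rfl | rfl <;> rcases Int.units_eq_one_or τ' with rfl | rfl <;>
    simpa [sgn]

/-- The singularities of the residue kernel on the diagonal are integrable. -/
theorem DualAdmissible.exists_norm_residueKernel_le (hA : Admissible ρ γ w m T R)
    (hB : DualAdmissible ρ w m κ γ' v l C) {k₀ : ℂ} (hk₀ : |k₀.im| < κ) {M : ℝ} (hM : 0 < M) :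
    ∃ θ : ℝ, 0 < θ ∧ θ ≤ 1 ∧ ∃ A, 0 ≤ A ∧ ∀ r r' : ℝ, |r| ≤ M → |r'| ≤ M → r ≠ r' →
      ‖residueKernel w κ l k₀ r r'‖ ≤ A * |r - r'| ^ (θ - 1) := by
  obtain ⟨θ, hθ, hθ1, A, hA0, hl⟩ := hB.exists_uniform_holder hA hk₀ hM
  obtain ⟨W, hW⟩ := isCompact_Icc.exists_bound_of_continuousOn
    (hA.continuous_sqrtWeight.continuousOn (s := Icc (-M) M))
  have hκ := hB.kappa_pos
  set E := Real.exp (‖k₀‖ * (2 * M)) with hE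
  have hexp : ∀ s : ℝ, |s| ≤ 2 * M → ‖Complex.exp (Complex.I * k₀ * s)‖ ≤ E := by
    intro s hs
    refine (Complex.norm_exp_le_exp_norm _).trans (Real.exp_le_exp.2 ?_)
    rw [norm_mul, norm_mul, Complex.norm_I, one_mul, Complex.norm_real, Real.norm_eq_abs]
    gcongr
  have hlp : ∀ τ, ∀ r : ℝ, |r| ≤ M → ‖l τ r k₀‖ ≤ A ∧ ∀ r' : ℝ, |r'| ≤ M →
      ‖l τ r k₀ - l τ r' k₀‖ ≤ A * |r - r'| ^ θ := by
    intro τ r hr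
    simpa [sgn] using hl τ 1 r hr
  have hlm : ∀ τ, ∀ r : ℝ, |r| ≤ M → ‖l τ r (-k₀)‖ ≤ A ∧ ∀ r' : ℝ, |r'| ≤ M →
      ‖l τ r (-k₀) - l τ r' (-k₀)‖ ≤ A * |r - r'| ^ θ := by
    intro τ r hr
    simpa [sgn] using hl τ (-1) r hr
  have hL : ∀ τ τ' : ℤˣ, ∀ r r' : ℝ, |r| ≤ M → |r'| ≤ M →
      ‖coeffL l τ τ' k₀ r r'‖ ≤ 2 * A ^ 2 := by
    intro τ τ' r r' hr hr'
    have h1 := (hlp τ r hr).1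
    have h2 := (hlm τ' r' hr').1
    have h3 := (hlp (-τ) (-r) (by rwa [abs_neg])).1
    have h4 := (hlm (-τ') (-r') (by rwa [abs_neg])).1
    calc ‖coeffL l τ τ' k₀ r r'‖ ≤ ‖l τ r k₀‖ * ‖l τ' r' (-k₀)‖ +
          ‖l (-τ) (-r) k₀‖ * ‖l (-τ') (-r') (-k₀)‖ := by
          rw [← norm_mul, ← norm_mul]
          exact norm_add_le _ _
      _ ≤ A * A + A * A := by gcongr
      _ = 2 * A ^ 2 := by ring
  -- An antisymmetrized product inherits the Hölder bound of its factors; it is applied to the two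
  -- summands of `L(r,r') - L(r',r)`.
  have hcross : ∀ a a' b b' : ℂ, ∀ h : ℝ, ‖a'‖ ≤ A → ‖b'‖ ≤ A → ‖a - a'‖ ≤ A * h →
      ‖b - b'‖ ≤ A * h → ‖a * b' - a' * b‖ ≤ 2 * A ^ 2 * h := by
    intro a a' b b' h h1 h2 h3 h4
    have hh : 0 ≤ A * h := (norm_nonneg _).trans h3
    calc ‖a * b' - a' * b‖ = ‖(a - a') * b' - a' * (b - b')‖ := by ring_nf
      _ ≤ ‖a - a'‖ * ‖b'‖ + ‖a'‖ * ‖b - b'‖ := by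
          rw [← norm_mul, ← norm_mul]
          exact norm_sub_le _ _
      _ ≤ (A * h) * A + A * (A * h) := by gcongr
      _ = 2 * A ^ 2 * h := by ring
  have hdiff : ∀ r r' : ℝ, |r| ≤ M → |r'| ≤ M →
      ‖coeffL l 1 1 k₀ r r' - coeffL l (-1) (-1) k₀ r r'‖ ≤ 4 * A ^ 2 * |r - r'| ^ θ := by
    intro r r' hr hr'
    have hrn : |-r| ≤ M := by rwa [abs_neg]
    have hrn' : |-r'| ≤ M := by rwa [abs_neg]
    rw [hB.coeffL_swap]
    have e1 := hcross _ _ _ _ _ (hlp 1 r' hr').1 (hlm 1 r' hr').1 ((hlp 1 r hr).2 r' hr')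
      ((hlm 1 r hr).2 r' hr')
    have e2 := hcross _ _ _ _ _ (hlp (-1) (-r') hrn').1 (hlm (-1) (-r') hrn').1
      ((hlp (-1) (-r) hrn).2 (-r') hrn') ((hlm (-1) (-r) hrn).2 (-r') hrn')
    rw [show -r - -r' = -(r - r') by ring, abs_neg] at e2
    calc ‖coeffL l 1 1 k₀ r r' - coeffL l 1 1 k₀ r' r‖ =
        ‖(l 1 r k₀ * l 1 r' (-k₀) - l 1 r' k₀ * l 1 r (-k₀)) +
          (l (-1) (-r) k₀ * l (-1) (-r') (-k₀) - l (-1) (-r') k₀ * l (-1) (-r) (-k₀))‖ := by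
          simp only [coeffL]
          congr 1
          ring
      _ ≤ _ := norm_add_le _ _
      _ ≤ 2 * A ^ 2 * |r - r'| ^ θ + 2 * A ^ 2 * |r - r'| ^ θ := add_le_add e1 e2
      _ = _ := by ring
  obtain ⟨Lip, hLip⟩ : ∃ Lip : ℝ, 0 ≤ Lip ∧ ∀ x : ℝ, |x| ≤ 2 * M →
      ‖Complex.exp (Complex.I * k₀ * x) - Complex.exp (-(Complex.I * k₀ * x))‖ ≤ Lip * |x| := by
    have hcd : ContDiff ℝ 1 fun x : ℝ =>
        Complex.exp (Complex.I * k₀ * x) - Complex.exp (-(Complex.I * k₀ * x)) := by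
      have h1 : ContDiff ℝ 1 fun x : ℝ => Complex.I * k₀ * (x : ℂ) :=
        contDiff_const.mul Complex.ofRealCLM.contDiff
      exact h1.cexp.sub h1.neg.cexp
    obtain ⟨Lip, h⟩ := (hcd.contDiffOn (s := Icc (-(2 * M)) (2 * M))).exists_lipschitzOnWith
      one_ne_zero (convex_Icc _ _) isCompact_Icc
    refine ⟨Lip, Lip.2, fun x hx => ?_⟩
    have := h.dist_le_mul x (abs_le.1 hx) 0 ⟨by linarith, by linarith⟩
    simpa [dist_eq_norm] using this
  set D : ℝ := 2 * M with hD
  set Q : ℝ := (E * (4 * A ^ 2) + Lip * D ^ (1 - θ) * (2 * A ^ 2)) * ((1 + κ * D) / κ) with hQ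
  set S : ℝ := 2 * (E * (2 * A ^ 2)) + E * (2 * A ^ 2) with hS
  have hLip0 := hLip.1
  have hD0 : 0 < D := by positivity
  refine ⟨θ, hθ, hθ1, |W| * |W| * (S * D ^ (1 - θ) + Q), by positivity, fun r r' hr hr' hne => ?_⟩
  set x := r - r' with hx
  have hx0 : x ≠ 0 := sub_ne_zero.2 hne
  have hxp : 0 < |x| := abs_pos.2 hx0
  have hxD : |x| ≤ D := by
    have := abs_sub r r'
    linarith
  -- As `θ ≤ 1` and `|x| ≤ D`, bounded terms can be absorbed into the singular power.
  have hone : 1 ≤ D ^ (1 - θ) * |x| ^ (θ - 1) := by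
    rw [show θ - 1 = -(1 - θ) by ring, Real.rpow_neg hxp.le, ← div_eq_mul_inv, one_le_div
      (by positivity)]
    exact Real.rpow_le_rpow hxp.le hxD (by linarith)
  have hmixed : ∀ (s t : ℝ) (c : ℂ), |s| ≤ D → ‖c‖ ≤ 2 * A ^ 2 →
      ‖Complex.exp (Complex.I * k₀ * s) / (1 + Complex.exp t) * c‖ ≤ E * (2 * A ^ 2) := by
    intro s t c hs hc
    rw [norm_mul, norm_div]
    have h1 : 1 ≤ ‖1 + Complex.exp (t : ℂ)‖ := by
      rw [← Complex.ofReal_exp, ← Complex.ofReal_one, ← Complex.ofReal_add, Complex.norm_real,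
        Real.norm_eq_abs, abs_of_pos (by positivity)]
      linarith [Real.exp_pos t]
    have h2 : ‖Complex.exp (Complex.I * k₀ * s)‖ / ‖1 + Complex.exp (t : ℂ)‖ ≤ E :=
      (div_le_self (norm_nonneg _) h1).trans (hexp s hs)
    gcongr
  -- The two terms with equal signs are treated together: the factor `1/|x|` meets only the
  -- difference of the numerators, which is `O(|x|^θ)`.
  have hdiag : ‖Complex.exp (Complex.I * k₀ * x) * coeffL l 1 1 k₀ r r' /
        (1 - Complex.exp ((-(κ * x) : ℝ) : ℂ)) +
      Complex.exp (-(Complex.I * k₀ * x)) * coeffL l (-1) (-1) k₀ r r' /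
        (1 - Complex.exp (-((-(κ * x) : ℝ) : ℂ)))‖ ≤ E * (2 * A ^ 2) + Q * |x| ^ (θ - 1) := by
    have ht : -(κ * x) ≠ 0 := neg_ne_zero.2 (mul_ne_zero hκ.ne' hx0)
    rw [div_one_sub_exp_add ht]
    have hE' : ‖Complex.exp (-(Complex.I * k₀ * x))‖ ≤ E := by
      have := hexp (-x) (by rwa [abs_neg])
      simpa using this
    have h1 := hL (-1) (-1) r r' hr hr'
    have h2 := hdiff r r' hr hr'
    have h3 := hexp x hxD
    have h4 := hLip.2 x hxD
    have h5 := norm_inv_one_sub_exp_le ht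
    rw [abs_neg, abs_mul, abs_of_pos hκ] at h5
    refine (norm_add_le _ _).trans (add_le_add ?_ ?_)
    · rw [norm_mul]
      gcongr
    · rw [norm_mul]
      -- The difference of the coefficients is Hölder and that of the exponentials is Lipschitz; the
      -- latter is weakened to `|x|^θ`.
      have h6 : ‖Complex.exp (Complex.I * k₀ * x) * coeffL l 1 1 k₀ r r' -
          Complex.exp (-(Complex.I * k₀ * x)) * coeffL l (-1) (-1) k₀ r r'‖ ≤
          (E * (4 * A ^ 2) + Lip * D ^ (1 - θ) * (2 * A ^ 2)) * |x| ^ θ := by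
        have h7 : |x| ≤ D ^ (1 - θ) * |x| ^ θ := by
          simpa using rpow_le_mul_rpow hxp.le hxD hθ hθ1
        calc _ = ‖Complex.exp (Complex.I * k₀ * x) *
              (coeffL l 1 1 k₀ r r' - coeffL l (-1) (-1) k₀ r r') +
              (Complex.exp (Complex.I * k₀ * x) - Complex.exp (-(Complex.I * k₀ * x))) *
                coeffL l (-1) (-1) k₀ r r'‖ := by
              congr 1
              ring
          _ ≤ E * (4 * A ^ 2 * |x| ^ θ) + (Lip * (D ^ (1 - θ) * |x| ^ θ)) * (2 * A ^ 2) := by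
              refine (norm_add_le _ _).trans ?_
              rw [norm_mul, norm_mul]
              gcongr
              exact h4.trans (by gcongr)
          _ = _ := by ring
      have h8 : (1 + κ * |x|) / (κ * |x|) ≤ (1 + κ * D) / κ * |x|⁻¹ := by
        rw [div_mul_eq_div_div, ← div_eq_mul_inv]
        gcongr
      calc _ ≤ (E * (4 * A ^ 2) + Lip * D ^ (1 - θ) * (2 * A ^ 2)) * |x| ^ θ *
            ((1 + κ * D) / κ * |x|⁻¹) := by
            have := h5.trans h8
            gcongr
        _ = Q * (|x| ^ θ * |x|⁻¹) := by rw [hQ]; ring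
        _ = Q * |x| ^ (θ - 1) := by rw [Real.rpow_sub_one hxp.ne', div_eq_mul_inv]
  have hm1 := hmixed (r + r') (κ * (-r' - r)) (coeffL l 1 (-1) k₀ r r')
    (by have := abs_add_le r r'; linarith) (hL _ _ r r' hr hr')
  have hm2 := hmixed (-r - r') (κ * (r' + r)) (coeffL l (-1) 1 k₀ r r')
    (by have := abs_sub (-r) r'; rw [abs_neg] at this; linarith) (hL _ _ r r' hr hr')
  have hdecomp : residueKernel w κ l k₀ r r' = sqrtWeight w r * sqrtWeight w r' *
      ((Complex.exp (Complex.I * k₀ * x) * coeffL l 1 1 k₀ r r' /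
        (1 - Complex.exp ((-(κ * x) : ℝ) : ℂ)) +
      Complex.exp (-(Complex.I * k₀ * x)) * coeffL l (-1) (-1) k₀ r r' /
        (1 - Complex.exp (-((-(κ * x) : ℝ) : ℂ)))) +
      (Complex.exp (Complex.I * k₀ * (r + r' : ℝ)) / (1 + Complex.exp (κ * (-r' - r) : ℝ)) *
        coeffL l 1 (-1) k₀ r r' +
      Complex.exp (Complex.I * k₀ * (-r - r' : ℝ)) / (1 + Complex.exp (κ * (r' + r) : ℝ)) *
        coeffL l (-1) 1 k₀ r r')) := by
    simp only [residueKernel, sum_signs, sgn, hx]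
    push_cast
    ring_nf
  rw [hdecomp, norm_mul, norm_mul, Complex.norm_real, Complex.norm_real]
  have hw1 := (hW r (abs_le.1 hr)).trans (le_abs_self W)
  have hw2 := (hW r' (abs_le.1 hr')).trans (le_abs_self W)
  have hfin : E * (2 * A ^ 2) + Q * |x| ^ (θ - 1) + (E * (2 * A ^ 2) + E * (2 * A ^ 2)) ≤
      (S * D ^ (1 - θ) + Q) * |x| ^ (θ - 1) := by
    have : S ≤ S * (D ^ (1 - θ) * |x| ^ (θ - 1)) := le_mul_of_one_le_right (by positivity) hone
    rw [add_mul, mul_assoc]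
    linarith
  calc _ ≤ |W| * |W| * ((S * D ^ (1 - θ) + Q) * |x| ^ (θ - 1)) := by
        gcongr
        refine (norm_add_le _ _).trans (le_trans (add_le_add hdiag
          ((norm_add_le _ _).trans (add_le_add hm1 hm2))) hfin)
    _ = _ := by ring

end

/-! ### Principal parts -/

/-- The hypothesis makes `1 +` the order positive, and a finite order is an integer. -/
theorem meromorphicOrderAt_nonneg_of_tendsto {f : ℂ → ℂ} {z : ℂ} (hf : MeromorphicAt f z)
    (h : Tendsto (fun y => (y - z) * f y) (𝓝[≠] z) (𝓝 0)) : 0 ≤ meromorphicOrderAt f z := by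
  have hid : MeromorphicAt (fun y : ℂ => y - z) z := by fun_prop
  have h1 := (tendsto_zero_iff_meromorphicOrderAt_pos (hid.mul hf)).1 h
  rw [meromorphicOrderAt_mul hid hf, show meromorphicOrderAt (fun y : ℂ => y - z) z = 1 from
    meromorphicOrderAt_id_sub_const] at h1
  by_contra! hneg
  obtain ⟨n, hn⟩ := WithTop.ne_top_iff_exists.1 hneg.ne_top
  rw [← hn] at h1 hneg
  have h2 : n < 0 := by exact_mod_cast hneg
  have h3 : 0 < 1 + n := by exact_mod_cast h1
  omega

/-- Subtracting its principal parts makes a meromorphic function with simple poles analytic. -/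
theorem exists_analytic_part {W : ℂ → ℂ} (hW : Meromorphic W) {ι : Type*} [Fintype ι]
    {p c : ι → ℂ} (hp : Function.Injective p)
    (hres : ∀ i, Tendsto (fun k => (k - p i) * W k) (𝓝[≠] (p i)) (𝓝 (c i))) {S : Set ℂ}
    (hS : ∀ z ∈ S, (∀ i, z ≠ p i) → 0 ≤ meromorphicOrderAt W z) :
    ∃ H : ℂ → ℂ, (∀ z ∈ S, AnalyticAt ℂ H z) ∧
      ∀ z, ∀ᶠ y in 𝓝[≠] z, W y = H y + ∑ i, c i * (y - p i)⁻¹ := by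
  classical
  set H₀ : ℂ → ℂ := fun y => W y - ∑ i, c i * (y - p i)⁻¹ with hH₀
  have hmer : Meromorphic H₀ := by
    intro z
    have : MeromorphicAt (fun y => ∑ i, c i * (y - p i)⁻¹) z :=
      MeromorphicAt.fun_sum fun i _ => by fun_prop
    exact (hW z).sub this
  -- The normal form corrects the values at isolated points, so that nonnegative order means
  -- analyticity at the point itself.
  refine ⟨toMeromorphicNFOn H₀ univ, fun z hz => ?_, fun z => ?_⟩
  · rw [← (meromorphicNFOn_toMeromorphicNFOn H₀ univ (mem_univ z)
      ).meromorphicOrderAt_nonneg_iff_analyticAt,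
      meromorphicOrderAt_toMeromorphicNFOn hmer.meromorphicOn (mem_univ z)]
    by_cases h : ∀ i, z ≠ p i
    · have ha : AnalyticAt ℂ (fun y => -∑ i, c i * (y - p i)⁻¹) z := by
        refine (Finset.analyticAt_fun_sum _ fun i _ => analyticAt_const.mul
          (AnalyticAt.inv (by fun_prop) (sub_ne_zero.2 (h i)))).neg
      have h1 := meromorphicOrderAt_add (hW z) ha.meromorphicAt
      have h2 : W + (fun y => -∑ i, c i * (y - p i)⁻¹) = H₀ := by
        funext y
        simp [hH₀, sub_eq_add_neg]
      rw [h2] at h1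
      exact (le_min (hS z hz h) ha.meromorphicOrderAt_nonneg).trans h1
    · push Not at h
      obtain ⟨i₀, rfl⟩ := h
      refine meromorphicOrderAt_nonneg_of_tendsto (hmer _) ?_
      -- After multiplication by `y - p i₀` only the principal part at `p i₀` survives in the limit,
      -- and it cancels the residue of `W`.
      have hterm : ∀ i, Tendsto (fun y => c i * ((y - p i₀) * (y - p i)⁻¹)) (𝓝[≠] (p i₀))
          (𝓝 (if i = i₀ then c i else 0)) := by
        intro i
        by_cases hi : i = i₀
        · subst hi
          rw [if_pos rfl]
          refine tendsto_const_nhds.congr' ?_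
          filter_upwards [self_mem_nhdsWithin] with y hy
          rw [mul_inv_cancel₀ (sub_ne_zero.2 hy), mul_one]
        · rw [if_neg hi]
          have hne : p i₀ - p i ≠ 0 := sub_ne_zero.2 fun h => hi (hp h.symm)
          have hc : ContinuousAt (fun y => c i * ((y - p i₀) * (y - p i)⁻¹)) (p i₀) :=
            continuousAt_const.mul (ContinuousAt.mul (by fun_prop)
              (ContinuousAt.inv₀ (by fun_prop) hne))
          have := hc.tendsto.mono_left (nhdsWithin_le_nhds (s := {p i₀}ᶜ))
          simpa using this
      have hlim := (hres i₀).sub (tendsto_finsetSum Finset.univ fun i _ => hterm i)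
      simp only [Finset.sum_ite_eq', Finset.mem_univ, if_true, sub_self] at hlim
      refine hlim.congr fun y => ?_
      simp only [hH₀, mul_sub, Finset.mul_sum]
      congr 1
      exact Finset.sum_congr rfl fun i _ => by ring
  · filter_upwards [hmer.meromorphicOn.toMeromorphicNFOn_eq_self_on_nhdsNE (mem_univ z)]
      with y hy
    rw [hy]
    simp [hH₀]

section

variable {ρ γ : ℝ} {w : ℂ → ℂ} {m : ℤˣ → ℂ → ℂ → ℂ} {T R : ℝ → ℂ}
  {κ γ' : ℝ} {v : ℂ → ℂ} {l : ℤˣ → ℝ → ℂ → ℂ} {C : ℂ → ℂ} {n : ℕ} {pole res : Fin n → ℂ}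

theorem meromorphic_dualWeight (hv : Meromorphic v) : Meromorphic (dualWeight v) := by
  intro z
  have h1 : MeromorphicAt (fun k => v (-k)) z :=
    (hv (-z)).comp_analyticAt (f := v) (g := fun k => -k) (x := z) (by fun_prop)
  exact h1.mul (hv z)

theorem analyticAt_dualWeight {z : ℂ} (h : AnalyticAt ℂ v z) (h' : AnalyticAt ℂ v (-z)) :
    AnalyticAt ℂ (dualWeight v) z := by
  have h1 : AnalyticAt ℂ (fun k => v (-k)) z := h'.comp_of_eq (by fun_prop) rfl
  exact h1.mul h

theorem dualWeight_neg (z : ℂ) : dualWeight v (-z) = dualWeight v z := by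
  simp [dualWeight, mul_comm]

/-- The sign in the quasi-periodicity of `v` enters twice and drops out. This reflection pairs the
poles `k_j` and `iκ - k_j`. -/
theorem DualAdmissible.dualWeight_sub (hB : DualAdmissible ρ w m κ γ' v l C) (z : ℂ) :
    dualWeight v (Complex.I * κ - z) = dualWeight v z := by
  obtain ⟨s, hs, h⟩ := hB.exists_v_period
  have h1 := h (z - Complex.I * κ)
  have h2 := h (-z)
  rw [sub_add_cancel] at h1
  rw [neg_add_eq_sub] at h2
  have h3 : v (-(Complex.I * κ - z)) = s * v z := by
    rw [neg_sub, h1, ← mul_assoc, hs, one_mul]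
  rw [dualWeight, h3, h2, dualWeight]
  linear_combination (v (-z) * v z) * hs

theorem DualAdmissible.analyticAt_v_of_im (hB : DualAdmissible ρ w m κ γ' v l C) {z : ℂ}
    (hz : z.im = 0 ∨ z.im = κ) : AnalyticAt ℂ v z ∧ AnalyticAt ℂ v (-z) := by
  rcases hz with hz | hz
  · have : z = (z.re : ℂ) := Complex.ext rfl (by simpa using hz)
    rw [this]
    refine ⟨hB.v_analytic_real _, ?_⟩
    rw [← Complex.ofReal_neg]
    exact hB.v_analytic_real _
  · exact ⟨hB.analyticAt_v_of_abs_im (by rw [hz, abs_of_pos hB.kappa_pos]),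
      hB.analyticAt_v_of_abs_im (by rw [Complex.neg_im, abs_neg, hz, abs_of_pos hB.kappa_pos])⟩

theorem eventually_analyticAt_neg (hv : Meromorphic v) (z : ℂ) :
    ∀ᶠ y in 𝓝[≠] z, AnalyticAt ℂ v y ∧ AnalyticAt ℂ v (-y) := by
  refine (hv z).eventually_analyticAt.and ?_
  have h1 : MeromorphicAt (fun k => v (-k)) z :=
    (hv (-z)).comp_analyticAt (f := v) (g := fun k => -k) (x := z) (by fun_prop)
  filter_upwards [h1.eventually_analyticAt] with y hy
  have h2 : AnalyticAt ℂ (fun k => (fun k => v (-k)) (-k)) (-y) :=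
    hy.fun_comp_of_eq (by fun_prop) (by simp)
  simpa using h2

/-- A version `u` of the dual weight that is continuous away from its poles, with its residue
theorem on large rectangles. -/
theorem DualAdmissible.exists_regularized_weight (hB : DualAdmissible ρ w m κ γ' v l C)
    (hpole : IsPolePairing κ v pole res) :
    ∃ u : ℂ → ℂ, ∃ B > 0,
      (∀ z : ℂ, z.im = 0 ∨ z.im = κ → u z = dualWeight v z) ∧
      (∀ z : ℂ, 0 ≤ z.im → z.im ≤ κ → B ≤ |z.re| → ContinuousAt u z) ∧
      (∀ z : ℂ, ∀ᶠ y in 𝓝[≠] z, u y = dualWeight v y) ∧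
      ∀ P ≥ B, ∀ E : ℂ → ℂ, Differentiable ℂ E → rectIntegral (fun z => u z * E z) P κ =
        2 * Real.pi * Complex.I *
          ∑ j, res j * (E (pole j) - E (Complex.I * κ - pole j)) := by
  have hstrip : ∀ j, 0 < (pole j).im ∧ (pole j).im < κ := fun j => by
    have := (hpole.poles (pole j)).2 ⟨j, Or.inl rfl⟩
    exact ⟨this.1, this.2.1⟩
  set p : Fin n ⊕ Fin n → ℂ := Sum.elim pole fun j => Complex.I * κ - pole j with hp
  -- The reflection `k ↦ iκ - k` preserves the dual weight but reverses the sign of `k - k_j`, hence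
  -- of the residue.
  set c : Fin n ⊕ Fin n → ℂ := Sum.elim res fun j => -res j with hc
  have hpim : ∀ i, 0 < (p i).im ∧ (p i).im < κ := by
    rintro (j | j)
    · exact hstrip j
    · have := hstrip j
      simp only [hp, Sum.elim_inr, Complex.sub_im, Complex.mul_im, Complex.I_re, Complex.ofReal_im,
        Complex.I_im, Complex.ofReal_re]
      constructor <;> linarith
  have hinj : Function.Injective p := by
    rw [hp, Sum.elim_injective]
    refine ⟨hpole.injective, fun i j h => hpole.injective (sub_right_injective h), ?_⟩
    exact fun i j => hpole.disjoint i j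
  have hres : ∀ i, Tendsto (fun k => (k - p i) * dualWeight v k) (𝓝[≠] (p i)) (𝓝 (c i)) := by
    rintro (j | j)
    · exact hpole.residue j
    · have hmap : Tendsto (fun k : ℂ => Complex.I * κ - k) (𝓝[≠] (p (Sum.inr j)))
          (𝓝[≠] (pole j)) := by
        refine tendsto_nhdsWithin_of_tendsto_nhds_of_eventually_within _ ?_ ?_
        · have hcont : Continuous fun k : ℂ => Complex.I * κ - k := by fun_prop
          have := hcont.tendsto (p (Sum.inr j))
          simp only [hp, Sum.elim_inr, sub_sub_cancel] at this
          exact this.mono_left nhdsWithin_le_nhds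
        · filter_upwards [self_mem_nhdsWithin] with k hk h
          rw [mem_singleton_iff] at h
          exact hk (by simp [hp, ← h])
      have h1 := ((hpole.residue j).comp hmap).neg
      refine h1.congr fun k => ?_
      simp only [Function.comp, hB.dualWeight_sub, hp, Sum.elim_inr]
      ring
  obtain ⟨H, hH, hHe⟩ := exists_analytic_part (meromorphic_dualWeight hB.v_meromorphic) hinj hres
    (S := {z | 0 ≤ z.im ∧ z.im ≤ κ}) (by
      rintro z ⟨h0, h1⟩ hz
      by_cases hzb : z.im = 0 ∨ z.im = κ
      · have := hB.analyticAt_v_of_im hzb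
        exact (analyticAt_dualWeight this.1 this.2).meromorphicOrderAt_nonneg
      · push Not at hzb
        by_contra! hneg
        obtain ⟨j, hj⟩ := (hpole.poles z).1 ⟨lt_of_le_of_ne h0 hzb.1.symm,
          lt_of_le_of_ne h1 hzb.2, hneg⟩
        rcases hj with hj | hj
        · exact hz (Sum.inl j) hj
        · exact hz (Sum.inr j) hj)
  set u : ℂ → ℂ := fun y => H y + ∑ i, c i * (y - p i)⁻¹ with hu
  have hcont : ∀ z : ℂ, 0 ≤ z.im → z.im ≤ κ → (∀ i, z ≠ p i) → ContinuousAt u z := by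
    intro z h0 h1 hz
    exact (hH z ⟨h0, h1⟩).continuousAt.add (tendsto_finsetSum _ fun i _ =>
      continuousAt_const.mul (ContinuousAt.inv₀ (by fun_prop) (sub_ne_zero.2 (hz i))))
  set B : ℝ := 1 + ∑ i, |(p i).re| with hBdef
  have hpB : ∀ i, |(p i).re| < B := fun i => by
    have := Finset.single_le_sum (f := fun i => |(p i).re|) (fun i _ => abs_nonneg _)
      (Finset.mem_univ i)
    linarith
  refine ⟨u, B, by positivity, ?_, ?_, ?_, ?_⟩
  · intro z hz
    have ha := hB.analyticAt_v_of_im hz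
    have hc1 := (analyticAt_dualWeight ha.1 ha.2).continuousAt
    have hc2 : ContinuousAt u z := by
      have hκ := hB.kappa_pos.le
      refine hcont z ?_ ?_ ?_
      · rcases hz with h | h <;> rw [h]
        exact hκ
      · rcases hz with h | h <;> rw [h]
        exact hκ
      · rintro i rfl
        have := hpim i
        rcases hz with h | h <;> rw [h] at this <;> linarith
    -- On the horizontal lines both functions are continuous, so agreement on a punctured
    -- neighbourhood extends to the point itself.
    exact tendsto_nhds_unique (hc2.tendsto.mono_left nhdsWithin_le_nhds)
      ((hc1.tendsto.mono_left (nhdsWithin_le_nhds (s := {z}ᶜ))).congr' (hHe z))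
  · intro z h0 h1 hz
    refine hcont z h0 h1 ?_
    rintro i rfl
    linarith [hpB i]
  · intro z
    filter_upwards [hHe z] with y hy
    exact hy.symm
  · intro P hP E hE
    have hP0 : 0 ≤ P := by
      have : 0 ≤ B := by positivity
      linarith
    have hκ := hB.kappa_pos.le
    have hne : ∀ i, ∀ z ∈ rectBoundary P κ, z ≠ p i := by
      rintro i z ⟨-, -, h⟩ rfl
      have h1 := hpB i
      have h2 := hpim i
      rcases h with h | h | h <;> linarith
    have hiE : RectIntegrable (fun z => H z * E z) P κ := by
      refine rectIntegrable_of_continuousOn hP0 hκ fun z hz => ?_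
      exact ((hH z hz.2.1).continuousAt.mul (hE z).continuousAt).continuousWithinAt
    have hi : ∀ i ∈ (Finset.univ : Finset (Fin n ⊕ Fin n)),
        RectIntegrable (fun z => c i * ((z - p i)⁻¹ * E z)) P κ := by
      intro i _
      refine rectIntegrable_of_continuousOn hP0 hκ (continuousOn_const.mul (ContinuousOn.mul
        (ContinuousOn.inv₀ (by fun_prop) fun z hz => sub_ne_zero.2 (hne i z hz))
        hE.continuous.continuousOn))
    have his : RectIntegrable (fun z => ∑ i, c i * ((z - p i)⁻¹ * E z)) P κ := by
      refine rectIntegrable_of_continuousOn hP0 hκ (continuousOn_finsetSum _ fun i _ =>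
        continuousOn_const.mul (ContinuousOn.mul
        (ContinuousOn.inv₀ (by fun_prop) fun z hz => sub_ne_zero.2 (hne i z hz))
        hE.continuous.continuousOn))
    have hexp : (fun z => u z * E z) = fun z => H z * E z + ∑ i, c i * ((z - p i)⁻¹ * E z) := by
      funext z
      simp only [hu, add_mul, Finset.sum_mul, mul_assoc]
    rw [hexp, rectIntegral_add hiE his, rectIntegral_finset_sum _ hi,
      rectIntegral_eq_zero (f := fun z => H z * E z) hP0 hκ
        fun z _ hz => (hH z hz).differentiableAt.mul (hE z), zero_add]
    simp only [rectIntegral_const_mul]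
    have hval : ∀ i, rectIntegral (fun z => (z - p i)⁻¹ * E z) P κ =
        2 * Real.pi * Complex.I * E (p i) := fun i =>
      rectIntegral_div_sub hE ((hpB i).trans_le hP) (hpim i).1 (hpim i).2
    simp only [hval]
    simp only [Fintype.sum_sum_type, hc, hp, Sum.elim_inl, Sum.elim_inr]
    rw [← Finset.sum_add_distrib, Finset.mul_sum]
    exact Finset.sum_congr rfl fun j _ => by ring

end

/-! ### Contour integration of the spectral kernel -/

/-- `m^τ(r,k) m^{τ'}(r',-k) + m^{-τ}(-r,k) m^{-τ'}(-r',-k)`, which is `ŵ(k) L^{τ,τ'}(k,r,r')`. -/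
noncomputable def coeffN (m : ℤˣ → ℂ → ℂ → ℂ) (τ τ' : ℤˣ) (k : ℂ) (r r' : ℝ) : ℂ :=
  m τ r k * m τ' r' (-k) + m (-τ) (-r : ℝ) k * m (-τ') (-r' : ℝ) (-k)

/-- A summand of the residue kernel without its weight factors. -/
noncomputable def residueTerm (κ : ℝ) (l : ℤˣ → ℝ → ℂ → ℂ) (τ τ' : ℤˣ) (k : ℂ) (r r' : ℝ) : ℂ :=
  Complex.exp (Complex.I * k * (sgn τ * r - sgn τ' * r')) /
    (1 - sgn τ * sgn τ' * Complex.exp (κ * (sgn τ' * r' - sgn τ * r))) * coeffL l τ τ' k r r'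

theorem sgn_mul_self (τ : ℤˣ) : sgn τ * sgn τ = 1 := by
  rcases Int.units_eq_one_or τ with rfl | rfl <;> simp [sgn]

theorem sgn_neg (τ : ℤˣ) : sgn (-τ) = -sgn τ := by
  simp [sgn]

section

variable {ρ γ : ℝ} {w : ℂ → ℂ} {m : ℤˣ → ℂ → ℂ → ℂ} {T R : ℝ → ℂ}
  {κ γ' : ℝ} {v : ℂ → ℂ} {l : ℤˣ → ℝ → ℂ → ℂ} {C : ℂ → ℂ} {n : ℕ} {pole res : Fin n → ℂ}

theorem DualAdmissible.dualWeight_mul_coeffL (hB : DualAdmissible ρ w m κ γ' v l C) (τ τ' : ℤˣ)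
    {k : ℂ} (hk : AnalyticAt ℂ v k) (hk' : AnalyticAt ℂ v (-k)) (r r' : ℝ) :
    dualWeight v k * coeffL l τ τ' k r r' = coeffN m τ τ' k r r' := by
  simp only [coeffN, hB.factorization _ _ _ hk, hB.factorization _ _ _ hk', coeffL, dualWeight]
  ring

theorem DualAdmissible.coeffN_add_period (hB : DualAdmissible ρ w m κ γ' v l C) (τ τ' : ℤˣ)
    (k : ℂ) (r r' : ℝ) :
    coeffN m τ τ' (k + Complex.I * κ) r r' = sgn τ * sgn τ' * coeffN m τ τ' k r r' := by
  have h : ∀ σ (x : ℝ), m σ x (-(k + Complex.I * κ)) = sgn σ * m σ x (-k) := by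
    intro σ x
    have h1 := hB.m_add_period σ x (-(k + Complex.I * κ))
    rw [show -(k + Complex.I * κ) + Complex.I * κ = -k by ring] at h1
    rw [h1, ← mul_assoc, sgn_mul_self, one_mul]
  simp only [coeffN, h, hB.m_add_period, sgn_neg]
  ring

/-- Divide the quasi-periodicity of `m` by that of `v` where `v` is regular and nonzero; such points
accumulate everywhere, and `ℓ` is continuous in `k`. -/
theorem DualAdmissible.l_add_period (hA : Admissible ρ γ w m T R)
    (hB : DualAdmissible ρ w m κ γ' v l C) {s : ℂ} (hs : s * s = 1)
    (hv : ∀ k, v (k + Complex.I * κ) = s * v k) (τ : ℤˣ) (r : ℝ) (k : ℂ) :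
    l τ r (k + Complex.I * κ) = s * sgn τ * l τ r k := by
  have hc := (hB.l_entire τ r).continuous
  have h1 : Tendsto (fun z => l τ r (z + Complex.I * κ)) (𝓝[≠] k)
      (𝓝 (l τ r (k + Complex.I * κ))) :=
    ((hc.comp (continuous_id.add continuous_const)).tendsto k).mono_left nhdsWithin_le_nhds
  have h2 : Tendsto (fun z => s * sgn τ * l τ r z) (𝓝[≠] k) (𝓝 (s * sgn τ * l τ r k)) :=
    ((continuous_const.mul hc).tendsto k).mono_left nhdsWithin_le_nhds
  refine tendsto_nhds_unique h1 (h2.congr' ?_)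
  filter_upwards [(hB.v_meromorphic k).eventually_analyticAt,
    (meromorphicOrderAt_ne_top_iff_eventually_ne_zero (hB.v_meromorphic k)).1
      (hB.v_order_ne_top hA k)] with z hz hz0
  have h3 := hB.m_add_period τ r z
  rw [hB.factorization τ r z hz, hB.factorization τ r _ ((hB.analyticAt_v_add z).2 hz), hv] at h3
  have h4 : v z * l τ r (z + Complex.I * κ) = v z * (s * sgn τ * l τ r z) := by
    linear_combination s * h3 - (v z * l τ r (z + Complex.I * κ)) * hs
  exact (mul_left_cancel₀ hz0 h4).symm

/-- Each product in `L` contains two factors `ℓ`, so the unknown sign of `v` enters squared. -/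
theorem DualAdmissible.coeffL_add_period (hA : Admissible ρ γ w m T R)
    (hB : DualAdmissible ρ w m κ γ' v l C) (τ τ' : ℤˣ) (k : ℂ) (r r' : ℝ) :
    coeffL l τ τ' (k + Complex.I * κ) r r' = sgn τ * sgn τ' * coeffL l τ τ' k r r' := by
  obtain ⟨s, hs, hv⟩ := hB.exists_v_period
  have h1 := hB.l_add_period hA hs hv
  have h2 : ∀ σ (x : ℝ), l σ x (-(k + Complex.I * κ)) = s * sgn σ * l σ x (-k) := by
    intro σ x
    have h3 := h1 σ x (-(k + Complex.I * κ))
    rw [show -(k + Complex.I * κ) + Complex.I * κ = -k by ring] at h3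
    rw [h3]
    linear_combination (-(s * s) * l σ x (-(k + Complex.I * κ))) * sgn_mul_self σ -
      l σ x (-(k + Complex.I * κ)) * hs
  simp only [coeffL, h1, h2, sgn_neg]
  linear_combination (sgn τ * sgn τ' * (l τ r k * l τ' r' (-k) +
    l (-τ) (-r) k * l (-τ') (-r') (-k))) * hs

theorem differentiable_exp_mul_coeffL (hB : DualAdmissible ρ w m κ γ' v l C) (τ τ' : ℤˣ) (a : ℝ)
    (r r' : ℝ) :
    Differentiable ℂ fun k => Complex.exp (Complex.I * k * a) * coeffL l τ τ' k r r' := by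
  have h := hB.l_entire
  have h' : ∀ σ (x : ℝ), Differentiable ℂ fun k => l σ x (-k) := fun σ x =>
    (h σ x).comp differentiable_neg
  refine Differentiable.mul (by fun_prop) (((h τ r).mul (h' τ' r')).add
    ((h (-τ) (-r)).mul (h' (-τ') (-r'))))

/-- The factor `1 - exp(-κa)` is exactly the denominator in the contour identity for equal signs, so
it cancels there and leaves `1/a`. -/
theorem integral_exp_vertical (c : ℂ) {a : ℝ} (ha : a ≠ 0) (P κ : ℝ) :
    ∫ y in (0 : ℝ)..κ, c * Complex.exp (Complex.I * (P + y * Complex.I) * a) =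
      c * Complex.exp (Complex.I * P * a) * (1 - Complex.exp ((-(κ * a) : ℝ) : ℂ)) / a := by
  have ha' : (a : ℂ) ≠ 0 := by exact_mod_cast ha
  have h1 : ∀ y : ℝ, c * Complex.exp (Complex.I * (P + y * Complex.I) * a) =
      c * Complex.exp (Complex.I * P * a) * Complex.exp (-a * y) := by
    intro y
    rw [mul_assoc c, ← Complex.exp_add]
    congr 2
    linear_combination (y * a : ℂ) * Complex.I_mul_I
  simp only [h1]
  rw [intervalIntegral.integral_const_mul, integral_exp_mul_complex (neg_ne_zero.2 ha')]
  push_cast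
  rw [mul_zero, Complex.exp_zero, show (-a * κ : ℂ) = -(κ * a) by ring]
  field_simp
  ring

/-- When `Re z → ∞` the argument `-z` moves to the left, so `m⁺(r,z) m⁺(r',-z)` tends to `C(r)
conj(C(r'))`. The other summand for equal signs has two small factors `m⁻`; for opposite signs each
summand contains one. -/
theorem DualAdmissible.exists_coeffN_asymptotics (hB : DualAdmissible ρ w m κ γ' v l C)
    (M N : ℝ) : ∃ A > 0, ∃ B > 0, ∀ r r' : ℝ, |r| ≤ M → |r'| ≤ M → ∀ z : ℂ, |z.im| ≤ N →
      (B ≤ z.re → ‖coeffN m 1 1 z r r' - C r * (starRingEnd ℂ) (C r')‖ ≤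
        A * Real.exp (-γ' * |z.re|)) ∧
      (B ≤ -z.re → ‖coeffN m 1 1 z r r' - (starRingEnd ℂ) (C r) * C r'‖ ≤
        A * Real.exp (-γ' * |z.re|)) ∧
      (B ≤ |z.re| → ‖coeffN m 1 (-1) z r r'‖ ≤ A * Real.exp (-γ' * |z.re|)) := by
  obtain ⟨A₁, hA₁, B₁, hB₁, h1⟩ := hB.exists_asymptotics M N
  obtain ⟨A₂, hA₂, B₂, hB₂, h2⟩ := hB.exists_norm_m_le M N
  obtain ⟨A₃, hA₃, h3⟩ := hB.exists_norm_C_le M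
  refine ⟨2 * (A₁ * A₂) + 2 * (A₁ * A₃), by positivity, B₁ + B₂, by positivity,
    fun r r' hr hr' z hz => ?_⟩
  have hrn : |-r| ≤ M := by rwa [abs_neg]
  have hrn' : |-r'| ≤ M := by rwa [abs_neg]
  have hzn : |(-z).im| ≤ N := by simpa using hz
  have habs : |(-z).re| = |z.re| := by simp
  set e := Real.exp (-γ' * |z.re|) with he
  have he0 : 0 < e := Real.exp_pos _
  have hcross : ∀ a b a' b' : ℂ, ‖a‖ ≤ A₂ → ‖b'‖ ≤ A₃ → ‖a - a'‖ ≤ A₁ * e → ‖b - b'‖ ≤ A₁ * e →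
      ‖a * b - a' * b'‖ ≤ A₁ * A₂ * e + A₁ * A₃ * e := by
    intro a b a' b' ha hb' haa hbb
    calc ‖a * b - a' * b'‖ = ‖a * (b - b') + (a - a') * b'‖ := by ring_nf
      _ ≤ ‖a‖ * ‖b - b'‖ + ‖a - a'‖ * ‖b'‖ := by
          rw [← norm_mul, ← norm_mul]
          exact norm_add_le _ _
      _ ≤ A₂ * (A₁ * e) + (A₁ * e) * A₃ := by gcongr
      _ = _ := by ring
  have hminus : B₁ + B₂ ≤ |z.re| → ‖m (-1) (-r : ℝ) z * m (-1) (-r' : ℝ) (-z)‖ ≤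
      A₁ * A₂ * e := by
    intro hb
    have e1 := (h1 z (-r) hrn hz).2.2 (by linarith)
    have e2 := h2 (-1) (-z) (-r') hrn' hzn (by rw [habs]; linarith)
    calc _ = ‖m (-1) (-r : ℝ) z‖ * ‖m (-1) (-r' : ℝ) (-z)‖ := norm_mul _ _
      _ ≤ (A₁ * e) * A₂ := by gcongr
      _ = _ := by ring
  have hpos : 0 < A₁ * A₂ * e := by positivity
  have hpos' : 0 < A₁ * A₃ * e := by positivity
  refine ⟨fun hb => ?_, fun hb => ?_, fun hb => ?_⟩
  · have hab : B₁ + B₂ ≤ |z.re| := hb.trans (le_abs_self _)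
    have e1 := (h1 z r hr hz).1 (by linarith)
    have e2 := (h1 (-z) r' hr' hzn).2.1 (by simp only [Complex.neg_re, neg_neg]; linarith)
    rw [habs] at e2
    have e3 := h2 1 z r hr hz (by linarith)
    have e4 := hcross _ _ _ _ e3 (by rw [RCLike.norm_conj]; exact h3 r' hr') e1 e2
    have e5 := hminus hab
    calc _ = ‖(m 1 r z * m 1 r' (-z) - C r * (starRingEnd ℂ) (C r')) +
          m (-1) (-r : ℝ) z * m (-1) (-r' : ℝ) (-z)‖ := by
          simp only [coeffN]
          congr 1
          ring
      _ ≤ _ := norm_add_le _ _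
      _ ≤ _ := by linarith
  · have hab : B₁ + B₂ ≤ |z.re| := hb.trans (neg_le_abs _)
    have e1 := (h1 z r hr hz).2.1 (by linarith)
    have e2 := (h1 (-z) r' hr' hzn).1 (by simp only [Complex.neg_re]; linarith)
    rw [habs] at e2
    have e3 := h2 1 z r hr hz (by linarith)
    have e4 := hcross _ _ _ _ e3 (h3 r' hr') e1 e2
    have e5 := hminus hab
    calc _ = ‖(m 1 r z * m 1 r' (-z) - (starRingEnd ℂ) (C r) * C r') +
          m (-1) (-r : ℝ) z * m (-1) (-r' : ℝ) (-z)‖ := by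
          simp only [coeffN]
          congr 1
          ring
      _ ≤ _ := norm_add_le _ _
      _ ≤ _ := by linarith
  · have e1 := (h1 z (-r) hrn hz).2.2 (by linarith)
    have e2 := h2 1 (-z) (-r') hrn' hzn (by rw [habs]; linarith)
    have e3 := (h1 (-z) r' hr' hzn).2.2 (by rw [habs]; linarith)
    rw [habs] at e3
    have e4 := h2 1 z r hr hz (by linarith)
    calc _ ≤ ‖m 1 r z‖ * ‖m (-1) r' (-z)‖ + ‖m (-1) (-r : ℝ) z‖ * ‖m 1 (-r' : ℝ) (-z)‖ := by
          rw [← norm_mul, ← norm_mul]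
          simp only [coeffN, neg_neg]
          exact norm_add_le _ _
      _ ≤ A₂ * (A₁ * e) + (A₁ * e) * A₂ := by gcongr
      _ ≤ _ := by linarith

/-- The contour integral of `ŵ(k) L^{τ,τ'}(k,r,r') exp(ika)`, for `a = τr - τ'r'`. -/
theorem DualAdmissible.contour_identity (hA : Admissible ρ γ w m T R)
    (hB : DualAdmissible ρ w m κ γ' v l C) {u : ℂ → ℂ} {P : ℝ}
    (hu : ∀ z : ℂ, z.im = 0 ∨ z.im = κ → u z = dualWeight v z)
    (hrect : ∀ E : ℂ → ℂ, Differentiable ℂ E → rectIntegral (fun z => u z * E z) P κ =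
        2 * Real.pi * Complex.I * ∑ j, res j * (E (pole j) - E (Complex.I * κ - pole j)))
    (τ τ' : ℤˣ) (r r' : ℝ)
    (hd : 1 - sgn τ * sgn τ' * Complex.exp (κ * (sgn τ' * r' - sgn τ * r)) ≠ 0)
    (hd' : 1 - sgn τ * sgn τ' * Complex.exp (κ * (sgn τ * r - sgn τ' * r')) ≠ 0) {a : ℝ}
    (ha : (a : ℂ) = sgn τ * r - sgn τ' * r') :
    ∫ k : ℝ in -P..P, coeffN m τ τ' k r r' * Complex.exp (Complex.I * k * a) =
      2 * Real.pi * Complex.I * ∑ j, res j * (residueTerm κ l τ τ' (pole j) r r' +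
        residueTerm κ l (-τ) (-τ') (pole j) r r') +
      (1 - sgn τ * sgn τ' * Complex.exp (κ * (sgn τ' * r' - sgn τ * r)))⁻¹ *
        (Complex.I * (∫ y : ℝ in (0 : ℝ)..κ, u (-P + y * Complex.I) *
          (Complex.exp (Complex.I * (-P + y * Complex.I) * a) *
            coeffL l τ τ' (-P + y * Complex.I) r r')) -
        Complex.I * ∫ y : ℝ in (0 : ℝ)..κ, u (P + y * Complex.I) *
          (Complex.exp (Complex.I * (P + y * Complex.I) * a) *
            coeffL l τ τ' (P + y * Complex.I) r r')) := by
  have h := hrect _ (differentiable_exp_mul_coeffL hB τ τ' a r r')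
  set d := 1 - sgn τ * sgn τ' * Complex.exp (κ * (sgn τ' * r' - sgn τ * r)) with hddef
  have hss : (sgn τ * sgn τ') * (sgn τ * sgn τ') = 1 := by
    linear_combination sgn τ' * sgn τ' * sgn_mul_self τ + sgn_mul_self τ'
  have hbot : ∀ x : ℝ, u x * (Complex.exp (Complex.I * x * a) * coeffL l τ τ' x r r') =
      coeffN m τ τ' x r r' * Complex.exp (Complex.I * x * a) := by
    intro x
    have hx := hB.analyticAt_v_of_im (z := x) (Or.inl (by simp))
    rw [hu x (Or.inl (by simp)), ← hB.dualWeight_mul_coeffL τ τ' hx.1 hx.2]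
    ring
  -- The top side reproduces the bottom side times `1 - d`, so the horizontal sides together give
  -- `d` times the bottom integral.
  have htop : ∀ x : ℝ, u (x + κ * Complex.I) * (Complex.exp (Complex.I * (x + κ * Complex.I) * a) *
      coeffL l τ τ' (x + κ * Complex.I) r r') =
      (1 - d) * (coeffN m τ τ' x r r' * Complex.exp (Complex.I * x * a)) := by
    intro x
    have him : ((x : ℂ) + κ * Complex.I).im = κ := by simp
    have hx := hB.analyticAt_v_of_im (Or.inr him)
    have h1 := hB.dualWeight_mul_coeffL τ τ' hx.1 hx.2 r r'
    have h2 := hB.coeffN_add_period τ τ' x r r'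
    rw [mul_comm Complex.I (κ : ℂ)] at h2
    have h3 : Complex.exp (Complex.I * (x + κ * Complex.I) * a) =
        Complex.exp (Complex.I * x * a) * Complex.exp (κ * (sgn τ' * r' - sgn τ * r)) := by
      rw [← Complex.exp_add]
      congr 1
      rw [show sgn τ' * r' - sgn τ * r = -(a : ℂ) by rw [ha]; ring]
      linear_combination (κ * a : ℂ) * Complex.I_mul_I
    rw [hu _ (Or.inr him), mul_left_comm, h1, h2, h3, hddef]
    ring
  -- Evenness and quasi-periodicity of `L` rewrite the value at `iκ - k_j` through `L^{-τ,-τ'}` at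
  -- `k_j`.
  have hresid : ∀ j, (Complex.exp (Complex.I * pole j * a) * coeffL l τ τ' (pole j) r r' -
      Complex.exp (Complex.I * (Complex.I * κ - pole j) * a) *
        coeffL l τ τ' (Complex.I * κ - pole j) r r') =
      d * (residueTerm κ l τ τ' (pole j) r r' + residueTerm κ l (-τ) (-τ') (pole j) r r') := by
    intro j
    have h1 := hB.coeffL_add_period hA τ τ' (-pole j) r r'
    rw [hB.coeffL_neg, neg_add_eq_sub] at h1
    have h2 : Complex.exp (Complex.I * (Complex.I * κ - pole j) * a) =
        Complex.exp (Complex.I * pole j * (sgn (-τ) * r - sgn (-τ') * r')) *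
          Complex.exp (κ * (sgn τ' * r' - sgn τ * r)) := by
      rw [← Complex.exp_add]
      congr 1
      rw [sgn_neg, sgn_neg, ha]
      linear_combination (κ * (sgn τ * r - sgn τ' * r') : ℂ) * Complex.I_mul_I
    have h3 : Complex.exp (κ * (sgn τ' * r' - sgn τ * r)) *
        Complex.exp (κ * (sgn τ * r - sgn τ' * r')) = 1 := by
      rw [← Complex.exp_add, ← Complex.exp_zero]
      congr 1
      ring
    have h4 : sgn (-τ) * sgn (-τ') * Complex.exp (κ * (sgn (-τ') * r' - sgn (-τ) * r)) =
        sgn τ * sgn τ' * Complex.exp (κ * (sgn τ * r - sgn τ' * r')) := by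
      rw [sgn_neg, sgn_neg]
      congr 1
      · ring
      · congr 1
        ring
    rw [h1, h2, ha, residueTerm, residueTerm, h4, mul_add, ← hddef]
    have h5 : d * (Complex.exp (Complex.I * pole j * (sgn τ * r - sgn τ' * r')) / d *
        coeffL l τ τ' (pole j) r r') =
        Complex.exp (Complex.I * pole j * (sgn τ * r - sgn τ' * r')) * coeffL l τ τ' (pole j) r r' := by
      field_simp
    rw [h5, sub_eq_add_neg]
    congr 1
    set X := Complex.exp (Complex.I * pole j * (sgn (-τ) * r - sgn (-τ') * r'))
    set Y := coeffL l (-τ) (-τ') (pole j) r r'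
    set e := Complex.exp (κ * (sgn τ' * r' - sgn τ * r))
    set e' := Complex.exp (κ * (sgn τ * r - sgn τ' * r'))
    -- This relates the denominator for `(τ,τ')` to that for `(-τ,-τ')` and absorbs the minus sign
    -- of the reflected residue.
    have h6 : d = -(sgn τ * sgn τ' * e) * (1 - sgn τ * sgn τ' * e') := by
      rw [hddef]
      linear_combination (-(e * e')) * hss - h3
    rw [h6]
    field_simp
  simp only [rectIntegral, hbot, htop, hresid] at h
  rw [intervalIntegral.integral_const_mul] at h
  have h7 : d * ∫ k : ℝ in -P..P, coeffN m τ τ' k r r' * Complex.exp (Complex.I * k * a) =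
      d * (2 * Real.pi * Complex.I * ∑ j, res j * (residueTerm κ l τ τ' (pole j) r r' +
        residueTerm κ l (-τ) (-τ') (pole j) r r')) +
        (Complex.I * (∫ y : ℝ in (0 : ℝ)..κ, u (-P + y * Complex.I) *
          (Complex.exp (Complex.I * (-P + y * Complex.I) * a) *
            coeffL l τ τ' (-P + y * Complex.I) r r')) -
        Complex.I * ∫ y : ℝ in (0 : ℝ)..κ, u (P + y * Complex.I) *
          (Complex.exp (Complex.I * (P + y * Complex.I) * a) *
            coeffL l τ τ' (P + y * Complex.I) r r')) := by
    have h8 : d * (2 * Real.pi * Complex.I * ∑ j, res j * (residueTerm κ l τ τ' (pole j) r r' +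
        residueTerm κ l (-τ) (-τ') (pole j) r r')) = 2 * Real.pi * Complex.I *
        ∑ j, res j * (d * (residueTerm κ l τ τ' (pole j) r r' +
        residueTerm κ l (-τ) (-τ') (pole j) r r')) := by
      rw [mul_left_comm, Finset.mul_sum]
      congr 1
      exact Finset.sum_congr rfl fun j _ => by ring
    rw [h8, ← h]
    ring
  apply mul_left_cancel₀ hd
  rw [h7, mul_add, ← mul_assoc d d⁻¹, mul_inv_cancel₀ hd, one_mul]

end

/-- The integrand over the full momentum line obtained by unfolding the spectral kernel. -/
noncomputable def spectralDensity (m : ℤˣ → ℂ → ℂ → ℂ) (k r r' : ℝ) : ℂ :=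
  coeffN m 1 1 k r r' * Complex.exp (Complex.I * k * (r - r' : ℝ)) +
    coeffN m 1 (-1) k r r' * Complex.exp (Complex.I * k * (r + r' : ℝ))

section

variable {ρ γ : ℝ} {w : ℂ → ℂ} {m : ℤˣ → ℂ → ℂ → ℂ} {T R : ℝ → ℂ}
  {κ γ' : ℝ} {v : ℂ → ℂ} {l : ℤˣ → ℝ → ℂ → ℂ} {C : ℂ → ℂ} {n : ℕ} {pole res : Fin n → ℂ}

theorem Admissible.continuous_m (hA : Admissible ρ γ w m T R) (τ : ℤˣ) {X : Type*}
    [TopologicalSpace X] {f g : X → ℝ} (hf : Continuous f) (hg : Continuous g) :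
    Continuous fun x => m τ (f x) (g x) :=
  (hA.m_smooth τ).continuous.comp (hf.prodMk hg)

theorem Admissible.continuous_coeffN (hA : Admissible ρ γ w m T R) (τ τ' : ℤˣ) :
    Continuous fun q : ℝ × ℝ × ℝ => coeffN m τ τ' (q.1 : ℂ) q.2.1 q.2.2 := by
  unfold coeffN
  have hn : ∀ q : ℝ × ℝ × ℝ, -(q.1 : ℂ) = ((-q.1 : ℝ) : ℂ) := fun q => by push_cast; rfl
  simp only [hn]
  exact ((hA.continuous_m τ (by fun_prop) (by fun_prop)).mul
    (hA.continuous_m τ' (by fun_prop) (by fun_prop))).add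
    ((hA.continuous_m (-τ) (by fun_prop) (by fun_prop)).mul
    (hA.continuous_m (-τ') (by fun_prop) (by fun_prop)))

theorem Admissible.continuous_spectralDensity (hA : Admissible ρ γ w m T R) :
    Continuous fun q : ℝ × ℝ × ℝ => spectralDensity m q.1 q.2.1 q.2.2 := by
  have h1 := hA.continuous_coeffN 1 1
  have h2 := hA.continuous_coeffN 1 (-1)
  unfold spectralDensity
  fun_prop

/-! ### The vertical sides and the truncated spectral integral -/

theorem norm_exp_I_mul_mul_ofReal (z : ℂ) (a : ℝ) :
    ‖Complex.exp (Complex.I * z * a)‖ = Real.exp (-(a * z.im)) := by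
  rw [Complex.norm_exp]
  congr 1
  simp [mul_comm]

/-- Factoring the product of coefficients through the dual weight requires `v` to be regular at `z`
and `-z`. The estimate therefore comes from nearby points, using continuity of the regularized
weight. -/
theorem DualAdmissible.norm_regularized_sub_le (hB : DualAdmissible ρ w m κ γ' v l C) {u : ℂ → ℂ}
    {z : ℂ} (hc : ContinuousAt u z) (hu : ∀ᶠ y in 𝓝[≠] z, u y = dualWeight v y) {τ τ' : ℤˣ}
    {r r' a A : ℝ} {c : ℂ}
    (hN : ∀ᶠ y in 𝓝[≠] z, ‖coeffN m τ τ' y r r' - c‖ ≤ A * Real.exp (-γ' * |y.re|)) :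
    ‖u z * (Complex.exp (Complex.I * z * a) * coeffL l τ τ' z r r') -
      c * Complex.exp (Complex.I * z * a)‖ ≤
      A * Real.exp (-γ' * |z.re|) * Real.exp (-(a * z.im)) := by
  have h1 : ContinuousAt (fun z => ‖u z * (Complex.exp (Complex.I * z * a) *
      coeffL l τ τ' z r r') - c * Complex.exp (Complex.I * z * a)‖) z :=
    ((hc.mul (differentiable_exp_mul_coeffL hB τ τ' a r r').continuous.continuousAt).sub
      (by fun_prop)).norm
  have h2 : Continuous fun z : ℂ => A * Real.exp (-γ' * |z.re|) * Real.exp (-(a * z.im)) := by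
    fun_prop
  refine le_of_tendsto_of_tendsto (h1.tendsto.mono_left nhdsWithin_le_nhds)
    ((h2.tendsto z).mono_left (nhdsWithin_le_nhds (s := {z}ᶜ))) ?_
  filter_upwards [hu, hN, eventually_analyticAt_neg hB.v_meromorphic z] with y hy1 hy2 hy3
  have h3 : u y * (Complex.exp (Complex.I * y * a) * coeffL l τ τ' y r r') -
      c * Complex.exp (Complex.I * y * a) =
      (coeffN m τ τ' y r r' - c) * Complex.exp (Complex.I * y * a) := by
    rw [hy1, ← hB.dualWeight_mul_coeffL τ τ' hy3.1 hy3.2]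
    ring
  rw [h3, norm_mul, norm_exp_I_mul_mul_ofReal]
  gcongr

/-- Comparison of the integral over a vertical side with its asymptotic value. -/
theorem DualAdmissible.norm_vertical_sub_le (hB : DualAdmissible ρ w m κ γ' v l C) {u : ℂ → ℂ}
    {Q : ℝ} (hc : ∀ z : ℂ, 0 ≤ z.im → z.im ≤ κ → z.re = Q → ContinuousAt u z)
    (hu : ∀ z : ℂ, ∀ᶠ y in 𝓝[≠] z, u y = dualWeight v y) {τ τ' : ℤˣ}
    {r r' a A D : ℝ} {c : ℂ} (haD : |a| ≤ D) (hA : 0 ≤ A)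
    (hN : ∀ᶠ x in 𝓝 Q, ∀ y : ℂ, y.re = x → |y.im| ≤ κ + 1 →
      ‖coeffN m τ τ' y r r' - c‖ ≤ A * Real.exp (-γ' * |y.re|)) :
    ‖(∫ y : ℝ in (0 : ℝ)..κ, u (Q + y * Complex.I) *
        (Complex.exp (Complex.I * (Q + y * Complex.I) * a) *
          coeffL l τ τ' (Q + y * Complex.I) r r')) -
      ∫ y : ℝ in (0 : ℝ)..κ, c * Complex.exp (Complex.I * (Q + y * Complex.I) * a)‖ ≤
      κ * A * Real.exp (D * κ) * Real.exp (-γ' * |Q|) := by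
  have hκ := hB.kappa_pos.le
  have hre : ∀ y : ℝ, ((Q : ℂ) + y * Complex.I).re = Q := fun y => by simp
  have him : ∀ y : ℝ, ((Q : ℂ) + y * Complex.I).im = y := fun y => by simp
  rw [← intervalIntegral.integral_sub]
  · refine (intervalIntegral.norm_integral_le_of_norm_le_const
      (C := A * Real.exp (-γ' * |Q|) * Real.exp (D * κ)) fun y hy => ?_).trans (le_of_eq ?_)
    · rw [uIoc_of_le hκ] at hy
      have h1 := hB.norm_regularized_sub_le (z := Q + y * Complex.I) (a := a) (c := c) (A := A)
        (τ := τ) (τ' := τ') (r := r) (r' := r')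
        (hc _ (by rw [him]; exact hy.1.le) (by rw [him]; exact hy.2) (hre y)) (hu _) (by
          have e1 : ∀ᶠ z : ℂ in 𝓝 ((Q : ℂ) + y * Complex.I), |z.im| < κ + 1 :=
            (Complex.continuous_im.abs.tendsto _).eventually_lt_const (by
              rw [him, abs_of_pos hy.1]
              linarith [hy.2])
          have e2 := (Complex.continuous_re.tendsto ((Q : ℂ) + y * Complex.I)).eventually
            (by rw [hre]; exact hN)
          refine eventually_nhdsWithin_of_eventually_nhds ?_
          filter_upwards [e1, e2] with z hz1 hz2
          exact hz2 z rfl hz1.le)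
      rw [hre, him] at h1
      refine h1.trans ?_
      have h2 : -(a * y) ≤ D * κ := by
        calc -(a * y) ≤ |a| * y := by nlinarith [neg_abs_le a, hy.1]
          _ ≤ D * κ := mul_le_mul haD hy.2 hy.1.le ((abs_nonneg a).trans haD)
      gcongr
    · rw [sub_zero, abs_of_nonneg hκ]
      ring
  · refine ContinuousOn.intervalIntegrable fun y hy => ?_
    rw [uIcc_of_le hκ] at hy
    have h1 : ContinuousAt (fun y : ℝ => (Q : ℂ) + y * Complex.I) y := by fun_prop
    have h2 : ContinuousAt u ((Q : ℂ) + y * Complex.I) :=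
      hc _ (by rw [him]; exact hy.1) (by rw [him]; exact hy.2) (hre y)
    have h3 : ContinuousAt (fun z => Complex.exp (Complex.I * z * a) * coeffL l τ τ' z r r')
        ((Q : ℂ) + y * Complex.I) :=
      (differentiable_exp_mul_coeffL hB τ τ' a r r').continuous.continuousAt
    exact (ContinuousAt.comp (f := fun y : ℝ => (Q : ℂ) + y * Complex.I)
      (h2.mul h3) h1).continuousWithinAt
  · exact Continuous.intervalIntegrable (by fun_prop) _ _

theorem integral_exp_symm {x : ℝ} (hx : x ≠ 0) (P : ℝ) :
    ∫ k : ℝ in -P..P, Complex.exp (Complex.I * k * x) =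
      -Complex.I * (Complex.exp (Complex.I * P * x) - Complex.exp (-(Complex.I * P * x))) / x := by
  have hx' : (x : ℂ) ≠ 0 := by exact_mod_cast hx
  have h1 : ∀ k : ℝ, Complex.exp (Complex.I * k * x) = Complex.exp (Complex.I * x * k) :=
    fun k => by congr 1; ring
  simp only [h1]
  rw [integral_exp_mul_complex (mul_ne_zero Complex.I_ne_zero hx')]
  push_cast
  rw [show Complex.I * x * P = Complex.I * P * x by ring,
    show Complex.I * x * -P = -(Complex.I * P * x) by ring, div_eq_div_iff
      (mul_ne_zero Complex.I_ne_zero hx') hx']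
  linear_combination ((Complex.exp (Complex.I * P * x) - Complex.exp (-(Complex.I * P * x))) *
    x) * Complex.I_mul_I

/-- The asymptotic form of the truncated spectral integral off the diagonal. -/
noncomputable def spectralLimit (κ : ℝ) (l : ℤˣ → ℝ → ℂ → ℂ) (C : ℂ → ℂ) {n : ℕ}
    (pole res : Fin n → ℂ) (P r r' : ℝ) : ℂ :=
  2 * Real.pi * Complex.I *
      ∑ j, res j * ∑ τ : ℤˣ, ∑ τ' : ℤˣ, residueTerm κ l τ τ' (pole j) r r' +
    C r * (starRingEnd ℂ) (C r') * (∫ k : ℝ in -P..P, Complex.exp (Complex.I * k * (r - r'))) +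
    -Complex.I * (C r * (starRingEnd ℂ) (C r') - (starRingEnd ℂ) (C r) * C r') / (r - r' : ℝ) *
      Complex.exp (-(Complex.I * P * (r - r')))

/-- With `x = r - r'`, the vertical sides contribute `i (c' exp(-iPx) - c exp(iPx)) / x` up to
exponentially small errors, where `c` and `c'` are the limits of the coefficient at the right and
left. Completing the `c`-part to a Dirichlet kernel leaves the oscillating term with coefficient `-i
(c - c') / x`. -/
theorem DualAdmissible.exists_norm_sub_spectralLimit_le (hA : Admissible ρ γ w m T R)
    (hB : DualAdmissible ρ w m κ γ' v l C) (hpole : IsPolePairing κ v pole res) {M : ℝ}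
    (hM : 0 < M) :
    ∃ A, 0 ≤ A ∧ ∃ B > 0, ∀ P ≥ B, ∀ r r' : ℝ, |r| ≤ M → |r'| ≤ M → r ≠ r' →
      ‖(∫ k : ℝ in -P..P, spectralDensity m k r r') - spectralLimit κ l C pole res P r r'‖ ≤
        A * Real.exp (-γ' * P) / |r - r'| := by
  obtain ⟨u, B₁, hB₁, hu1, hu2, hu3, hu4⟩ := hB.exists_regularized_weight hpole
  -- The strip is widened by 1 because the estimates on the sides need a full neighbourhood of each
  -- point.
  obtain ⟨A, hA0, B₂, hB₂, hN⟩ := hB.exists_coeffN_asymptotics M (κ + 1)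
  have hκ := hB.kappa_pos
  set Q : ℝ := κ * A * Real.exp (2 * M * κ) with hQ
  have hQ0 : 0 ≤ Q := by positivity
  -- The first summand bounds the error divided by `1 - exp(-κx)`. The second comes from the
  -- opposite-sign denominator, whose inverse is at most `1 ≤ 2M/|x|`.
  refine ⟨(1 + κ * (2 * M)) / κ * (2 * Q) + 2 * M * (2 * Q), by positivity, B₁ + B₂ + 1,
    by positivity, fun P hP r r' hr hr' hne => ?_⟩
  have hP0 : 0 < P := by linarith
  set x := r - r' with hx
  have hx0 : x ≠ 0 := sub_ne_zero.2 hne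
  have hxp : 0 < |x| := abs_pos.2 hx0
  have hxM : |x| ≤ 2 * M := by
    have := abs_sub r r'
    linarith
  have hyM : |r + r'| ≤ 2 * M := by
    have := abs_add_le r r'
    linarith
  set e := Real.exp (-γ' * P) with he
  have he0 : 0 < e := Real.exp_pos _
  have hexpne : ∀ s : ℝ, s ≠ 0 → (1 : ℂ) - Complex.exp s ≠ 0 := by
    intro s hs h
    rw [sub_eq_zero, ← Complex.ofReal_exp, ← Complex.ofReal_one, Complex.ofReal_inj, eq_comm,
      Real.exp_eq_one_iff] at h
    exact hs h
  have hexppos : ∀ s : ℝ, (1 : ℝ) ≤ ‖(1 : ℂ) + Complex.exp s‖ := by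
    intro s
    rw [← Complex.ofReal_exp, ← Complex.ofReal_one, ← Complex.ofReal_add, Complex.norm_real,
      Real.norm_eq_abs, abs_of_pos (by positivity)]
    linarith [Real.exp_pos s]
  have hexpne' : ∀ s : ℝ, (1 : ℂ) + Complex.exp s ≠ 0 := fun s h => by
    have := hexppos s
    rw [h, norm_zero] at this
    linarith
  -- the vertical sides
  have hcR : ∀ z : ℂ, 0 ≤ z.im → z.im ≤ κ → z.re = P → ContinuousAt u z := fun z h0 h1 h2 =>
    hu2 z h0 h1 (by rw [h2, abs_of_pos hP0]; linarith)
  have hcL : ∀ z : ℂ, 0 ≤ z.im → z.im ≤ κ → z.re = -P → ContinuousAt u z := fun z h0 h1 h2 =>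
    hu2 z h0 h1 (by rw [h2, abs_neg, abs_of_pos hP0]; linarith)
  have hR : ∀ᶠ x in 𝓝 P, B₂ < x := eventually_gt_nhds (by linarith)
  have hL : ∀ᶠ x in 𝓝 (-P), x < -B₂ := eventually_lt_nhds (by linarith)
  have v1 := hB.norm_vertical_sub_le hcR hu3 (τ := 1) (τ' := 1) (r := r) (r' := r') (a := x)
    (c := C r * (starRingEnd ℂ) (C r')) hxM hA0.le (by
      filter_upwards [hR] with s hs y hy1 hy2
      exact (hN r r' hr hr' y hy2).1 (by rw [hy1]; exact hs.le))
  have v2 := hB.norm_vertical_sub_le hcL hu3 (τ := 1) (τ' := 1) (r := r) (r' := r') (a := x)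
    (c := (starRingEnd ℂ) (C r) * C r') hxM hA0.le (by
      filter_upwards [hL] with s hs y hy1 hy2
      exact (hN r r' hr hr' y hy2).2.1 (by rw [hy1]; linarith))
  have v3 := hB.norm_vertical_sub_le hcR hu3 (τ := 1) (τ' := -1) (r := r) (r' := r')
    (a := r + r') (c := 0) hyM hA0.le (by
      filter_upwards [hR] with s hs y hy1 hy2
      rw [sub_zero]
      exact (hN r r' hr hr' y hy2).2.2 (by rw [hy1]; exact hs.le.trans (le_abs_self _)))
  have v4 := hB.norm_vertical_sub_le hcL hu3 (τ := 1) (τ' := -1) (r := r) (r' := r')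
    (a := r + r') (c := 0) hyM hA0.le (by
      filter_upwards [hL] with s hs y hy1 hy2
      rw [sub_zero]
      exact (hN r r' hr hr' y hy2).2.2 (by rw [hy1]; linarith [neg_le_abs s]))
  rw [integral_exp_vertical _ hx0, abs_of_pos hP0] at v1
  rw [integral_exp_vertical _ hx0, abs_neg, abs_of_pos hP0] at v2
  simp only [zero_mul, intervalIntegral.integral_zero, sub_zero] at v3 v4
  rw [abs_of_pos hP0] at v3
  rw [abs_neg, abs_of_pos hP0] at v4
  -- the contour identities
  have hd1 : (1 : ℂ) - sgn 1 * sgn 1 * Complex.exp (κ * (sgn 1 * r' - sgn 1 * r)) =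
      1 - Complex.exp ((-(κ * x) : ℝ) : ℂ) := by
    simp only [sgn, hx]
    push_cast
    ring_nf
  have hd1' : (1 : ℂ) - sgn 1 * sgn 1 * Complex.exp (κ * (sgn 1 * r - sgn 1 * r')) =
      1 - Complex.exp ((κ * x : ℝ) : ℂ) := by
    simp only [sgn, hx]
    push_cast
    ring_nf
  have hd2 : (1 : ℂ) - sgn 1 * sgn (-1) * Complex.exp (κ * (sgn (-1) * r' - sgn 1 * r)) =
      1 + Complex.exp ((-(κ * (r + r')) : ℝ) : ℂ) := by
    simp only [sgn]
    push_cast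
    ring_nf
  have hd2' : (1 : ℂ) - sgn 1 * sgn (-1) * Complex.exp (κ * (sgn 1 * r - sgn (-1) * r')) =
      1 + Complex.exp ((κ * (r + r') : ℝ) : ℂ) := by
    simp only [sgn]
    push_cast
    ring_nf
  have hκx : κ * x ≠ 0 := mul_ne_zero hκ.ne' hx0
  have i1 := hB.contour_identity hA hu1 (hu4 P (by linarith)) 1 1 r r'
    (by rw [hd1]; exact hexpne _ (neg_ne_zero.2 hκx)) (by rw [hd1']; exact hexpne _ hκx) (a := x)
    (by simp [hx, sgn])
  have i2 := hB.contour_identity hA hu1 (hu4 P (by linarith)) 1 (-1) r r'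
    (by rw [hd2]; exact hexpne' _) (by rw [hd2']; exact hexpne' _) (a := r + r')
    (by simp [sgn])
  rw [hd1] at i1
  rw [hd2] at i2
  rw [← Complex.ofReal_neg P] at i1 i2
  set V1 := ∫ y : ℝ in (0 : ℝ)..κ, u (P + y * Complex.I) *
        (Complex.exp (Complex.I * (P + y * Complex.I) * x) *
          coeffL l 1 1 (P + y * Complex.I) r r') with hV1
  set V2 := ∫ y : ℝ in (0 : ℝ)..κ, u ((-P : ℝ) + y * Complex.I) *
        (Complex.exp (Complex.I * ((-P : ℝ) + y * Complex.I) * x) *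
          coeffL l 1 1 ((-P : ℝ) + y * Complex.I) r r') with hV2
  set V3 := ∫ y : ℝ in (0 : ℝ)..κ, u (P + y * Complex.I) *
        (Complex.exp (Complex.I * (P + y * Complex.I) * (r + r' : ℝ)) *
          coeffL l 1 (-1) (P + y * Complex.I) r r') with hV3
  set V4 := ∫ y : ℝ in (0 : ℝ)..κ, u ((-P : ℝ) + y * Complex.I) *
        (Complex.exp (Complex.I * ((-P : ℝ) + y * Complex.I) * (r + r' : ℝ)) *
          coeffL l 1 (-1) ((-P : ℝ) + y * Complex.I) r r') with hV4
  set c := C r * (starRingEnd ℂ) (C r') with hc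
  set c' := (starRingEnd ℂ) (C r) * C r' with hc'
  set d := 1 - Complex.exp ((-(κ * x) : ℝ) : ℂ) with hd
  set d₂ := 1 + Complex.exp ((-(κ * (r + r')) : ℝ) : ℂ) with hd₂
  have hd0 : d ≠ 0 := hexpne _ (neg_ne_zero.2 hκx)
  have hsplit : ∫ k : ℝ in -P..P, spectralDensity m k r r' =
      (∫ k : ℝ in -P..P, coeffN m 1 1 k r r' * Complex.exp (Complex.I * k * x)) +
      ∫ k : ℝ in -P..P, coeffN m 1 (-1) k r r' * Complex.exp (Complex.I * k * (r + r' : ℝ)) := by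
    have hcN : ∀ τ τ' : ℤˣ, Continuous fun k : ℝ => coeffN m τ τ' (k : ℂ) r r' := fun τ τ' =>
      (hA.continuous_coeffN τ τ').comp
        (continuous_id.prodMk (continuous_const (y := ((r, r') : ℝ × ℝ))))
    exact intervalIntegral.integral_add
      (((hcN 1 1).mul (by fun_prop)).intervalIntegrable _ _)
      (((hcN 1 (-1)).mul (by fun_prop)).intervalIntegrable _ _)
  have hxC : (x : ℂ) ≠ 0 := by exact_mod_cast hx0
  have hmain : (∫ k : ℝ in -P..P, spectralDensity m k r r') -
      spectralLimit κ l C pole res P r r' =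
      d⁻¹ * (Complex.I * (V2 - c' * Complex.exp (Complex.I * (-P : ℝ) * x) * d / x) -
        Complex.I * (V1 - c * Complex.exp (Complex.I * P * x) * d / x)) +
      d₂⁻¹ * (Complex.I * V4 - Complex.I * V3) := by
    have hI := integral_exp_symm hx0 P
    have hxe : ((r : ℂ) - r') = x := by rw [hx]; push_cast; rfl
    have hsum : (∑ j, res j * (residueTerm κ l 1 1 (pole j) r r' +
        residueTerm κ l (-1) (-1) (pole j) r r')) + ∑ j, res j *
        (residueTerm κ l 1 (-1) (pole j) r r' + residueTerm κ l (-1) (- -1) (pole j) r r') =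
        ∑ j, res j * ∑ τ : ℤˣ, ∑ τ' : ℤˣ, residueTerm κ l τ τ' (pole j) r r' := by
      rw [← Finset.sum_add_distrib]
      refine Finset.sum_congr rfl fun j _ => ?_
      simp only [sum_signs, neg_neg]
      ring
    rw [hsplit, i1, i2, spectralLimit, hxe, hI, ← hsum, ← hx, ← hc, ← hc']
    have hee : Complex.exp (Complex.I * (-P : ℝ) * x) = Complex.exp (-(Complex.I * P * x)) := by
      congr 1
      push_cast
      ring
    rw [hee]
    field_simp
    ring
  have hVb : ∀ a b : ℂ, ‖a‖ ≤ Q * e → ‖b‖ ≤ Q * e → ‖Complex.I * a - Complex.I * b‖ ≤ 2 * Q * e := by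
    intro a b h1 h2
    refine (norm_sub_le _ _).trans ?_
    rw [norm_mul, norm_mul, Complex.norm_I, one_mul, one_mul]
    linarith
  have b1 := hVb _ _ v2 v1
  have b2 := hVb _ _ v4 v3
  have hdinv := norm_inv_one_sub_exp_le (neg_ne_zero.2 hκx)
  rw [abs_neg, abs_mul, abs_of_pos hκ, ← hd] at hdinv
  have hdinv' : ‖d⁻¹‖ ≤ (1 + κ * (2 * M)) / κ / |x| := by
    refine hdinv.trans ?_
    rw [div_div]
    gcongr
  have hd2inv : ‖d₂⁻¹‖ ≤ 2 * M / |x| := by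
    rw [norm_inv]
    refine (inv_le_one_of_one_le₀ (hexppos _)).trans ?_
    rwa [one_le_div hxp]
  rw [hmain]
  calc _ ≤ ‖d⁻¹‖ * (2 * Q * e) + ‖d₂⁻¹‖ * (2 * Q * e) := by
        refine (norm_add_le _ _).trans ?_
        rw [norm_mul, norm_mul]
        gcongr
    _ ≤ (1 + κ * (2 * M)) / κ / |x| * (2 * Q * e) + 2 * M / |x| * (2 * Q * e) := by gcongr
    _ = _ := by ring

end

/-! ### The limit of the truncated spectral integrals -/

theorem IsPosTest.exists_support_bound {f : ℝ → ℂ} (hf : IsPosTest f) :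
    ∃ M > 0, ∀ M' ≥ M, ∀ r, M' < |r| → f r = 0 := by
  obtain ⟨M, hM⟩ := hf.2.isCompact.isBounded.exists_norm_le
  refine ⟨|M| + 1, by positivity, fun M' hM' r hr => ?_⟩
  by_contra h
  have h1 := hM r (subset_tsupport f h)
  rw [Real.norm_eq_abs] at h1
  linarith [le_abs_self M]

theorem IsPosTest.exists_norm_le {f : ℝ → ℂ} (hf : IsPosTest f) : ∃ A, 0 ≤ A ∧ ∀ r, ‖f r‖ ≤ A := by
  obtain ⟨A, hA⟩ := hf.1.continuous.bounded_above_of_compact_support hf.2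
  exact ⟨A, (norm_nonneg _).trans (hA 0), hA⟩

theorem ae_prod_ne : ∀ᵐ p : ℝ × ℝ ∂(volume.prod volume), p.1 ≠ p.2 := by
  have hm : MeasurableSet {p : ℝ × ℝ | p.1 = p.2} := isClosed_diagonal.measurableSet
  have h0 : (volume.prod volume : Measure (ℝ × ℝ)) {p : ℝ × ℝ | p.1 = p.2} = 0 := by
    rw [Measure.measure_prod_null hm]
    refine Eventually.of_forall fun x => ?_
    have : Prod.mk x ⁻¹' {p : ℝ × ℝ | p.1 = p.2} = {x} := by
      ext y
      simp [eq_comm]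
    simp [this]
  rw [ae_iff]
  simpa using h0

/-- An integrable majorant for kernels that are weakly singular on the diagonal. -/
theorem integrable_majorant {f g : ℝ → ℂ} {F G : ℝ} (hf : ∀ r, ‖f r‖ ≤ F) (hg : ∀ r, ‖g r‖ ≤ G)
    (hF : 0 ≤ F)
    {M : ℝ} (hfM : ∀ r, M < |r| → f r = 0) (hgM : ∀ r, M < |r| → g r = 0) {s : ℝ} (hs : -1 < s)
    {A : ℝ} :
    ∃ b : ℝ × ℝ → ℝ, Integrable b (volume.prod volume) ∧ ∀ (K : ℂ) (p : ℝ × ℝ),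
      (|p.1| ≤ M → |p.2| ≤ M → ‖K‖ ≤ A * |p.1 - p.2| ^ s) →
      ‖(starRingEnd ℂ) (f p.1) * g p.2 * K‖ ≤ b p := by
  refine ⟨indicator (Icc (-M) M ×ˢ Icc (-M) M) fun p => F * G * (A * |p.1 - p.2| ^ s), ?_,
    fun K p hK => ?_⟩
  · rw [integrable_indicator_iff (measurableSet_Icc.prod measurableSet_Icc)]
    exact ((integrableOn_abs_sub_rpow hs M).const_mul A).const_mul (F * G)
  · by_cases hp : p ∈ Icc (-M) M ×ˢ Icc (-M) M
    · rw [indicator_of_mem hp, norm_mul, norm_mul, RCLike.norm_conj]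
      have h1 := hK (abs_le.2 hp.1) (abs_le.2 hp.2)
      have h2 := hf p.1
      have h3 := hg p.2
      have h4 : 0 ≤ G := (norm_nonneg _).trans h3
      gcongr
    · rw [indicator_of_notMem hp]
      rw [mem_prod, mem_Icc, mem_Icc, ← abs_le, ← abs_le, not_and_or, not_le, not_le] at hp
      rcases hp with hp | hp
      · simp [hfM _ hp]
      · simp [hgM _ hp]

section

variable {ρ γ : ℝ} {w : ℂ → ℂ} {m : ℤˣ → ℂ → ℂ → ℂ} {T R : ℝ → ℂ}
  {κ γ' : ℝ} {v : ℂ → ℂ} {l : ℤˣ → ℝ → ℂ → ℂ} {C : ℂ → ℂ} {n : ℕ} {pole res : Fin n → ℂ}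

theorem IsPolePairing.abs_im_lt (hpole : IsPolePairing κ v pole res) (j : Fin n) :
    |(pole j).im| < κ := by
  have := (hpole.poles (pole j)).2 ⟨j, Or.inl rfl⟩
  rw [abs_of_pos this.1]
  exact this.2.1

theorem DualAdmissible.integrable_residueKernel (hA : Admissible ρ γ w m T R)
    (hB : DualAdmissible ρ w m κ γ' v l C) {k₀ : ℂ} (hk₀ : |k₀.im| < κ) {f g : ℝ → ℂ}
    (hf : IsPosTest f) (hg : IsPosTest g) :
    Integrable (fun p : ℝ × ℝ =>
      (starRingEnd ℂ) (f p.1) * g p.2 * residueKernel w κ l k₀ p.1 p.2)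
      (volume.prod volume) := by
  obtain ⟨M₁, hM₁, hfM⟩ := hf.exists_support_bound
  obtain ⟨M₂, hM₂, hgM⟩ := hg.exists_support_bound
  obtain ⟨F, hF0, hF⟩ := hf.exists_norm_le
  obtain ⟨G, hG0, hG⟩ := hg.exists_norm_le
  obtain ⟨θ, hθ, -, A, hA0, hK⟩ := hB.exists_norm_residueKernel_le hA hk₀
    (M := M₁ + M₂) (by positivity)
  obtain ⟨b, hb, hbK⟩ := integrable_majorant hF hG hF0 (hfM (M₁ + M₂) (by linarith))
    (hgM (M₁ + M₂) (by linarith)) (s := θ - 1) (by linarith) (A := A)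
  refine hb.mono' ?_ ?_
  · have h1 := hf.1.continuous
    have h2 := hg.1.continuous
    exact (Continuous.aestronglyMeasurable (by fun_prop)).mul
      (hB.measurable_residueKernel hA hk₀).aestronglyMeasurable
  · filter_upwards [ae_prod_ne] with p hp
    exact hbK _ p fun h1 h2 => hK p.1 p.2 h1 h2 hp

theorem DualAdmissible.exists_norm_m_real_le (hA : Admissible ρ γ w m T R)
    (hB : DualAdmissible ρ w m κ γ' v l C) (M : ℝ) :
    ∃ A > 0, ∀ τ, ∀ k r : ℝ, |r| ≤ M → ‖m τ r k‖ ≤ A := by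
  obtain ⟨A₁, hA₁, B, hB0, h1⟩ := hB.exists_norm_m_le M 0
  have h2 : ∀ τ, ∃ A₂, ∀ p ∈ Icc (-M) M ×ˢ Icc (-B) B, ‖m τ (p.1 : ℝ) (p.2 : ℝ)‖ ≤ A₂ := fun τ =>
    (isCompact_Icc.prod isCompact_Icc).exists_bound_of_continuousOn
      (hA.m_smooth τ).continuous.continuousOn
  choose A₂ h2 using h2
  refine ⟨A₁ + ∑ τ, |A₂ τ|, by positivity, fun τ k r hr => ?_⟩
  have h3 : |A₂ τ| ≤ ∑ τ, |A₂ τ| :=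
    Finset.single_le_sum (f := fun τ => |A₂ τ|) (fun i _ => abs_nonneg _) (Finset.mem_univ τ)
  rcases le_total B |k| with hk | hk
  · have := h1 τ k r hr (by simp) (by simpa using hk)
    linarith [abs_nonneg (A₂ τ)]
  · have := h2 τ (r, k) ⟨abs_le.1 hr, abs_le.1 hk⟩
    simp only at this
    linarith [le_abs_self (A₂ τ)]

theorem DualAdmissible.exists_norm_spectralDensity_le (hA : Admissible ρ γ w m T R)
    (hB : DualAdmissible ρ w m κ γ' v l C) (M : ℝ) :
    ∃ A > 0, ∀ k r r' : ℝ, |r| ≤ M → |r'| ≤ M → ‖spectralDensity m k r r'‖ ≤ A := by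
  obtain ⟨A, hA0, h⟩ := hB.exists_norm_m_real_le hA M
  have hN : ∀ τ τ', ∀ k r r' : ℝ, |r| ≤ M → |r'| ≤ M →
      ‖coeffN m τ τ' k r r'‖ ≤ 2 * A ^ 2 := by
    intro τ τ' k r r' hr hr'
    have h1 := h τ k r hr
    have h2 := h τ' (-k) r' hr'
    have h3 := h (-τ) k (-r) (by rwa [abs_neg])
    have h4 := h (-τ') (-k) (-r') (by rwa [abs_neg])
    rw [Complex.ofReal_neg k] at h2 h4
    calc _ ≤ ‖m τ r k‖ * ‖m τ' r' (-k)‖ + ‖m (-τ) (-r : ℝ) k‖ * ‖m (-τ') (-r' : ℝ) (-k)‖ := by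
          rw [← norm_mul, ← norm_mul]
          exact norm_add_le _ _
      _ ≤ A * A + A * A := by gcongr
      _ = 2 * A ^ 2 := by ring
  refine ⟨4 * A ^ 2, by positivity, fun k r r' hr hr' => ?_⟩
  have he : ∀ a : ℝ, ‖Complex.exp (Complex.I * k * a)‖ = 1 := fun a => by
    rw [norm_exp_I_mul_mul_ofReal, Complex.ofReal_im, mul_zero, neg_zero, Real.exp_zero]
  refine (norm_add_le _ _).trans ?_
  rw [norm_mul, norm_mul, he, he]
  linarith [hN 1 1 k r r' hr hr', hN 1 (-1) k r r' hr hr']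

theorem DualAdmissible.contDiff_C (hB : DualAdmissible ρ w m κ γ' v l C) :
    ContDiff ℝ ∞ fun r : ℝ => C r :=
  (hB.C_entire.contDiff.restrict_scalars ℝ).comp Complex.ofRealCLM.contDiff

/-- The numerator vanishes on the diagonal and `C` is locally Lipschitz, so the quotient stays
bounded. -/
theorem DualAdmissible.exists_norm_offdiag_le (hB : DualAdmissible ρ w m κ γ' v l C) (M : ℝ) :
    ∃ A, 0 ≤ A ∧ ∀ r r' : ℝ, |r| ≤ M → |r'| ≤ M → r ≠ r' →
      ‖-Complex.I * (C r * (starRingEnd ℂ) (C r') - (starRingEnd ℂ) (C r) * C r') /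
        (r - r' : ℝ)‖ ≤ A := by
  obtain ⟨A, hA0, hC⟩ := hB.exists_norm_C_le M
  obtain ⟨Lip, hLip⟩ := (hB.contDiff_C.contDiffOn (s := Icc (-M) M)).exists_lipschitzOnWith
    (by simp) (convex_Icc _ _) isCompact_Icc
  refine ⟨2 * (Lip * A), by positivity, fun r r' hr hr' hne => ?_⟩
  have hx : 0 < |r - r'| := abs_pos.2 (sub_ne_zero.2 hne)
  have h1 : ‖C r - C r'‖ ≤ Lip * |r - r'| := by
    have := hLip.dist_le_mul r (abs_le.1 hr) r' (abs_le.1 hr')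
    rwa [dist_eq_norm, Real.dist_eq] at this
  rw [norm_div, norm_mul, norm_neg, Complex.norm_I, one_mul, Complex.norm_real, Real.norm_eq_abs,
    div_le_iff₀ hx]
  calc _ = ‖(C r - C r') * (starRingEnd ℂ) (C r') - (starRingEnd ℂ) (C r - C r') * C r'‖ := by
        rw [map_sub]
        congr 1
        ring
    _ ≤ ‖C r - C r'‖ * ‖C r'‖ + ‖C r - C r'‖ * ‖C r'‖ := by
        refine (norm_sub_le _ _).trans ?_
        rw [norm_mul, norm_mul, RCLike.norm_conj, RCLike.norm_conj]
    _ ≤ Lip * |r - r'| * A + Lip * |r - r'| * A := by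
        have := hC r' hr'
        gcongr
    _ = _ := by ring

theorem one_add_mul_exp_neg_le {c P : ℝ} (hc : 0 < c) (hP : 0 ≤ P) :
    (1 + P) * Real.exp (-c * P) ≤ 1 + 1 / c := by
  rw [neg_mul, Real.exp_neg, ← div_eq_mul_inv, div_le_iff₀ (Real.exp_pos _)]
  have h1 := Real.add_one_le_exp (c * P)
  have h2 : 1 + P ≤ (1 + 1 / c) * (c * P + 1) := by
    have : (1 + 1 / c) * (c * P + 1) = 1 + P + (c * P + 1 / c) := by
      field_simp
      ring
    rw [this]
    have : 0 ≤ c * P + 1 / c := by positivity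
    linarith
  exact h2.trans (by gcongr)

theorem residueKernel_eq_residueTerm (k : ℂ) (r r' : ℝ) :
    residueKernel w κ l k r r' = sqrtWeight w r * sqrtWeight w r' *
      ∑ τ : ℤˣ, ∑ τ' : ℤˣ, residueTerm κ l τ τ' k r r' := rfl

/-! ### Weakly singular bounds for the truncation error -/

theorem DualAdmissible.exists_norm_sum_residueKernel_le (hA : Admissible ρ γ w m T R)
    (hB : DualAdmissible ρ w m κ γ' v l C) (hpole : IsPolePairing κ v pole res) {M : ℝ}
    (hM : 0 < M) :
    ∃ θ : ℝ, 0 < θ ∧ θ ≤ 1 ∧ ∃ A, 0 ≤ A ∧ ∀ r r' : ℝ, |r| ≤ M → |r'| ≤ M → r ≠ r' →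
      ‖∑ j, res j * residueKernel w κ l (pole j) r r'‖ ≤ A * |r - r'| ^ (θ - 1) := by
  choose θ' hθ' hθ'1 A hA0 hK using fun j =>
    hB.exists_norm_residueKernel_le hA (hpole.abs_im_lt j) hM
  obtain ⟨θ, hθ1, hθ0, hθ⟩ : ∃ θ : ℝ, θ ≤ 1 ∧ 0 < θ ∧ ∀ j, θ ≤ θ' j := by
    have h1 : ∀ᶠ θ : ℝ in 𝓝[>] 0, ∀ j, θ ≤ θ' j := eventually_all.2 fun j =>
      eventually_nhdsWithin_of_eventually_nhds (eventually_le_nhds (hθ' j))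
    have h2 : ∀ᶠ θ : ℝ in 𝓝[>] 0, θ ≤ 1 :=
      eventually_nhdsWithin_of_eventually_nhds (eventually_le_nhds one_pos)
    have h3 : ∀ᶠ θ : ℝ in 𝓝[>] 0, 0 < θ := eventually_mem_nhdsWithin
    exact (h2.and (h3.and h1)).exists
  refine ⟨θ, hθ0, hθ1, ∑ j, ‖res j‖ * (A j * (2 * M) ^ (θ' j - θ)),
    Finset.sum_nonneg fun j _ => by have := hA0 j; positivity, fun r r' hr hr' hne => ?_⟩
  have hx : 0 < |r - r'| := abs_pos.2 (sub_ne_zero.2 hne)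
  have hxM : |r - r'| ≤ 2 * M := by
    have := abs_sub r r'
    linarith
  rw [Finset.sum_mul]
  refine (norm_sum_le _ _).trans (Finset.sum_le_sum fun j _ => ?_)
  rw [norm_mul, mul_assoc]
  gcongr
  refine (hK j r r' hr hr' hne).trans ?_
  have h1 : |r - r'| ^ (θ' j - θ) ≤ (2 * M) ^ (θ' j - θ) :=
    Real.rpow_le_rpow hx.le hxM (by linarith [hθ j])
  calc _ = A j * (|r - r'| ^ (θ' j - θ) * |r - r'| ^ (θ - 1)) := by
        rw [← Real.rpow_add hx]
        ring_nf
    _ ≤ _ := by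
        rw [mul_assoc]
        have := hA0 j
        gcongr

theorem Admissible.exists_sqrtWeight_le (hA : Admissible ρ γ w m T R) (M : ℝ) :
    ∃ W, 0 ≤ W ∧ ∀ r : ℝ, |r| ≤ M → ‖(sqrtWeight w r : ℂ)‖ ≤ W := by
  obtain ⟨W, hW⟩ := (isCompact_Icc (a := -M) (b := M)).exists_bound_of_continuousOn
    hA.continuous_sqrtWeight.continuousOn
  refine ⟨|W|, abs_nonneg _, fun r hr => ?_⟩
  rw [Complex.norm_real]
  exact (hW r (abs_le.1 hr)).trans (le_abs_self _)

/-- A crude bound for the remainder, growing linearly in the truncation parameter. -/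
theorem DualAdmissible.exists_norm_remainder_le_linear (hA : Admissible ρ γ w m T R)
    (hB : DualAdmissible ρ w m κ γ' v l C) (hpole : IsPolePairing κ v pole res) {M : ℝ}
    (hM : 0 < M) :
    ∃ θ : ℝ, 0 < θ ∧ θ ≤ 1 ∧ ∃ A, 0 ≤ A ∧ ∀ P ≥ 0, ∀ r r' : ℝ, |r| ≤ M → |r'| ≤ M → r ≠ r' →
      ‖(sqrtWeight w r * sqrtWeight w r' : ℂ) * ((∫ k : ℝ in -P..P, spectralDensity m k r r') -
        spectralLimit κ l C pole res P r r')‖ ≤ A * (1 + P) * |r - r'| ^ (θ - 1) := by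
  obtain ⟨θ, hθ0, hθ1, A₁, hA₁, h1⟩ := hB.exists_norm_sum_residueKernel_le hA hpole hM
  obtain ⟨W, hW0, hW⟩ := hA.exists_sqrtWeight_le M
  obtain ⟨A₂, hA₂, h2⟩ := hB.exists_norm_spectralDensity_le hA M
  obtain ⟨A₃, hA₃, h3⟩ := hB.exists_norm_offdiag_le M
  obtain ⟨A₄, hA₄, h4⟩ := hB.exists_norm_C_le M
  set D := (2 * M) ^ (1 - θ) with hD
  have hD0 : 0 < D := by positivity
  refine ⟨θ, hθ0, hθ1, W * W * (2 * A₂ + 2 * A₄ * A₄ + A₃) * D + 2 * Real.pi * A₁, by positivity,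
    fun P hP r r' hr hr' hne => ?_⟩
  have hx : 0 < |r - r'| := abs_pos.2 (sub_ne_zero.2 hne)
  have hxM : |r - r'| ≤ 2 * M := by
    have := abs_sub r r'
    linarith
  have hDx : 1 ≤ D * |r - r'| ^ (θ - 1) := by
    rw [show θ - 1 = -(1 - θ) by ring, Real.rpow_neg hx.le, ← div_eq_mul_inv, one_le_div
      (by positivity)]
    exact Real.rpow_le_rpow hx.le hxM (by linarith)
  set Y := |r - r'| ^ (θ - 1) with hY
  -- Only the residue part is singular on the diagonal. The other terms are bounded, or grow at most
  -- linearly in `P`.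
  have hsplit : (sqrtWeight w r * sqrtWeight w r' : ℂ) *
      ((∫ k : ℝ in -P..P, spectralDensity m k r r') - spectralLimit κ l C pole res P r r') =
      (sqrtWeight w r * sqrtWeight w r' : ℂ) * ((∫ k : ℝ in -P..P, spectralDensity m k r r') -
        C r * (starRingEnd ℂ) (C r') *
          (∫ k : ℝ in -P..P, Complex.exp (Complex.I * k * (r - r'))) -
        -Complex.I * (C r * (starRingEnd ℂ) (C r') - (starRingEnd ℂ) (C r) * C r') /
          (r - r' : ℝ) * Complex.exp (-(Complex.I * P * (r - r')))) -
      2 * Real.pi * Complex.I * ∑ j, res j * residueKernel w κ l (pole j) r r' := by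
    simp only [spectralLimit, residueKernel_eq_residueTerm, mul_sub, mul_add, Finset.mul_sum]
    have : ∀ j τ τ', (sqrtWeight w r * sqrtWeight w r' : ℂ) * (2 * Real.pi * Complex.I *
        (res j * residueTerm κ l τ τ' (pole j) r r')) = 2 * Real.pi * Complex.I * (res j *
        (sqrtWeight w r * sqrtWeight w r' * residueTerm κ l τ τ' (pole j) r r')) :=
      fun j τ τ' => by ring
    simp only [this]
    ring
  have i1 : ‖∫ k : ℝ in -P..P, spectralDensity m k r r'‖ ≤ 2 * A₂ * P := by
    refine (intervalIntegral.norm_integral_le_of_norm_le_const (C := A₂) fun k _ =>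
      h2 k r r' hr hr').trans (le_of_eq ?_)
    rw [abs_of_nonneg (by linarith)]
    ring
  have i2 := norm_intervalIntegral_exp_le hP (r, r')
  have i3 : ‖Complex.exp (-(Complex.I * P * (r - r')))‖ = 1 := by
    have := norm_exp_I_mul_mul_sub (-P) r r'
    rwa [show Complex.I * ((-P : ℝ) : ℂ) * (r - r') = -(Complex.I * P * (r - r')) by
      push_cast; ring] at this
  have j1 := hW r hr
  have j2 := hW r' hr'
  have j3 := h4 r hr
  have j4 := h4 r' hr'
  have j5 := h3 r r' hr hr' hne
  rw [hsplit]
  calc _ ≤ W * W * (2 * A₂ * P + A₄ * A₄ * (2 * P) + A₃ * 1) + 2 * Real.pi * (A₁ * Y) := by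
        refine (norm_sub_le _ _).trans (add_le_add ?_ ?_)
        · rw [norm_mul, norm_mul]
          gcongr
          refine (norm_sub_le _ _).trans (add_le_add ((norm_sub_le _ _).trans
            (add_le_add i1 ?_)) ?_)
          · rw [norm_mul, norm_mul, RCLike.norm_conj]
            gcongr
          · rw [norm_mul, i3]
            gcongr
        · rw [norm_mul]
          have : ‖(2 * Real.pi * Complex.I : ℂ)‖ = 2 * Real.pi := by
            simp [abs_of_pos Real.pi_pos]
          rw [this]
          gcongr
          exact h1 r r' hr hr' hne
    _ ≤ W * W * ((2 * A₂ + 2 * A₄ * A₄ + A₃) * (1 + P)) * (D * Y) +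
        2 * Real.pi * (A₁ * Y) * (1 + P) := by
        have hY0 : 0 < Y := by positivity
        have e1 : 2 * A₂ * P + A₄ * A₄ * (2 * P) + A₃ * 1 ≤
            (2 * A₂ + 2 * A₄ * A₄ + A₃) * (1 + P) := by
          nlinarith [mul_nonneg hA₃ hP, mul_self_nonneg A₄]
        have e2 : 2 * Real.pi * (A₁ * Y) ≤ 2 * Real.pi * (A₁ * Y) * (1 + P) :=
          le_mul_of_one_le_right (by positivity) (by linarith)
        have e3 : 0 ≤ W * W * ((2 * A₂ + 2 * A₄ * A₄ + A₃) * (1 + P)) := by positivity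
        have e4 : W * W * (2 * A₂ * P + A₄ * A₄ * (2 * P) + A₃ * 1) ≤
            W * W * ((2 * A₂ + 2 * A₄ * A₄ + A₃) * (1 + P)) := by gcongr
        have e5 := le_mul_of_one_le_right e3 hDx
        linarith
    _ = _ := by ring

/-- A uniform weakly singular bound for the remainder. -/
theorem DualAdmissible.exists_norm_remainder_le (hA : Admissible ρ γ w m T R)
    (hB : DualAdmissible ρ w m κ γ' v l C) (hpole : IsPolePairing κ v pole res) {M : ℝ}
    (hM : 0 < M) :
    ∃ s : ℝ, -1 < s ∧ ∃ A, ∃ B > 0, ∀ P ≥ B, ∀ r r' : ℝ, |r| ≤ M → |r'| ≤ M → r ≠ r' →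
      ‖(sqrtWeight w r * sqrtWeight w r' : ℂ) * ((∫ k : ℝ in -P..P, spectralDensity m k r r') -
        spectralLimit κ l C pole res P r r')‖ ≤ A * |r - r'| ^ s := by
  obtain ⟨θ, hθ0, hθ1, A₁, hA₁, h1⟩ := hB.exists_norm_remainder_le_linear hA hpole hM
  obtain ⟨A₂, hA₂, B, hB0, h2⟩ := hB.exists_norm_sub_spectralLimit_le hA hpole hM
  obtain ⟨W, hW0, hW⟩ := hA.exists_sqrtWeight_le M
  have hγ := hB.gamma_pos
  -- Geometric mean of the linear bound `(1+P)|r-r'|^{θ-1}` and the exponential bound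
  -- `exp(-γ'P)/|r-r'|`. In the product `(1+P) exp(-γ'P)` is bounded, and half of the exponent `θ -
  -- 2` is still larger than `-1`.
  refine ⟨θ / 2 - 1, by linarith, √(A₁ * (W * W * A₂) * (1 + 1 / γ')), B, hB0,
    fun P hP r r' hr hr' hne => ?_⟩
  have hx : 0 < |r - r'| := abs_pos.2 (sub_ne_zero.2 hne)
  have hP0 : 0 ≤ P := by linarith
  have a := h1 P hP0 r r' hr hr' hne
  have b := h2 P hP r r' hr hr' hne
  set E := (∫ k : ℝ in -P..P, spectralDensity m k r r') - spectralLimit κ l C pole res P r r'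
  have b' : ‖(sqrtWeight w r * sqrtWeight w r' : ℂ) * E‖ ≤
      W * W * (A₂ * Real.exp (-γ' * P) / |r - r'|) := by
    have j1 := hW r hr
    have j2 := hW r' hr'
    rw [norm_mul, norm_mul]
    gcongr
  refine abs_le_of_sq_le_sq' ?_ (by positivity) |>.2
  rw [mul_pow, Real.sq_sqrt (by positivity), ← Real.rpow_mul_natCast hx.le, sq]
  calc _ ≤ A₁ * (1 + P) * |r - r'| ^ (θ - 1) *
        (W * W * (A₂ * Real.exp (-γ' * P) / |r - r'|)) := by gcongr
    _ = A₁ * (W * W * A₂) * ((1 + P) * Real.exp (-γ' * P)) *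
        |r - r'| ^ ((θ / 2 - 1) * (2 : ℕ)) := by
        rw [show (θ / 2 - 1) * (2 : ℕ) = (θ - 1) - 1 by push_cast; ring,
          Real.rpow_sub_one hx.ne' (θ - 1)]
        generalize |r - r'| ^ (θ - 1) = Y
        ring
    _ ≤ _ := by
        have := one_add_mul_exp_neg_le hγ hP0
        gcongr

theorem Admissible.sqrtWeight_sq (hA : Admissible ρ γ w m T R) (r : ℝ) :
    sqrtWeight w r * sqrtWeight w r = (w r).re :=
  Real.mul_self_sqrt (hA.w_pos r).2.le

theorem Admissible.isPosTest_sqrtWeight_mul (hA : Admissible ρ γ w m T R) {f u : ℝ → ℂ}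
    (hf : IsPosTest f) (hu : ContDiff ℝ ∞ u) : IsPosTest fun r => f r * (sqrtWeight w r * u r) := by
  have h1 : ContDiff ℝ ∞ fun r => (sqrtWeight w r : ℂ) :=
    Complex.ofRealCLM.contDiff.comp hA.contDiff_sqrtWeight
  obtain ⟨h2, h3⟩ := hf
  have h4 : HasCompactSupport (f * fun r => (sqrtWeight w r * u r : ℂ)) := h3.mul_right
  exact ⟨h2.mul (h1.mul hu), h4⟩

theorem IsPosTest.conj {f : ℝ → ℂ} (hf : IsPosTest f) :
    IsPosTest fun r => (starRingEnd ℂ) (f r) :=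
  ⟨Complex.conjCLE.contDiff.comp hf.1, hf.2.comp_left (map_zero _)⟩

theorem Admissible.continuous_integral_spectralDensity (hA : Admissible ρ γ w m T R) (P : ℝ) :
    Continuous fun p : ℝ × ℝ => ∫ k : ℝ in -P..P, spectralDensity m k p.1 p.2 := by
  have key : ∀ F : ℝ → ℝ → ℝ → ℂ, Continuous (fun q : ℝ × ℝ × ℝ => F q.1 q.2.1 q.2.2) →
      Continuous fun p : ℝ × ℝ => ∫ k : ℝ in -P..P, F k p.1 p.2 := fun F hF =>
    intervalIntegral.continuous_parametric_intervalIntegral_of_continuous'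
      (f := fun (p : ℝ × ℝ) (k : ℝ) => F k p.1 p.2)
      (hF.comp (g := fun q : ℝ × ℝ × ℝ => F q.1 q.2.1 q.2.2)
        (f := fun q : (ℝ × ℝ) × ℝ => (q.2, q.1.1, q.1.2)) (by fun_prop)) _ _
  exact key _ hA.continuous_spectralDensity

theorem DualAdmissible.measurable_spectralLimit (hA : Admissible ρ γ w m T R)
    (hB : DualAdmissible ρ w m κ γ' v l C) (hpole : IsPolePairing κ v pole res) (P : ℝ) :
    Measurable fun p : ℝ × ℝ => (sqrtWeight w p.1 * sqrtWeight w p.2 : ℂ) *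
      spectralLimit κ l C pole res P p.1 p.2 := by
  have hC := hB.C_entire.continuous
  have h1 := hA.continuous_sqrtWeight
  have h2 := fun j => hB.measurable_residueKernel hA (hpole.abs_im_lt j)
  have h3 := continuous_intervalIntegral_exp P
  have h4 : Measurable fun p : ℝ × ℝ => ∑ j, res j * residueKernel w κ l (pole j) p.1 p.2 :=
    Finset.measurable_sum _ fun j _ => (h2 j).const_mul _
  have h5 : Measurable fun p : ℝ × ℝ => -Complex.I * (C p.1 * (starRingEnd ℂ) (C p.2) -
      (starRingEnd ℂ) (C p.1) * C p.2) / (p.1 - p.2 : ℝ) * Complex.exp (-(Complex.I * P *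
      (p.1 - p.2))) := by
    refine (Measurable.div ?_ ?_).mul ?_
    all_goals exact Continuous.measurable (by fun_prop)
  have h6 : Continuous fun p : ℝ × ℝ => C p.1 * (starRingEnd ℂ) (C p.2) *
      ∫ k : ℝ in -P..P, Complex.exp (Complex.I * k * (p.1 - p.2)) := by fun_prop
  have h7 : Continuous fun p : ℝ × ℝ => (sqrtWeight w p.1 * sqrtWeight w p.2 : ℂ) := by fun_prop
  have : (fun p : ℝ × ℝ => (sqrtWeight w p.1 * sqrtWeight w p.2 : ℂ) *
      spectralLimit κ l C pole res P p.1 p.2) = fun p => 2 * Real.pi * Complex.I *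
      (∑ j, res j * residueKernel w κ l (pole j) p.1 p.2) +
      (sqrtWeight w p.1 * sqrtWeight w p.2 : ℂ) * (C p.1 * (starRingEnd ℂ) (C p.2) *
      (∫ k : ℝ in -P..P, Complex.exp (Complex.I * k * (p.1 - p.2)))) +
      (sqrtWeight w p.1 * sqrtWeight w p.2 : ℂ) * (-Complex.I * (C p.1 * (starRingEnd ℂ) (C p.2) -
      (starRingEnd ℂ) (C p.1) * C p.2) / (p.1 - p.2 : ℝ) * Complex.exp (-(Complex.I * P *
      (p.1 - p.2)))) := by
    funext p
    simp only [spectralLimit, residueKernel_eq_residueTerm, mul_add]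
    congr 2
    simp only [Finset.mul_sum]
    exact Finset.sum_congr rfl fun j _ => Finset.sum_congr rfl fun τ _ =>
      Finset.sum_congr rfl fun τ' _ => by ring
  rw [this]
  exact ((h4.const_mul _).add (h7.measurable.mul h6.measurable)).add (h7.measurable.mul h5)

/-- The remainder integrals are eventually integrable and tend to zero. -/
theorem DualAdmissible.tendsto_integral_remainder (hA : Admissible ρ γ w m T R)
    (hB : DualAdmissible ρ w m κ γ' v l C) (hpole : IsPolePairing κ v pole res) {f g : ℝ → ℂ}
    (hf : IsPosTest f) (hg : IsPosTest g) :
    (∀ᶠ P : ℝ in atTop, Integrable (fun p : ℝ × ℝ => (starRingEnd ℂ) (f p.1) * g p.2 *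
      ((sqrtWeight w p.1 * sqrtWeight w p.2 : ℂ) *
        ((∫ k : ℝ in -P..P, spectralDensity m k p.1 p.2) -
          spectralLimit κ l C pole res P p.1 p.2))) (volume.prod volume)) ∧
    Tendsto (fun P : ℝ => ∫ p : ℝ × ℝ, (starRingEnd ℂ) (f p.1) * g p.2 *
      ((sqrtWeight w p.1 * sqrtWeight w p.2 : ℂ) *
        ((∫ k : ℝ in -P..P, spectralDensity m k p.1 p.2) -
          spectralLimit κ l C pole res P p.1 p.2)) ∂(volume.prod volume)) atTop (𝓝 0) := by
  obtain ⟨M₁, hM₁, hfM⟩ := hf.exists_support_bound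
  obtain ⟨M₂, hM₂, hgM⟩ := hg.exists_support_bound
  obtain ⟨F, hF0, hF⟩ := hf.exists_norm_le
  obtain ⟨G, hG0, hG⟩ := hg.exists_norm_le
  have hM : 0 < M₁ + M₂ := by positivity
  obtain ⟨s, hs, A, B, -, hAs⟩ := hB.exists_norm_remainder_le hA hpole hM
  obtain ⟨b, hb, hbK⟩ := integrable_majorant hF hG hF0 (hfM (M₁ + M₂) (by linarith))
    (hgM (M₁ + M₂) (by linarith)) hs (A := A)
  have hmeas : ∀ P : ℝ, AEStronglyMeasurable (fun p : ℝ × ℝ => (starRingEnd ℂ) (f p.1) * g p.2 *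
      ((sqrtWeight w p.1 * sqrtWeight w p.2 : ℂ) *
        ((∫ k : ℝ in -P..P, spectralDensity m k p.1 p.2) -
          spectralLimit κ l C pole res P p.1 p.2))) (volume.prod volume) := by
    intro P
    have h1 := hf.1.continuous
    have h2 := hg.1.continuous
    have h3 := hA.continuous_sqrtWeight
    have h4 := hA.continuous_integral_spectralDensity P
    simp only [mul_sub (_ * _ : ℂ) (∫ k : ℝ in -P..P, _)]
    exact (Continuous.aestronglyMeasurable (by fun_prop)).mul
      ((Continuous.aestronglyMeasurable (by fun_prop)).sub
        (hB.measurable_spectralLimit hA hpole P).aestronglyMeasurable)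
  have hbound : ∀ P ≥ B, ∀ᵐ p : ℝ × ℝ ∂(volume.prod volume), ‖(starRingEnd ℂ) (f p.1) * g p.2 *
      ((sqrtWeight w p.1 * sqrtWeight w p.2 : ℂ) *
        ((∫ k : ℝ in -P..P, spectralDensity m k p.1 p.2) -
          spectralLimit κ l C pole res P p.1 p.2))‖ ≤ b p := by
    intro P hP
    filter_upwards [ae_prod_ne] with p hp
    exact hbK _ p fun h1 h2 => hAs P hP p.1 p.2 h1 h2 hp
  refine ⟨?_, ?_⟩
  · filter_upwards [eventually_ge_atTop B] with P hP
    exact hb.mono' (hmeas P) (hbound P hP)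
  · have h0 : (0 : ℂ) = ∫ _ : ℝ × ℝ, (0 : ℂ) ∂(volume.prod volume) := by simp
    rw [h0]
    refine tendsto_integral_filter_of_dominated_convergence b (Eventually.of_forall hmeas) ?_ hb ?_
    · filter_upwards [eventually_ge_atTop B] with P hP
      exact hbound P hP
    · filter_upwards [ae_prod_ne] with p hp
      obtain ⟨A', -, B', -, h⟩ := hB.exists_norm_sub_spectralLimit_le hA hpole
        (M := |p.1| + |p.2| + 1) (by positivity)
      have h1 : Tendsto (fun P : ℝ => A' * Real.exp (-γ' * P) / |p.1 - p.2|) atTop (𝓝 0) := by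
        have : Tendsto (fun P : ℝ => Real.exp (-γ' * P)) atTop (𝓝 0) :=
          Real.tendsto_exp_atBot.comp
            (tendsto_id.const_mul_atTop_of_neg (neg_lt_zero.2 hB.gamma_pos))
        simpa using (this.const_mul A').div_const |p.1 - p.2|
      have h2 : Tendsto (fun P : ℝ => (∫ k : ℝ in -P..P, spectralDensity m k p.1 p.2) -
          spectralLimit κ l C pole res P p.1 p.2) atTop (𝓝 0) := by
        refine squeeze_zero_norm' ?_ h1
        filter_upwards [eventually_ge_atTop B'] with P hP
        exact h P hP p.1 p.2 (by linarith [abs_nonneg p.2]) (by linarith [abs_nonneg p.1]) hp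
      simpa using (h2.const_mul (sqrtWeight w p.1 * sqrtWeight w p.2 : ℂ)).const_mul
        ((starRingEnd ℂ) (f p.1) * g p.2)

theorem DualAdmissible.integrable_offdiag (hA : Admissible ρ γ w m T R)
    (hB : DualAdmissible ρ w m κ γ' v l C) {f g : ℝ → ℂ} (hf : IsPosTest f) (hg : IsPosTest g) :
    Integrable (fun p : ℝ × ℝ => (starRingEnd ℂ) (f p.1) * g p.2 *
      ((sqrtWeight w p.1 * sqrtWeight w p.2 : ℂ) * (-Complex.I * (C p.1 * (starRingEnd ℂ) (C p.2) -
        (starRingEnd ℂ) (C p.1) * C p.2) / (p.1 - p.2 : ℝ)))) (volume.prod volume) := by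
  obtain ⟨M₁, hM₁, hfM⟩ := hf.exists_support_bound
  obtain ⟨M₂, hM₂, hgM⟩ := hg.exists_support_bound
  obtain ⟨F, hF0, hF⟩ := hf.exists_norm_le
  obtain ⟨G, hG0, hG⟩ := hg.exists_norm_le
  obtain ⟨W, hW0, hW⟩ := hA.exists_sqrtWeight_le (M₁ + M₂)
  obtain ⟨A, hA0, hAx⟩ := hB.exists_norm_offdiag_le (M₁ + M₂)
  obtain ⟨b, hb, hbK⟩ := integrable_majorant hF hG hF0 (hfM (M₁ + M₂) (by linarith))
    (hgM (M₁ + M₂) (by linarith)) (s := 0) (by norm_num) (A := W * W * A)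
  refine hb.mono' ?_ ?_
  · have h1 := hf.1.continuous
    have h2 := hg.1.continuous
    have h3 := hA.continuous_sqrtWeight
    have hC := hB.C_entire.continuous
    refine (Continuous.aestronglyMeasurable (by fun_prop)).mul
      ((Continuous.aestronglyMeasurable (by fun_prop)).mul (Measurable.aestronglyMeasurable ?_))
    exact Measurable.div (Continuous.measurable (by fun_prop))
      (Continuous.measurable (by fun_prop))
  · filter_upwards [ae_prod_ne] with p hp
    refine hbK _ p fun h1 h2 => ?_
    have j1 := hW _ h1
    have j2 := hW _ h2
    have j3 := hAx _ _ h1 h2 hp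
    rw [Real.rpow_zero, mul_one, norm_mul, norm_mul]
    gcongr

/-- Four contributions: the Dirichlet part tends to `2π ∫ conj(f) g`, the oscillating part vanishes
by Riemann-Lebesgue, the remainder vanishes by dominated convergence, and the residue part does not
depend on `P`. -/
theorem DualAdmissible.tendsto_integral_spectralDensity (hA : Admissible ρ γ w m T R)
    (hB : DualAdmissible ρ w m κ γ' v l C) (hpole : IsPolePairing κ v pole res) {f g : ℝ → ℂ}
    (hf : IsPosTest f) (hg : IsPosTest g) :
    Tendsto (fun P : ℝ => ∫ p : ℝ × ℝ, (starRingEnd ℂ) (f p.1) * g p.2 *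
      ((sqrtWeight w p.1 * sqrtWeight w p.2 : ℂ) *
        ∫ k : ℝ in -P..P, spectralDensity m k p.1 p.2) ∂(volume.prod volume)) atTop
      (𝓝 (2 * Real.pi * (∫ r, (starRingEnd ℂ) (f r) * g r) +
        2 * Real.pi * Complex.I * ∑ j, res j * ∫ p : ℝ × ℝ, (starRingEnd ℂ) (f p.1) * g p.2 *
          residueKernel w κ l (pole j) p.1 p.2 ∂(volume.prod volume))) := by
  have hC := hB.contDiff_C
  -- The weight and `C` are distributed over the two variables, so that the coefficient of the
  -- Dirichlet kernel factorizes; on the diagonal `w |C|² = 1` leaves `conj(f) g`.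
  set α : ℝ → ℂ := fun r => (starRingEnd ℂ) (f r) * (sqrtWeight w r * C r) with hα
  set β : ℝ → ℂ := fun r => g r * (sqrtWeight w r * (starRingEnd ℂ) (C r)) with hβ
  have hαt : IsPosTest α := hA.isPosTest_sqrtWeight_mul hf.conj hC
  have hβt : IsPosTest β :=
    hA.isPosTest_sqrtWeight_mul hg (Complex.conjCLE.contDiff.comp hC)
  have hαβ : ∀ r, α r * β r = (starRingEnd ℂ) (f r) * g r := by
    intro r
    have h1 : C r * (starRingEnd ℂ) (C r) = ((1 / (w r).re : ℝ) : ℂ) := by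
      rw [Complex.mul_conj, Complex.normSq_eq_norm_sq, hB.C_normSq]
    have h2 : (sqrtWeight w r : ℂ) * sqrtWeight w r = ((w r).re : ℝ) := by
      exact_mod_cast hA.sqrtWeight_sq r
    have h3 : (((w r).re : ℝ) : ℂ) ≠ 0 := by exact_mod_cast (hA.w_pos r).2.ne'
    calc _ = (starRingEnd ℂ) (f r) * g r * ((sqrtWeight w r : ℂ) * sqrtWeight w r) *
          (C r * (starRingEnd ℂ) (C r)) := by
          simp only [hα, hβ]
          ring
      _ = _ := by
          rw [h1, h2]
          push_cast
          field_simp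
  obtain ⟨hRi, hR⟩ := hB.tendsto_integral_remainder hA hpole hf hg
  have hD := tendsto_integral_dirichlet hαt.integrable hβt
  simp only [hαβ] at hD
  set q : ℝ × ℝ → ℂ := fun p => (starRingEnd ℂ) (f p.1) * g p.2 *
      ((sqrtWeight w p.1 * sqrtWeight w p.2 : ℂ) * (-Complex.I * (C p.1 * (starRingEnd ℂ) (C p.2) -
        (starRingEnd ℂ) (C p.1) * C p.2) / (p.1 - p.2 : ℝ))) with hq
  have hqi : Integrable q (volume.prod volume) := hB.integrable_offdiag hA hf hg
  have hQ := tendsto_integral_exp_neg_sub q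
  have hres : ∀ j, Integrable (fun p : ℝ × ℝ => (starRingEnd ℂ) (f p.1) * g p.2 *
      residueKernel w κ l (pole j) p.1 p.2) (volume.prod volume) := fun j =>
    hB.integrable_residueKernel hA (hpole.abs_im_lt j) hf hg
  have hfinal := ((hD.add hQ).add hR).add_const (2 * Real.pi * Complex.I * ∑ j, res j *
    ∫ p : ℝ × ℝ, (starRingEnd ℂ) (f p.1) * g p.2 *
      residueKernel w κ l (pole j) p.1 p.2 ∂(volume.prod volume))
  rw [add_zero, add_zero] at hfinal
  refine hfinal.congr' ?_
  filter_upwards [hRi, eventually_ge_atTop 0] with P hP hP0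
  have i1 := integrable_mul_dirichlet hαt.integrable hβt.integrable hP0
  have i2 : Integrable (fun p : ℝ × ℝ => q p * Complex.exp (-(Complex.I * P * (p.1 - p.2))))
      (volume.prod volume) := by
    refine hqi.mul_bdd (c := 1) (Continuous.aestronglyMeasurable (by fun_prop))
      (Eventually.of_forall fun p => ?_)
    have := norm_exp_I_mul_mul_sub (-P) p.1 p.2
    rw [show Complex.I * ((-P : ℝ) : ℂ) * (p.1 - p.2) = -(Complex.I * P * (p.1 - p.2)) by
      push_cast; ring] at this
    exact this.le
  have i3 : Integrable (fun p : ℝ × ℝ => ∑ j, res j * ((starRingEnd ℂ) (f p.1) * g p.2 *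
      residueKernel w κ l (pole j) p.1 p.2)) (volume.prod volume) :=
    integrable_finsetSum _ fun j _ => (hres j).const_mul _
  have e3 : ∑ j, res j * ∫ p : ℝ × ℝ, (starRingEnd ℂ) (f p.1) * g p.2 *
      residueKernel w κ l (pole j) p.1 p.2 ∂(volume.prod volume) =
      ∫ p : ℝ × ℝ, ∑ j, res j * ((starRingEnd ℂ) (f p.1) * g p.2 *
      residueKernel w κ l (pole j) p.1 p.2) ∂(volume.prod volume) := by
    rw [integral_finsetSum _ fun j _ => (hres j).const_mul _]
    simp only [integral_const_mul]
  have s1 := integral_add i1 i2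
  have s2 := integral_add (i1.add i2) hP
  have s3 := integral_add ((i1.add i2).add hP) (i3.const_mul (2 * Real.pi * Complex.I))
  simp only [Pi.add_apply] at s1 s2 s3
  rw [e3, ← integral_const_mul, ← s1, ← s2, ← s3]
  refine integral_congr_ae (Eventually.of_forall fun p => ?_)
  have e4 : ∀ j, (starRingEnd ℂ) (f p.1) * g p.2 * residueKernel w κ l (pole j) p.1 p.2 =
      (starRingEnd ℂ) (f p.1) * g p.2 * (sqrtWeight w p.1 * sqrtWeight w p.2) *
      (∑ τ : ℤˣ, ∑ τ' : ℤˣ, residueTerm κ l τ τ' (pole j) p.1 p.2) := fun j => by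
    rw [residueKernel_eq_residueTerm]
    ring
  have e5 : ∑ j, res j * ((starRingEnd ℂ) (f p.1) * g p.2 *
      residueKernel w κ l (pole j) p.1 p.2) =
      (starRingEnd ℂ) (f p.1) * g p.2 * (sqrtWeight w p.1 * sqrtWeight w p.2) *
      ∑ j, res j * ∑ τ : ℤˣ, ∑ τ' : ℤˣ, residueTerm κ l τ τ' (pole j) p.1 p.2 := by
    rw [Finset.mul_sum]
    refine Finset.sum_congr rfl fun j _ => ?_
    rw [e4]
    ring
  beta_reduce
  rw [e5]
  simp only [spectralLimit, hα, hβ, hq]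
  ring

end

/-! ### Decay of the transformed test functions -/

/-- The plane-wave parts are Fourier integrals of the test functions `a χ` and `b χ` at frequencies
`±x`; the rest of the kernel is exponentially small on the support of `χ`. -/
theorem exists_norm_integral_le_of_asymptotics {K : ℝ → ℝ → ℂ} {χ a b : ℝ → ℂ} {c A M : ℝ}
    {S : Set ℝ} (hK : Continuous fun p : ℝ × ℝ => K p.1 p.2) (hχ : IsPosTest χ)
    (ha : ContDiff ℝ ∞ a) (hb : ContDiff ℝ ∞ b) (hc : 0 < c) (hM : ∀ y, M < |y| → χ y = 0)
    (hS : ∀ x ∈ S, ∀ y, |y| ≤ M → ‖K x y - (a y * Complex.exp (Complex.I * x * y) +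
      b y * Complex.exp (-(Complex.I * x * y)))‖ ≤ A * Real.exp (-c * |x|)) :
    ∃ A', 0 ≤ A' ∧ ∀ x ∈ S, ‖∫ y, K x y * χ y‖ ≤ A' / (1 + x ^ 2) := by
  have mulTest : ∀ u : ℝ → ℂ, ContDiff ℝ ∞ u → IsPosTest fun y => u y * χ y := fun u hu =>
    ⟨hu.mul hχ.1, HasCompactSupport.mul_left (f := u) hχ.2⟩
  obtain ⟨A₁, hA₁, h1⟩ := exists_norm_integral_exp_mul_le (mulTest a ha)
  obtain ⟨A₂, hA₂, h2⟩ := exists_norm_integral_exp_mul_le (mulTest b hb)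
  obtain ⟨A₃, hA₃, h3⟩ := exists_exp_neg_mul_abs_le hc
  have hχi := hχ.integrable.norm
  have hχ0 : 0 ≤ ∫ y, ‖χ y‖ := integral_nonneg fun y => norm_nonneg _
  refine ⟨A₁ + A₂ + |A| * A₃ * ∫ y, ‖χ y‖, by positivity, fun x hx => ?_⟩
  have hχc := hχ.1.continuous
  have hint : ∀ u : ℝ → ℂ, Continuous u → Integrable fun y => u y * χ y := fun u hu =>
    (hu.mul hχc).integrable_of_hasCompactSupport (HasCompactSupport.mul_left (f := u) hχ.2)
  have hKx : Continuous fun y => K x y := hK.comp (Continuous.prodMk_right x)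
  have hac := ha.continuous
  have hbc := hb.continuous
  have i1 : Integrable fun y : ℝ => Complex.exp (Complex.I * x * y) * (a y * χ y) := by
    simpa [mul_assoc] using hint (fun y => Complex.exp (Complex.I * x * y) * a y) (by fun_prop)
  have i2 : Integrable fun y : ℝ => Complex.exp (Complex.I * (-x : ℝ) * y) * (b y * χ y) := by
    simpa [mul_assoc] using
      hint (fun y => Complex.exp (Complex.I * (-x : ℝ) * y) * b y) (by fun_prop)
  have i3 : Integrable fun y : ℝ => (K x y - (a y * Complex.exp (Complex.I * x * y) +
      b y * Complex.exp (-(Complex.I * x * y)))) * χ y := hint _ (by fun_prop)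
  have hsplit : ∫ y, K x y * χ y = (∫ y : ℝ, Complex.exp (Complex.I * x * y) * (a y * χ y)) +
      (∫ y : ℝ, Complex.exp (Complex.I * (-x : ℝ) * y) * (b y * χ y)) +
      ∫ y : ℝ, (K x y - (a y * Complex.exp (Complex.I * x * y) +
      b y * Complex.exp (-(Complex.I * x * y)))) * χ y := by
    have s1 := integral_add i1 i2
    have s2 := integral_add (i1.add i2) i3
    simp only [Pi.add_apply] at s2
    rw [← s1, ← s2]
    refine integral_congr_ae (Eventually.of_forall fun y => ?_)
    have : Complex.I * (-x : ℝ) * y = -(Complex.I * x * y) := by push_cast; ring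
    simp only [this]
    ring
  have j3 : ‖∫ y : ℝ, (K x y - (a y * Complex.exp (Complex.I * x * y) +
      b y * Complex.exp (-(Complex.I * x * y)))) * χ y‖ ≤
      |A| * (A₃ / (1 + x ^ 2)) * ∫ y, ‖χ y‖ := by
    rw [← integral_const_mul]
    refine norm_integral_le_of_norm_le (hχi.const_mul _) (Eventually.of_forall fun y => ?_)
    rcases le_or_gt |y| M with hy | hy
    · rw [norm_mul]
      gcongr
      refine (hS x hx y hy).trans ?_
      exact mul_le_mul (le_abs_self A) (h3 x) (Real.exp_pos _).le (abs_nonneg _)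
    · simp [hM y hy]
  have j2 := h2 (-x)
  rw [neg_sq] at j2
  rw [hsplit]
  refine (norm_add₃_le).trans ((add_le_add (add_le_add (h1 x) j2) j3).trans (le_of_eq ?_))
  ring

/-- An oscillatory integral transform whose kernel approaches combinations of plane waves
exponentially fast maps test functions to functions decaying like `1 / (1 + x²)`. -/
theorem exists_norm_integral_le {K : ℝ → ℝ → ℂ} {χ aR bR aL bL : ℝ → ℂ} {c A B M : ℝ}
    (hK : Continuous fun p : ℝ × ℝ => K p.1 p.2) (hχ : IsPosTest χ)
    (haR : ContDiff ℝ ∞ aR) (hbR : ContDiff ℝ ∞ bR) (haL : ContDiff ℝ ∞ aL)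
    (hbL : ContDiff ℝ ∞ bL) (hc : 0 < c) (hM : ∀ y, M < |y| → χ y = 0)
    (hR : ∀ x y, B ≤ x → |y| ≤ M → ‖K x y - (aR y * Complex.exp (Complex.I * x * y) +
      bR y * Complex.exp (-(Complex.I * x * y)))‖ ≤ A * Real.exp (-c * |x|))
    (hL : ∀ x y, B ≤ -x → |y| ≤ M → ‖K x y - (aL y * Complex.exp (Complex.I * x * y) +
      bL y * Complex.exp (-(Complex.I * x * y)))‖ ≤ A * Real.exp (-c * |x|)) :
    (Continuous fun x => ∫ y, K x y * χ y) ∧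
    ∃ A', 0 ≤ A' ∧ ∀ x, ‖∫ y, K x y * χ y‖ ≤ A' / (1 + x ^ 2) := by
  have hcont : Continuous fun x => ∫ y, K x y * χ y := by
    have hχc := hχ.1.continuous
    refine continuous_parametric_integral_of_continuous (μ := volume) (s := tsupport χ)
      (f := fun x y => K x y * χ y) ?_ hχ.2.isCompact |>.congr fun x => ?_
    · exact hK.mul (hχc.comp continuous_snd)
    · refine setIntegral_eq_integral_of_forall_compl_eq_zero fun y hy => ?_
      rw [image_eq_zero_of_notMem_tsupport hy, mul_zero]
  refine ⟨hcont, ?_⟩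
  obtain ⟨A₁, hA₁, h1⟩ := exists_norm_integral_le_of_asymptotics (S := Ici B) hK hχ haR hbR hc hM
    (fun x hx y hy => hR x y hx hy)
  obtain ⟨A₂, hA₂, h2⟩ := exists_norm_integral_le_of_asymptotics (S := {x | B ≤ -x}) hK hχ haL hbL
    hc hM (fun x hx y hy => hL x y hx hy)
  obtain ⟨A₃, h3⟩ := (isCompact_Icc (a := -B) (b := B)).exists_bound_of_continuousOn
    hcont.continuousOn
  refine ⟨A₁ + A₂ + |A₃| * (1 + B ^ 2), by positivity, fun x => ?_⟩
  rcases le_total B x with hx | hx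
  · refine (h1 x hx).trans ?_
    gcongr
    have : 0 ≤ |A₃| * (1 + B ^ 2) := by positivity
    linarith
  · rcases le_total B (-x) with hx' | hx'
    · refine (h2 x hx').trans ?_
      gcongr
      have : 0 ≤ |A₃| * (1 + B ^ 2) := by positivity
      linarith
    · have hx2 : x ^ 2 ≤ B ^ 2 := sq_le_sq' (by linarith) hx
      rw [le_div_iff₀ (by positivity)]
      calc _ ≤ |A₃| * (1 + B ^ 2) := by
            have := (h3 x ⟨by linarith, hx⟩).trans (le_abs_self A₃)
            gcongr
        _ ≤ _ := by linarith

section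

variable {ρ γ : ℝ} {w : ℂ → ℂ} {m : ℤˣ → ℂ → ℂ → ℂ} {T R : ℝ → ℂ}
  {κ γ' : ℝ} {v : ℂ → ℂ} {l : ℤˣ → ℝ → ℂ → ℂ} {C : ℂ → ℂ} {n : ℕ} {pole res : Fin n → ℂ}

theorem waveFun_eq (w : ℂ → ℂ) (m : ℤˣ → ℂ → ℂ → ℂ) (r k : ℝ) :
    waveFun w m r k = sqrtWeight w r * (m 1 r k * Complex.exp (Complex.I * r * k) +
      m (-1) r k * Complex.exp (-(Complex.I * r * k))) := by
  simp [waveFun, sgn]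

theorem Admissible.continuous_waveFun (hA : Admissible ρ γ w m T R) :
    Continuous fun p : ℝ × ℝ => waveFun w m p.1 p.2 := by
  simp only [waveFun_eq]
  have h1 := hA.continuous_m 1 (continuous_fst (X := ℝ) (Y := ℝ)) continuous_snd
  have h2 := hA.continuous_m (-1) (continuous_fst (X := ℝ) (Y := ℝ)) continuous_snd
  have h3 : Continuous fun p : ℝ × ℝ => (sqrtWeight w p.1 : ℂ) :=
    Complex.continuous_ofReal.comp (hA.continuous_sqrtWeight.comp continuous_fst)
  exact h3.mul ((h1.mul (by fun_prop)).add (h2.mul (by fun_prop)))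

theorem Admissible.conj_waveFun (hA : Admissible ρ γ w m T R) (r k : ℝ) :
    (starRingEnd ℂ) (waveFun w m r k) = waveFun w m r (-k) := by
  have h1 := hA.m_conj 1 r k
  have h2 := hA.m_conj (-1) r k
  rw [waveFun_eq, waveFun_eq]
  simp only [map_mul, map_add, h1, h2, ← Complex.exp_conj, map_neg, Complex.conj_I,
    Complex.conj_ofReal, Complex.ofReal_neg]
  ring_nf

theorem norm_combination_sub_le {p q a b e e' : ℂ} {E : ℝ} (he : ‖e‖ = 1) (he' : ‖e'‖ = 1)
    (hp : ‖p - a‖ ≤ E) (hq : ‖q - b‖ ≤ E) :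
    ‖(p * e + q * e') - (a * e + b * e')‖ ≤ 2 * E := by
  rw [show (p * e + q * e') - (a * e + b * e') = (p - a) * e + (q - b) * e' by ring]
  refine (norm_add_le _ _).trans ?_
  rw [norm_mul, norm_mul, he, he']
  linarith

theorem norm_exp_I_mul_mul (x y : ℝ) : ‖Complex.exp (Complex.I * x * y)‖ = 1 := by
  simpa using norm_exp_I_mul_mul_sub x y 0

theorem norm_exp_neg_I_mul_mul (x y : ℝ) : ‖Complex.exp (-(Complex.I * x * y))‖ = 1 := by
  simpa using norm_exp_I_mul_mul_sub (-x) y 0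

/-- Decay in `r` of wave packets. -/
theorem Admissible.exists_norm_wavePacket_le (hA : Admissible ρ γ w m T R) {χ : ℝ → ℂ}
    (hχ : IsPosTest χ) :
    (Continuous fun r => ∫ k, waveFun w m r k * χ k) ∧
    ∃ A, 0 ≤ A ∧ ∀ r, ‖∫ k, waveFun w m r k * χ k‖ ≤ A / (1 + r ^ 2) := by
  obtain ⟨M, -, hM⟩ := hχ.exists_support_bound
  obtain ⟨s, ⟨B₀, -, hs⟩, has⟩ := hA.asymptotics
  obtain ⟨A₁, hA₁, B₁, hB₁, h1⟩ := has.plus_right.exists_bound M 0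
  obtain ⟨A₂, hA₂, B₂, hB₂, h2⟩ := has.plus_left.exists_bound M 0
  obtain ⟨A₃, hA₃, B₃, hB₃, h3⟩ := has.minus_right.exists_bound M 0
  obtain ⟨A₄, hA₄, B₄, hB₄, h4⟩ := has.minus_left.exists_bound M 0
  have hr1 : rsgn 1 = 1 := by simp [rsgn]
  have hr2 : rsgn (-1) = -1 := by simp [rsgn]
  have hrw : ∀ r k : ℝ, B₀ < |r| → waveFun w m r k =
      (s r * m 1 r k) * Complex.exp (Complex.I * r * k) +
      (s r * m (-1) r k) * Complex.exp (-(Complex.I * r * k)) := fun r k hr => by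
    rw [waveFun_eq, hs r hr]
    ring
  refine exists_norm_integral_le (aR := T) (bR := fun _ => 0) (aL := fun _ => 1)
    (bL := fun k => -R k) (A := 2 * (A₁ + A₂ + A₃ + A₄)) (B := |B₀| + 1 + B₁ + B₂ + B₃ + B₄)
    hA.continuous_waveFun hχ hA.T_smooth contDiff_const contDiff_const hA.R_smooth.neg
    hA.gamma_pos (hM M le_rfl) (fun r k hr hk => ?_) (fun r k hr hk => ?_)
  · rw [hrw r k (by linarith [le_abs_self B₀, le_abs_self r])]
    have e1 := h1 r k hk (by simp) (by rw [hr1, Complex.ofReal_re]; linarith [abs_nonneg B₀])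
    have e3 := h3 r k hk (by simp) (by rw [hr1, Complex.ofReal_re]; linarith [abs_nonneg B₀])
    rw [Complex.ofReal_re] at e1 e3
    have he := Real.exp_pos (-γ * |r|)
    refine (norm_combination_sub_le (E := (A₁ + A₂ + A₃ + A₄) * Real.exp (-γ * |r|))
      (norm_exp_I_mul_mul r k) (norm_exp_neg_I_mul_mul r k) (e1.trans ?_) ?_).trans
      (le_of_eq (mul_assoc _ _ _).symm)
    · gcongr
      linarith
    · rw [sub_zero]
      refine e3.trans ?_
      gcongr
      linarith
  · rw [hrw r k (by linarith [le_abs_self B₀, neg_le_abs r])]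
    have e1 := h2 r k hk (by simp) (by rw [hr2, Complex.ofReal_re]; linarith [abs_nonneg B₀])
    have e3 := h4 r k hk (by simp) (by rw [hr2, Complex.ofReal_re]; linarith [abs_nonneg B₀])
    rw [Complex.ofReal_re] at e1 e3
    have he := Real.exp_pos (-γ * |r|)
    refine (norm_combination_sub_le (E := (A₁ + A₂ + A₃ + A₄) * Real.exp (-γ * |r|))
      (norm_exp_I_mul_mul r k) (norm_exp_neg_I_mul_mul r k) (e1.trans ?_) ?_).trans
      (le_of_eq (mul_assoc _ _ _).symm)
    · gcongr
      linarith
    · rw [sub_neg_eq_add]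
      refine e3.trans ?_
      gcongr
      linarith

/-- Decay in `k` of spectral integrals of test functions. -/
theorem DualAdmissible.exists_norm_spectralIntegral_le (hA : Admissible ρ γ w m T R)
    (hB : DualAdmissible ρ w m κ γ' v l C) {h : ℝ → ℂ} (hh : IsPosTest h) :
    (Continuous fun k => ∫ r, waveFun w m r k * h r) ∧
    ∃ A, 0 ≤ A ∧ ∀ k, ‖∫ r, waveFun w m r k * h r‖ ≤ A / (1 + k ^ 2) := by
  obtain ⟨M, -, hM⟩ := hh.exists_support_bound
  obtain ⟨W, hW0, hW⟩ := hA.exists_sqrtWeight_le M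
  obtain ⟨A, hA0, B, hB0, h1⟩ := hB.exists_asymptotics M 0
  have h2 : ContDiff ℝ ∞ fun r => (sqrtWeight w r : ℂ) :=
    Complex.ofRealCLM.contDiff.comp hA.contDiff_sqrtWeight
  have hC := hB.contDiff_C
  have hC' : ContDiff ℝ ∞ fun r : ℝ => (starRingEnd ℂ) (C r) := Complex.conjCLE.contDiff.comp hC
  have hrw : ∀ k r : ℝ, waveFun w m r k =
      (sqrtWeight w r * m 1 r k) * Complex.exp (Complex.I * k * r) +
      (sqrtWeight w r * m (-1) r k) * Complex.exp (-(Complex.I * k * r)) := fun k r => by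
    rw [waveFun_eq, mul_right_comm Complex.I (r : ℂ)]
    ring
  have hbd : ∀ (r : ℝ) (z z' : ℂ) (E : ℝ), |r| ≤ M → ‖z - z'‖ ≤ E →
      ‖sqrtWeight w r * z - sqrtWeight w r * z'‖ ≤ W * E := fun r z z' E hr hz => by
    rw [← mul_sub, norm_mul]
    exact mul_le_mul (hW r hr) hz (norm_nonneg _) hW0
  refine exists_norm_integral_le (K := fun k r => waveFun w m r k)
    (aR := fun r => sqrtWeight w r * C r)
    (bR := fun r => sqrtWeight w r * 0) (aL := fun r => sqrtWeight w r * (starRingEnd ℂ) (C r))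
    (bL := fun r => sqrtWeight w r * 0) (A := 2 * (W * A)) (B := B) (M := M)
    (hA.continuous_waveFun.comp continuous_swap) hh (h2.mul hC) (h2.mul contDiff_const)
    (h2.mul hC') (h2.mul contDiff_const) hB.gamma_pos (hM M le_rfl) (fun k r hk hr => ?_)
    (fun k r hk hr => ?_)
  · rw [hrw]
    obtain ⟨e1, -, e3⟩ := h1 k r hr (by simp)
    rw [Complex.ofReal_re] at e1 e3
    refine (norm_combination_sub_le (norm_exp_I_mul_mul k r) (norm_exp_neg_I_mul_mul k r)
      (hbd r _ _ _ hr (e1 hk)) (hbd r _ _ _ hr ?_)).trans (le_of_eq (by ring))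
    rw [sub_zero]
    exact e3 (hk.trans (le_abs_self k))
  · rw [hrw]
    obtain ⟨-, e1, e3⟩ := h1 k r hr (by simp)
    rw [Complex.ofReal_re] at e1 e3
    refine (norm_combination_sub_le (norm_exp_I_mul_mul k r) (norm_exp_neg_I_mul_mul k r)
      (hbd r _ _ _ hr (e1 hk)) (hbd r _ _ _ hr ?_)).trans (le_of_eq (by ring))
    rw [sub_zero]
    exact e3 (hk.trans (neg_le_abs k))

theorem DualAdmissible.coeffN_neg_signs (hB : DualAdmissible ρ w m κ γ' v l C) (τ τ' : ℤˣ)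
    (k r r' : ℝ) : coeffN m (-τ) (-τ') k r r' = coeffN m τ τ' (-k : ℝ) r r' := by
  have h1 := hB.v_analytic_real k
  have h2 := hB.v_analytic_real (-k)
  rw [Complex.ofReal_neg] at h2 ⊢
  rw [← hB.dualWeight_mul_coeffL _ _ h1 h2,
    ← hB.dualWeight_mul_coeffL _ _ h2 (by rwa [neg_neg]), hB.coeffL_neg, dualWeight_neg]

/-- Unfolding of the spectral kernel to the full momentum line. -/
theorem DualAdmissible.sum_waveFun_mul_waveFun (hA : Admissible ρ γ w m T R)
    (hB : DualAdmissible ρ w m κ γ' v l C) (k r r' : ℝ) :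
    ∑ δ : ℤˣ, waveFun w m (rsgn δ * r) k * waveFun w m (rsgn δ * r') (-k) =
      (sqrtWeight w r * sqrtWeight w r' : ℂ) *
        (spectralDensity m k r r' + spectralDensity m (-k) r r') := by
  have hw : ∀ r : ℝ, sqrtWeight w (-r) = sqrtWeight w r := fun r => by
    have := hA.w_even r
    simp only [sqrtWeight, Complex.ofReal_neg, this]
  have h1 := hB.coeffN_neg_signs 1 1 k r r'
  have h2 := hB.coeffN_neg_signs 1 (-1) k r r'
  have e1 : Complex.exp (Complex.I * k * (r - r' : ℝ)) =
      Complex.exp (Complex.I * r * k) * Complex.exp (-(Complex.I * r' * k)) := by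
    rw [← Complex.exp_add]
    congr 1
    push_cast
    ring
  have e2 : Complex.exp (Complex.I * k * (r + r' : ℝ)) =
      Complex.exp (Complex.I * r * k) * Complex.exp (Complex.I * r' * k) := by
    rw [← Complex.exp_add]
    congr 1
    push_cast
    ring
  have e3 : Complex.exp (Complex.I * (-k : ℝ) * (r - r' : ℝ)) =
      Complex.exp (-(Complex.I * r * k)) * Complex.exp (Complex.I * r' * k) := by
    rw [← Complex.exp_add]
    congr 1
    push_cast
    ring
  have e4 : Complex.exp (Complex.I * (-k : ℝ) * (r + r' : ℝ)) =
      Complex.exp (-(Complex.I * r * k)) * Complex.exp (-(Complex.I * r' * k)) := by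
    rw [← Complex.exp_add]
    congr 1
    push_cast
    ring
  simp only [spectralDensity]
  rw [← h1, ← h2, e1, e2, e3, e4]
  simp only [sum_signs, waveFun_eq, rsgn, coeffN, Units.val_neg, Units.val_one, Int.cast_neg,
    Int.cast_one, one_mul, neg_mul, mul_neg, hw, neg_neg, Complex.ofReal_neg]
  ring

end

/-! ### The spectral inner product of two test functions -/

theorem rsgn_mul_self (δ : ℤˣ) : rsgn δ * rsgn δ = 1 := by
  rcases Int.units_eq_one_or δ with rfl | rfl <;> simp [rsgn]

theorem abs_rsgn (δ : ℤˣ) : |rsgn δ| = 1 := by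
  rcases Int.units_eq_one_or δ with rfl | rfl <;> simp [rsgn]

theorem norm_sgn (δ : ℤˣ) : ‖sgn δ‖ = 1 := by
  rcases Int.units_eq_one_or δ with rfl | rfl <;> simp [sgn]

theorem conj_sgn (δ : ℤˣ) : (starRingEnd ℂ) (sgn δ) = sgn δ := by
  simp [sgn]

theorem integral_comp_rsgn_mul (δ : ℤˣ) (f : ℝ → ℂ) : ∫ r, f (rsgn δ * r) = ∫ r, f r := by
  rw [Measure.integral_comp_mul_left, abs_inv, abs_rsgn, inv_one, one_smul]

theorem IsPosTest.comp_rsgn_mul {f : ℝ → ℂ} (hf : IsPosTest f) (δ : ℤˣ) :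
    IsPosTest fun r => f (rsgn δ * r) := by
  obtain ⟨h1, h2⟩ := hf
  refine ⟨h1.comp (contDiff_const.mul contDiff_id), ?_⟩
  rcases Int.units_eq_one_or δ with rfl | rfl
  · simpa [rsgn] using h2
  · have h3 : (fun r => f (rsgn (-1) * r)) = f ∘ Homeomorph.neg ℝ := by
      funext r
      simp [rsgn]
    rw [h3]
    exact h2.comp_homeomorph (Homeomorph.neg ℝ)

theorem adjointFun_eq (Ψ : ℝ → ℝ → ℂ) (h : ℝ → ℂ) (δ : ℤˣ) (k : ℝ) :
    adjointFun Ψ h δ k = sgn δ * (1 / Real.sqrt (2 * Real.pi) : ℝ) *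
      ∫ r : ℝ, Ψ r (-k) * h (rsgn δ * r) := by
  rw [adjointFun, ← integral_comp_rsgn_mul δ]
  simp only [← mul_assoc, rsgn_mul_self, one_mul]

section

variable {ρ γ : ℝ} {w : ℂ → ℂ} {m : ℤˣ → ℂ → ℂ → ℂ} {T R : ℝ → ℂ}
  {κ γ' : ℝ} {v : ℂ → ℂ} {l : ℤˣ → ℝ → ℂ → ℂ} {C : ℂ → ℂ} {n : ℕ} {pole res : Fin n → ℂ}

theorem DualAdmissible.exists_norm_adjointFun_le (hA : Admissible ρ γ w m T R)
    (hB : DualAdmissible ρ w m κ γ' v l C) {h : ℝ → ℂ} (hh : IsPosTest h) (δ : ℤˣ) :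
    Continuous (adjointFun (waveFun w m) h δ) ∧
    ∃ A, 0 ≤ A ∧ ∀ k, ‖adjointFun (waveFun w m) h δ k‖ ≤ A / (1 + k ^ 2) := by
  obtain ⟨hc, A, hA0, hAk⟩ := hB.exists_norm_spectralIntegral_le hA (hh.comp_rsgn_mul δ)
  refine ⟨?_, 1 / Real.sqrt (2 * Real.pi) * A, by positivity, fun k => ?_⟩
  · rw [funext (adjointFun_eq (waveFun w m) h δ)]
    exact continuous_const.mul (hc.comp continuous_neg)
  · rw [adjointFun_eq, norm_mul, norm_mul, norm_sgn, one_mul, Complex.norm_real, Real.norm_eq_abs,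
      abs_of_nonneg (by positivity), mul_div_assoc]
    have := hAk (-k)
    rw [neg_sq] at this
    gcongr

theorem DualAdmissible.memLp_adjointFun (hA : Admissible ρ γ w m T R)
    (hB : DualAdmissible ρ w m κ γ' v l C) {h : ℝ → ℂ} (hh : IsPosTest h) (δ : ℤˣ) :
    MemLp (adjointFun (waveFun w m) h δ) 2 (volume.restrict (Ioi (0 : ℝ))) := by
  obtain ⟨hc, A, -, hAk⟩ := hB.exists_norm_adjointFun_le hA hh δ
  exact memLp_two_of_norm_le Measure.restrict_le_self hc.aestronglyMeasurable
    (Eventually.of_forall hAk)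

theorem DualAdmissible.exists_norm_spectralIntegrand_le (hA : Admissible ρ γ w m T R)
    (hB : DualAdmissible ρ w m κ γ' v l C) {f g : ℝ → ℂ} (hf : IsPosTest f) (hg : IsPosTest g) :
    ∃ A, ∀ (k : ℝ) (p : ℝ × ℝ), ‖(starRingEnd ℂ) (f p.1) * g p.2 *
      ((sqrtWeight w p.1 * sqrtWeight w p.2 : ℂ) * spectralDensity m k p.1 p.2)‖ ≤
        A * (‖f p.1‖ * ‖g p.2‖) := by
  obtain ⟨M₁, hM₁, hfM⟩ := hf.exists_support_bound
  obtain ⟨M₂, hM₂, hgM⟩ := hg.exists_support_bound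
  obtain ⟨W, hW0, hW⟩ := hA.exists_sqrtWeight_le (M₁ + M₂)
  obtain ⟨A, hA0, hAk⟩ := hB.exists_norm_spectralDensity_le hA (M₁ + M₂)
  refine ⟨W * W * A, fun k p => ?_⟩
  by_cases h1 : |p.1| ≤ M₁ + M₂
  · by_cases h2 : |p.2| ≤ M₁ + M₂
    · have j1 := hW _ h1
      have j2 := hW _ h2
      have j3 := hAk k _ _ h1 h2
      rw [norm_mul, norm_mul, norm_mul, norm_mul, RCLike.norm_conj, mul_comm]
      gcongr
    · simp [hgM (M₁ + M₂) (by linarith) _ (not_le.1 h2)]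
  · simp [hfM (M₁ + M₂) (by linarith) _ (not_le.1 h1)]

theorem Admissible.continuous_spectralIntegrand (hA : Admissible ρ γ w m T R) {f g : ℝ → ℂ}
    (hf : IsPosTest f) (hg : IsPosTest g) :
    Continuous fun q : ℝ × (ℝ × ℝ) => (starRingEnd ℂ) (f q.2.1) * g q.2.2 *
      ((sqrtWeight w q.2.1 * sqrtWeight w q.2.2 : ℂ) * spectralDensity m q.1 q.2.1 q.2.2) := by
  have hfc := hf.1.continuous
  have hgc := hg.1.continuous
  have hwc := hA.continuous_sqrtWeight
  have hsc := hA.continuous_spectralDensity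
  refine Continuous.mul (by fun_prop) (Continuous.mul ?_ hsc)
  fun_prop

theorem DualAdmissible.integrable_spectralDensity (hA : Admissible ρ γ w m T R)
    (hB : DualAdmissible ρ w m κ γ' v l C) {f g : ℝ → ℂ} (hf : IsPosTest f) (hg : IsPosTest g)
    (P : ℝ) :
    Integrable (fun q : ℝ × (ℝ × ℝ) => (starRingEnd ℂ) (f q.2.1) * g q.2.2 *
      ((sqrtWeight w q.2.1 * sqrtWeight w q.2.2 : ℂ) * spectralDensity m q.1 q.2.1 q.2.2))
      ((volume.restrict (Ioc (-P) P)).prod (volume.prod volume)) := by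
  obtain ⟨A, hAk⟩ := hB.exists_norm_spectralIntegrand_le hA hf hg
  have hb : Integrable (fun q : ℝ × (ℝ × ℝ) => A * (‖f q.2.1‖ * ‖g q.2.2‖))
      ((volume.restrict (Ioc (-P) P)).prod (volume.prod volume)) :=
    (integrable_const A).mul_prod (hf.integrable.norm.mul_prod hg.integrable.norm)
  exact hb.mono' (hA.continuous_spectralIntegrand hf hg).aestronglyMeasurable
    (Eventually.of_forall fun q => hAk q.1 q.2)

/-- Conjugating `Ψ` reverses `k`, and the signs `δ` square to 1. The product of single integrals is
then a double integral whose kernel unfolds under the sum over `δ`. -/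
theorem DualAdmissible.sum_conj_adjointFun_mul (hA : Admissible ρ γ w m T R)
    (hB : DualAdmissible ρ w m κ γ' v l C) {f g : ℝ → ℂ} (hf : IsPosTest f) (hg : IsPosTest g)
    (k : ℝ) :
    ∑ δ : ℤˣ, (starRingEnd ℂ) (adjointFun (waveFun w m) f δ k) *
        adjointFun (waveFun w m) g δ k =
      (2 * Real.pi : ℂ)⁻¹ * ∫ p : ℝ × ℝ, (starRingEnd ℂ) (f p.1) * g p.2 *
        ((sqrtWeight w p.1 * sqrtWeight w p.2 : ℂ) *
          (spectralDensity m k p.1 p.2 + spectralDensity m (-k) p.1 p.2)) ∂(volume.prod volume) := by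
  have hΨ := hA.continuous_waveFun
  have hc : ((1 / Real.sqrt (2 * Real.pi) : ℝ) : ℂ) * (1 / Real.sqrt (2 * Real.pi) : ℝ) =
      (2 * Real.pi : ℂ)⁻¹ := by
    rw [← Complex.ofReal_mul, ← pow_two, div_pow, Real.sq_sqrt (by positivity)]
    push_cast
    ring
  have hΨi : ∀ (δ : ℤˣ) (k : ℝ) (h : ℝ → ℂ), IsPosTest h →
      Integrable fun r => waveFun w m (rsgn δ * r) k * h r := fun δ k h hh => by
    have h1 : Continuous fun r : ℝ => waveFun w m (rsgn δ * r) k :=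
      hΨ.comp (f := fun r : ℝ => (rsgn δ * r, k)) (by fun_prop)
    exact (h1.mul hh.1.continuous).integrable_of_hasCompactSupport
      (HasCompactSupport.mul_left (f := fun r => waveFun w m (rsgn δ * r) k) hh.2)
  have key : ∀ δ : ℤˣ, (starRingEnd ℂ) (adjointFun (waveFun w m) f δ k) *
      adjointFun (waveFun w m) g δ k = (2 * Real.pi : ℂ)⁻¹ * ∫ p : ℝ × ℝ,
        (waveFun w m (rsgn δ * p.1) k * (starRingEnd ℂ) (f p.1)) *
        (waveFun w m (rsgn δ * p.2) (-k) * g p.2) ∂(volume.prod volume) := by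
    intro δ
    rw [integral_prod_mul (fun r => waveFun w m (rsgn δ * r) k * (starRingEnd ℂ) (f r))
      (fun r => waveFun w m (rsgn δ * r) (-k) * g r), adjointFun, adjointFun, map_mul, map_mul,
      conj_sgn, Complex.conj_ofReal, ← integral_conj]
    simp only [map_mul, hA.conj_waveFun, neg_neg]
    rw [← hc]
    linear_combination ((1 / Real.sqrt (2 * Real.pi) : ℝ) : ℂ) * (1 / Real.sqrt (2 * Real.pi) : ℝ) *
      (∫ r, waveFun w m (rsgn δ * r) k * (starRingEnd ℂ) (f r)) *
      (∫ r, waveFun w m (rsgn δ * r) (-k) * g r) * sgn_mul_self δ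
  simp only [key]
  rw [← Finset.mul_sum, ← integral_finsetSum]
  · congr 1
    refine integral_congr_ae (Eventually.of_forall fun p => ?_)
    beta_reduce
    rw [← hB.sum_waveFun_mul_waveFun hA, Finset.mul_sum]
    exact Finset.sum_congr rfl fun δ _ => by ring
  · exact fun δ _ => (hΨi δ k _ hf.conj).mul_prod (hΨi δ (-k) _ hg)

/-- The half-line integral of `S(k) + S(-k)`, truncated at `P`, is the integral of `S` over `[-P,
P]`, to which Fubini applies. Square integrability of the adjoint transforms ensures that the
half-line integral is the limit of its truncations. -/
theorem DualAdmissible.integral_sum_conj_adjointFun_mul (hA : Admissible ρ γ w m T R)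
    (hB : DualAdmissible ρ w m κ γ' v l C) (hpole : IsPolePairing κ v pole res) {f g : ℝ → ℂ}
    (hf : IsPosTest f) (hg : IsPosTest g) :
    ∫ k in Ioi (0 : ℝ), ∑ δ : ℤˣ, (starRingEnd ℂ) (adjointFun (waveFun w m) f δ k) *
        adjointFun (waveFun w m) g δ k =
      (∫ r, (starRingEnd ℂ) (f r) * g r) + Complex.I * ∑ j, res j * ∫ p : ℝ × ℝ,
        (starRingEnd ℂ) (f p.1) * g p.2 * residueKernel w κ l (pole j) p.1 p.2
          ∂(volume.prod volume) := by
  set S : ℝ → ℂ := fun k => ∫ p : ℝ × ℝ, (starRingEnd ℂ) (f p.1) * g p.2 *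
    ((sqrtWeight w p.1 * sqrtWeight w p.2 : ℂ) * spectralDensity m k p.1 p.2)
      ∂(volume.prod volume) with hS
  have hslice : ∀ k : ℝ, Integrable (fun p : ℝ × ℝ => (starRingEnd ℂ) (f p.1) * g p.2 *
      ((sqrtWeight w p.1 * sqrtWeight w p.2 : ℂ) * spectralDensity m k p.1 p.2))
      (volume.prod volume) := by
    intro k
    obtain ⟨A, hAk⟩ := hB.exists_norm_spectralIntegrand_le hA hf hg
    refine ((hf.integrable.norm.mul_prod hg.integrable.norm).const_mul A).mono' ?_
      (Eventually.of_forall fun p => hAk k p)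
    exact ((hA.continuous_spectralIntegrand hf hg).comp
      (Continuous.prodMk_right k)).aestronglyMeasurable
  have hSi : ∀ P : ℝ, IntegrableOn S (Ioc (-P) P) := fun P =>
    (hB.integrable_spectralDensity hA hf hg P).integral_prod_left
  have hsum : ∀ k, ∑ δ : ℤˣ, (starRingEnd ℂ) (adjointFun (waveFun w m) f δ k) *
      adjointFun (waveFun w m) g δ k = (2 * Real.pi : ℂ)⁻¹ * (S k + S (-k)) := by
    intro k
    rw [hB.sum_conj_adjointFun_mul hA hf hg, hS]
    beta_reduce
    rw [← integral_add (hslice k) (hslice (-k))]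
    congr 1
    exact integral_congr_ae (Eventually.of_forall fun p => by beta_reduce; ring)
  have hint : IntegrableOn (fun k => ∑ δ : ℤˣ,
      (starRingEnd ℂ) (adjointFun (waveFun w m) f δ k) * adjointFun (waveFun w m) g δ k)
      (Ioi 0) := by
    refine integrable_finsetSum _ fun δ _ => ?_
    have h1 := (hB.memLp_adjointFun hA hf δ).star
    exact h1.integrable_mul (hB.memLp_adjointFun hA hg δ)
  have hlim := intervalIntegral_tendsto_integral_Ioi 0 hint tendsto_id
  have hlim' := (hB.tendsto_integral_spectralDensity hA hpole hf hg).const_mul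
    ((2 * Real.pi : ℂ)⁻¹)
  have hpi : (2 * Real.pi : ℂ) ≠ 0 := by
    exact_mod_cast (by positivity : (2 * Real.pi : ℝ) ≠ 0)
  have heq : (2 * Real.pi : ℂ)⁻¹ * (2 * Real.pi * (∫ r, (starRingEnd ℂ) (f r) * g r) +
      2 * Real.pi * Complex.I * ∑ j, res j * ∫ p : ℝ × ℝ, (starRingEnd ℂ) (f p.1) * g p.2 *
        residueKernel w κ l (pole j) p.1 p.2 ∂(volume.prod volume)) =
      (∫ r, (starRingEnd ℂ) (f r) * g r) + Complex.I * ∑ j, res j * ∫ p : ℝ × ℝ,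
        (starRingEnd ℂ) (f p.1) * g p.2 * residueKernel w κ l (pole j) p.1 p.2
          ∂(volume.prod volume) := by
    rw [mul_assoc (2 * Real.pi : ℂ) Complex.I, ← mul_add, inv_mul_cancel_left₀ hpi]
  rw [heq] at hlim'
  refine tendsto_nhds_unique hlim (hlim'.congr' ?_)
  filter_upwards [eventually_ge_atTop 0] with P hP
  have hII : ∀ a b : ℝ, -P ≤ a → a ≤ b → b ≤ P → IntervalIntegrable S volume a b :=
    fun a b h1 h2 h3 => (intervalIntegrable_iff_integrableOn_Ioc_of_le h2).2
      ((hSi P).mono_set (Ioc_subset_Ioc h1 h3))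
  have h1 := hII (-P) 0 le_rfl (by linarith) hP
  have h2 := hII 0 P (by linarith) hP le_rfl
  have h3 : IntervalIntegrable (fun k => S (-k)) volume 0 P := by
    have := (IntervalIntegrable.iff_comp_neg (by finiteness)).1 h1
    simp only [neg_neg, neg_zero] at this
    exact this.symm
  simp only [hsum, id]
  rw [intervalIntegral.integral_const_mul, intervalIntegral.integral_add h2 h3,
    intervalIntegral.integral_comp_neg, neg_zero, add_comm,
    intervalIntegral.integral_add_adjacent_intervals h1 h2]
  congr 1
  have hswap := integral_integral_swap (f := fun (k : ℝ) (p : ℝ × ℝ) =>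
    (starRingEnd ℂ) (f p.1) * g p.2 *
      ((sqrtWeight w p.1 * sqrtWeight w p.2 : ℂ) * spectralDensity m k p.1 p.2))
    (hB.integrable_spectralDensity hA hf hg P)
  rw [intervalIntegral.integral_of_le (by linarith), hS, hswap]
  refine integral_congr_ae (Eventually.of_forall fun p => ?_)
  beta_reduce
  rw [integral_const_mul, integral_const_mul, intervalIntegral.integral_of_le (by linarith)]

theorem DualAdmissible.integral_prod_residueKernel (hA : Admissible ρ γ w m T R)
    (hB : DualAdmissible ρ w m κ γ' v l C) {k₀ : ℂ} (hk₀ : |k₀.im| < κ) {f g : ℝ → ℂ}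
    (hf : IsPosTest f) (hg : IsPosTest g) :
    ∫ p : ℝ × ℝ, (starRingEnd ℂ) (f p.1) * g p.2 * residueKernel w κ l k₀ p.1 p.2
      ∂(volume.prod volume) = ∫ r : ℝ, (starRingEnd ℂ) (f r) *
        ∫ r' : ℝ, g r' * residueKernel w κ l k₀ r r' := by
  rw [integral_prod _ (hB.integrable_residueKernel hA hk₀ hf hg)]
  simp only [mul_assoc, integral_const_mul]

end

/-! ### Density of test functions -/

/-- A function orthogonal to all real test functions vanishes almost everywhere, so the orthogonal
complement is trivial. -/
theorem dense_of_forall_posTest {K : Submodule ℂ PosSpace}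
    (hK : ∀ h : ℝ → ℂ, IsPosTest h → ∃ f ∈ K, (f : ℝ → ℂ) =ᵐ[volume] h) :
    Dense (K : Set PosSpace) := by
  rw [Submodule.dense_iff_topologicalClosure_eq_top, Submodule.topologicalClosure_eq_top_iff,
    eq_bot_iff]
  intro x hx
  rw [Submodule.mem_orthogonal] at hx
  rw [Submodule.mem_bot, Lp.eq_zero_iff_ae_eq_zero]
  have := isOpen_univ.ae_eq_zero_of_integral_contDiff_smul_eq_zero (μ := (volume : Measure ℝ))
    (f := x) (((Lp.memLp x).locallyIntegrable (by norm_num)).locallyIntegrableOn _) ?_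
  · filter_upwards [this] with r hr
    exact hr (mem_univ r)
  · intro g hg hgc _
    have htest : IsPosTest fun r => (g r : ℂ) :=
      ⟨Complex.ofRealCLM.contDiff.comp hg, hgc.comp_left (g := ((↑) : ℝ → ℂ)) Complex.ofReal_zero⟩
    obtain ⟨f, hf, hfg⟩ := hK _ htest
    have h1 := hx f hf
    rw [L2.inner_def] at h1
    rw [← h1]
    refine integral_congr_ae ?_
    filter_upwards [hfg] with r hr
    rw [hr, RCLike.inner_apply, Complex.conj_ofReal, Complex.real_smul, mul_comm]

/-- The same argument, one component at a time, with scalar test functions supported in `(0,∞)`. -/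
theorem dense_of_forall_momTest {K : Submodule ℂ MomSpace}
    (hK : ∀ φ, IsMomTest φ → ∃ f ∈ K,
      (f : ℝ → EuclideanSpace ℂ ℤˣ) =ᵐ[volume.restrict (Ioi (0 : ℝ))] φ) :
    Dense (K : Set MomSpace) := by
  rw [Submodule.dense_iff_topologicalClosure_eq_top, Submodule.topologicalClosure_eq_top_iff,
    eq_bot_iff]
  intro x hx
  rw [Submodule.mem_orthogonal] at hx
  rw [Submodule.mem_bot, Lp.eq_zero_iff_ae_eq_zero]
  have key : ∀ δ : ℤˣ, ∀ᵐ k ∂(volume.restrict (Ioi (0 : ℝ))), x k δ = 0 := by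
    intro δ
    have hloc : LocallyIntegrable (fun k => x k δ) (volume.restrict (Ioi (0 : ℝ))) :=
      (memLp_piLp_iff.1 (Lp.memLp x) δ).locallyIntegrable (by norm_num)
    have := isOpen_Ioi.ae_eq_zero_of_integral_contDiff_smul_eq_zero
      (μ := volume.restrict (Ioi (0 : ℝ))) (U := Ioi 0) (f := fun k => x k δ)
      (hloc.locallyIntegrableOn _) ?_
    · filter_upwards [this, ae_restrict_mem measurableSet_Ioi] with k hk hk0
      exact hk hk0
    · intro g hg hgc hgs
      have hgC : ContDiff ℝ ∞ fun k => (g k : ℂ) := Complex.ofRealCLM.contDiff.comp hg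
      have hts : tsupport (fun k => (g k : ℂ)) ⊆ tsupport g :=
        closure_mono fun k hk h0 => hk (by simp [h0])
      have htest : IsMomTest fun k => (g k : ℂ) • EuclideanSpace.single δ (1 : ℂ) := by
        refine ⟨hgC.smul contDiff_const, ?_, ?_⟩
        · exact HasCompactSupport.smul_right (f := fun k => (g k : ℂ))
            (hgc.comp_left (g := ((↑) : ℝ → ℂ)) Complex.ofReal_zero)
        · exact ((tsupport_smul_subset_left (fun k => (g k : ℂ)) _).trans hts).trans hgs
      obtain ⟨f, hf, hfg⟩ := hK _ htest
      have h1 := hx f hf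
      rw [L2.inner_def] at h1
      rw [← h1]
      refine integral_congr_ae ?_
      filter_upwards [hfg] with k hk
      rw [hk, inner_smul_left, EuclideanSpace.inner_single_left, map_one, one_mul,
        Complex.conj_ofReal, Complex.real_smul]
  filter_upwards [ae_all_iff.2 key] with k hk
  ext δ
  exact hk δ

/-! ### The transform on test functions -/

theorem IsMomTest.isPosTest {φ : ℝ → EuclideanSpace ℂ ℤˣ} (hφ : IsMomTest φ) (δ : ℤˣ) :
    IsPosTest fun k => φ k δ := by
  obtain ⟨h1, h2, -⟩ := hφ
  have h3 : (fun k => φ k δ) = (fun x : EuclideanSpace ℂ ℤˣ => x δ) ∘ φ := rfl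
  refine ⟨?_, ?_⟩
  · exact (PiLp.proj (𝕜 := ℝ) 2 (fun _ : ℤˣ => ℂ) δ).contDiff.comp h1
  · rw [h3]
    exact h2.comp_left rfl

theorem IsMomTest.eq_zero {φ : ℝ → EuclideanSpace ℂ ℤˣ} (hφ : IsMomTest φ) {k : ℝ}
    (hk : k ∉ Ioi (0 : ℝ)) : φ k = 0 :=
  image_eq_zero_of_notMem_tsupport fun h => hk (hφ.2.2 h)

theorem IsMomTest.memLp {φ : ℝ → EuclideanSpace ℂ ℤˣ} (hφ : IsMomTest φ) :
    MemLp φ 2 (volume.restrict (Ioi (0 : ℝ))) :=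
  (hφ.1.continuous.memLp_of_hasCompactSupport hφ.2.1).restrict _

section

variable {ρ γ : ℝ} {w : ℂ → ℂ} {m : ℤˣ → ℂ → ℂ → ℂ} {T R : ℝ → ℂ}
  {κ γ' : ℝ} {v : ℂ → ℂ} {l : ℤˣ → ℝ → ℂ → ℂ} {C : ℂ → ℂ} {n : ℕ} {pole res : Fin n → ℂ}

theorem Admissible.integrable_waveFun_mul (hA : Admissible ρ γ w m T R) {χ : ℝ → ℂ}
    (hχ : IsPosTest χ) (r : ℝ) : Integrable fun k => waveFun w m r k * χ k :=
  ((hA.continuous_waveFun.comp (Continuous.prodMk_right r)).mul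
    hχ.1.continuous).integrable_of_hasCompactSupport
    (HasCompactSupport.mul_left (f := fun k => waveFun w m r k) hχ.2)

theorem Admissible.integrable_integrand (hA : Admissible ρ γ w m T R)
    {φ : ℝ → EuclideanSpace ℂ ℤˣ} (hφ : IsMomTest φ) (r : ℝ) :
    Integrable (integrand (waveFun w m) φ r) := by
  refine integrable_finsetSum _ fun δ _ => ?_
  simp only [mul_assoc]
  exact (hA.integrable_waveFun_mul (hφ.isPosTest δ) _).const_mul _

theorem Admissible.transformFun_eq (hA : Admissible ρ γ w m T R)
    {φ : ℝ → EuclideanSpace ℂ ℤˣ} (hφ : IsMomTest φ) (r : ℝ) :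
    transformFun (waveFun w m) φ r = (1 / Real.sqrt (2 * Real.pi) : ℝ) *
      ∑ δ : ℤˣ, sgn δ * ∫ k, waveFun w m (rsgn δ * r) k * φ k δ := by
  rw [transformFun, setIntegral_eq_integral_of_forall_compl_eq_zero (fun k hk => by
    simp [integrand, hφ.eq_zero hk])]
  congr 1
  simp only [integrand, mul_assoc]
  rw [integral_finsetSum _ fun δ _ =>
    (hA.integrable_waveFun_mul (hφ.isPosTest δ) _).const_mul _]
  simp only [integral_const_mul]

theorem Admissible.memLp_transformFun (hA : Admissible ρ γ w m T R)
    {φ : ℝ → EuclideanSpace ℂ ℤˣ} (hφ : IsMomTest φ) :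
    MemLp (transformFun (waveFun w m) φ) 2 volume := by
  rw [funext (hA.transformFun_eq hφ)]
  have hsum : ∀ F : ℤˣ → ℝ → ℂ, (∀ δ, MemLp (F δ) 2 volume) → ∀ c : ℂ,
      MemLp (fun r => c * ∑ δ : ℤˣ, sgn δ * F δ r) 2 volume := fun F hF c =>
    (memLp_finsetSum _ fun δ _ => (hF δ).const_mul (sgn δ)).const_mul c
  refine hsum (fun δ r => ∫ k, waveFun w m (rsgn δ * r) k * φ k δ) (fun δ => ?_) _
  obtain ⟨hc, A, -, hA'⟩ := hA.exists_norm_wavePacket_le (hφ.isPosTest δ)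
  have hc' : Continuous fun r => ∫ k, waveFun w m (rsgn δ * r) k * φ k δ :=
    hc.comp (f := fun r => rsgn δ * r) (by fun_prop)
  refine memLp_two_of_norm_le (A := A) le_rfl hc'.aestronglyMeasurable
    (Eventually.of_forall fun r => ?_)
  have := hA' (rsgn δ * r)
  rwa [mul_pow, pow_two (rsgn δ), rsgn_mul_self, one_mul] at this

theorem Admissible.exists_mem_transform_domain (hA : Admissible ρ γ w m T R)
    {φ : ℝ → EuclideanSpace ℂ ℤˣ} (hφ : IsMomTest φ) :
    ∃ f ∈ (transform (waveFun w m)).domain,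
      (f : ℝ → EuclideanSpace ℂ ℤˣ) =ᵐ[volume.restrict (Ioi (0 : ℝ))] φ := by
  have h := hφ.memLp.coeFn_toLp
  refine ⟨hφ.memLp.toLp φ, ⟨⟨φ, hφ, h⟩, fun r => ?_, ?_⟩, h⟩
  · exact (hA.integrable_integrand hφ r).integrableOn.congr (integrand_congr h r).symm
  · rw [transformFun_congr h]
    exact hA.memLp_transformFun hφ

theorem Admissible.dense_transform_domain (hA : Admissible ρ γ w m T R) :
    Dense ((transform (waveFun w m)).domain : Set MomSpace) :=
  dense_of_forall_momTest fun _ hφ => hA.exists_mem_transform_domain hφ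

theorem coeFn_transform {Ψ : ℝ → ℝ → ℂ} (f : (transform Ψ).domain)
    {φ : ℝ → EuclideanSpace ℂ ℤˣ}
    (h : ((f : MomSpace) : ℝ → EuclideanSpace ℂ ℤˣ) =ᵐ[volume.restrict (Ioi (0 : ℝ))] φ) :
    (transform Ψ f : ℝ → ℂ) =ᵐ[volume] transformFun Ψ φ := by
  rw [← transformFun_congr h]
  exact f.2.2.2.coeFn_toLp

/-! ### The adjoint on test functions -/

/-- The two components of the adjoint transform of `h`. -/
noncomputable def adjointVec (Ψ : ℝ → ℝ → ℂ) (h : ℝ → ℂ) (k : ℝ) : EuclideanSpace ℂ ℤˣ :=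
  WithLp.toLp 2 fun δ => adjointFun Ψ h δ k

theorem DualAdmissible.memLp_adjointVec (hA : Admissible ρ γ w m T R)
    (hB : DualAdmissible ρ w m κ γ' v l C) {h : ℝ → ℂ} (hh : IsPosTest h) :
    MemLp (adjointVec (waveFun w m) h) 2 (volume.restrict (Ioi (0 : ℝ))) :=
  memLp_piLp_iff.2 fun δ => hB.memLp_adjointFun hA hh δ

theorem Admissible.integral_conj_mul_wavePacket (hA : Admissible ρ γ w m T R) {h χ : ℝ → ℂ}
    (hh : IsPosTest h) (hχ : IsPosTest χ) (δ : ℤˣ) :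
    ∫ r, (starRingEnd ℂ) (h r) * ∫ k, waveFun w m (rsgn δ * r) k * χ k =
      ∫ k, (∫ r, waveFun w m (rsgn δ * r) k * (starRingEnd ℂ) (h r)) * χ k := by
  simp only [← integral_const_mul, ← integral_mul_const]
  rw [integral_integral_swap_of_hasCompactSupport]
  · refine integral_congr_ae (Eventually.of_forall fun k => integral_congr_ae
      (Eventually.of_forall fun r => ?_))
    beta_reduce
    ring
  · have h1 := hh.1.continuous
    have h2 := hχ.1.continuous
    have h3 : Continuous fun p : ℝ × ℝ => waveFun w m (rsgn δ * p.1) p.2 :=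
      hA.continuous_waveFun.comp (f := fun p : ℝ × ℝ => (rsgn δ * p.1, p.2)) (by fun_prop)
    exact Continuous.mul (by fun_prop) (h3.mul (by fun_prop))
  · refine HasCompactSupport.intro (hh.2.isCompact.prod hχ.2.isCompact) fun p hp => ?_
    rw [mem_prod, not_and_or] at hp
    rcases hp with hp | hp
    · simp [Function.uncurry, image_eq_zero_of_notMem_tsupport hp]
    · simp [Function.uncurry, image_eq_zero_of_notMem_tsupport hp]

/-- The defining relation of the Hilbert space adjoint. Both sides reduce to the same double
integral by Fubini, which is harmless because both test functions have compact support. -/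
theorem DualAdmissible.inner_adjointVec (hA : Admissible ρ γ w m T R)
    (hB : DualAdmissible ρ w m κ γ' v l C) {h : ℝ → ℂ} (hh : IsPosTest h) {y : PosSpace}
    (hy : (y : ℝ → ℂ) =ᵐ[volume] h) (f : (transform (waveFun w m)).domain) :
    ⟪(hB.memLp_adjointVec hA hh).toLp _, (f : MomSpace)⟫_ℂ = ⟪y, transform (waveFun w m) f⟫_ℂ := by
  obtain ⟨φ, hφ, hfφ⟩ := f.2.1
  have hpack := fun δ => hA.exists_norm_wavePacket_le (hφ.isPosTest δ)
  have hi1 : ∀ δ, Integrable fun r => (starRingEnd ℂ) (h r) *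
      ∫ k, waveFun w m (rsgn δ * r) k * φ k δ := fun δ => by
    have h1 := hh.conj.1.continuous
    have h2 : Continuous fun r => ∫ k, waveFun w m (rsgn δ * r) k * φ k δ :=
      (hpack δ).1.comp (f := fun r => rsgn δ * r) (by fun_prop)
    exact (h1.mul h2).integrable_of_hasCompactSupport hh.conj.2.mul_right
  have e1 : ⟪y, transform (waveFun w m) f⟫_ℂ = (1 / Real.sqrt (2 * Real.pi) : ℝ) *
      ∑ δ : ℤˣ, sgn δ * ∫ r, (starRingEnd ℂ) (h r) *
        ∫ k, waveFun w m (rsgn δ * r) k * φ k δ := by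
    have : ∑ δ : ℤˣ, sgn δ * ∫ r, (starRingEnd ℂ) (h r) *
        (∫ k, waveFun w m (rsgn δ * r) k * φ k δ) = ∫ r, ∑ δ : ℤˣ, sgn δ *
        ((starRingEnd ℂ) (h r) * ∫ k, waveFun w m (rsgn δ * r) k * φ k δ) := by
      rw [integral_finsetSum _ fun δ _ => (hi1 δ).const_mul _]
      exact Finset.sum_congr rfl fun δ _ => (integral_const_mul _ _).symm
    rw [L2.inner_def, this, ← integral_const_mul]
    refine integral_congr_ae ?_
    filter_upwards [hy, coeFn_transform f hfφ] with r h1 h2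
    rw [h1, h2, RCLike.inner_apply, hA.transformFun_eq hφ, Finset.mul_sum, Finset.mul_sum,
      Finset.sum_mul]
    exact Finset.sum_congr rfl fun δ _ => by ring
  have hi2 : ∀ δ, Integrable fun k => (∫ r, waveFun w m (rsgn δ * r) k * (starRingEnd ℂ) (h r)) *
      φ k δ := fun δ => by
    have h1 := (hB.exists_norm_spectralIntegral_le hA (hh.conj.comp_rsgn_mul δ)).1
    have h2 : (fun k => ∫ r, waveFun w m (rsgn δ * r) k * (starRingEnd ℂ) (h r)) =
        fun k => ∫ r, waveFun w m r k * (starRingEnd ℂ) (h (rsgn δ * r)) := by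
      funext k
      rw [← integral_comp_rsgn_mul δ]
      simp only [← mul_assoc, rsgn_mul_self, one_mul]
    rw [← h2] at h1
    exact (h1.mul (hφ.isPosTest δ).1.continuous).integrable_of_hasCompactSupport
      (HasCompactSupport.mul_left (hφ.isPosTest δ).2)
  have hconj : ∀ δ k, (starRingEnd ℂ) (adjointFun (waveFun w m) h δ k) =
      sgn δ * (1 / Real.sqrt (2 * Real.pi) : ℝ) *
        ∫ r, waveFun w m (rsgn δ * r) k * (starRingEnd ℂ) (h r) := fun δ k => by
    rw [adjointFun, map_mul, map_mul, conj_sgn, Complex.conj_ofReal, ← integral_conj]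
    simp only [map_mul, hA.conj_waveFun, neg_neg]
  have e2 : ⟪(hB.memLp_adjointVec hA hh).toLp _, (f : MomSpace)⟫_ℂ =
      (1 / Real.sqrt (2 * Real.pi) : ℝ) * ∑ δ : ℤˣ, sgn δ *
        ∫ k, (∫ r, waveFun w m (rsgn δ * r) k * (starRingEnd ℂ) (h r)) * φ k δ := by
    rw [L2.inner_def]
    have : ∫ k, ∑ δ : ℤˣ, (starRingEnd ℂ) (adjointFun (waveFun w m) h δ k) * φ k δ =
        (1 / Real.sqrt (2 * Real.pi) : ℝ) * ∑ δ : ℤˣ, sgn δ *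
        ∫ k, (∫ r, waveFun w m (rsgn δ * r) k * (starRingEnd ℂ) (h r)) * φ k δ := by
      have : ∑ δ : ℤˣ, sgn δ * ∫ k, (∫ r, waveFun w m (rsgn δ * r) k * (starRingEnd ℂ) (h r)) *
          φ k δ = ∫ k, ∑ δ : ℤˣ, sgn δ *
          ((∫ r, waveFun w m (rsgn δ * r) k * (starRingEnd ℂ) (h r)) * φ k δ) := by
        rw [integral_finsetSum _ fun δ _ => (hi2 δ).const_mul _]
        exact Finset.sum_congr rfl fun δ _ => (integral_const_mul _ _).symm
      rw [this, ← integral_const_mul]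
      refine integral_congr_ae (Eventually.of_forall fun k => ?_)
      beta_reduce
      simp only [hconj]
      rw [Finset.mul_sum]
      exact Finset.sum_congr rfl fun δ _ => by ring
    have hset : ∫ k in Ioi (0 : ℝ), ∑ δ : ℤˣ, (starRingEnd ℂ) (adjointFun (waveFun w m) h δ k) *
        φ k δ = ∫ k, ∑ δ : ℤˣ, (starRingEnd ℂ) (adjointFun (waveFun w m) h δ k) * φ k δ :=
      setIntegral_eq_integral_of_forall_compl_eq_zero fun k hk => by simp [hφ.eq_zero hk]
    rw [← this, ← hset]
    refine integral_congr_ae ?_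
    filter_upwards [hfφ, (hB.memLp_adjointVec hA hh).coeFn_toLp] with k h1 h2
    rw [h1, h2, PiLp.inner_apply]
    exact Finset.sum_congr rfl fun δ _ => by rw [RCLike.inner_apply, mul_comm]; rfl
  rw [e1, e2]
  congr 1
  exact Finset.sum_congr rfl fun δ _ => by
    rw [hA.integral_conj_mul_wavePacket hh (hφ.isPosTest δ)]

theorem DualAdmissible.mem_adjoint_domain (hA : Admissible ρ γ w m T R)
    (hB : DualAdmissible ρ w m κ γ' v l C) {h : ℝ → ℂ} (hh : IsPosTest h) {y : PosSpace}
    (hy : (y : ℝ → ℂ) =ᵐ[volume] h) : y ∈ (transform (waveFun w m)).adjoint.domain :=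
  LinearPMap.mem_adjoint_domain_of_exists y
    ⟨(hB.memLp_adjointVec hA hh).toLp _, hB.inner_adjointVec hA hh hy⟩

theorem DualAdmissible.adjoint_apply (hA : Admissible ρ γ w m T R)
    (hB : DualAdmissible ρ w m κ γ' v l C) {h : ℝ → ℂ} (hh : IsPosTest h)
    (y : (transform (waveFun w m)).adjoint.domain)
    (hy : ((y : PosSpace) : ℝ → ℂ) =ᵐ[volume] h) :
    (transform (waveFun w m)).adjoint y = (hB.memLp_adjointVec hA hh).toLp _ :=
  LinearPMap.adjoint_apply_eq hA.dense_transform_domain y (hB.inner_adjointVec hA hh hy)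

end

/-! ### The adjoint identity and isometry -/

/-- A kernel that integrates to zero against all products of test functions vanishes at its points
of continuity. -/
theorem eq_zero_of_forall_integral_eq_zero {S : ℝ × ℝ → ℂ}
    (hS : ∀ f g : ℝ → ℂ, IsPosTest f → IsPosTest g → Integrable
      (fun p : ℝ × ℝ => (starRingEnd ℂ) (f p.1) * g p.2 * S p) (volume.prod volume))
    (h0 : ∀ f g : ℝ → ℂ, IsPosTest f → IsPosTest g →
      ∫ p : ℝ × ℝ, (starRingEnd ℂ) (f p.1) * g p.2 * S p ∂(volume.prod volume) = 0)
    {p : ℝ × ℝ} (hp : ContinuousAt S p) : S p = 0 := by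
  by_contra hne
  have hpos : 0 < ‖S p‖ / 2 := half_pos (norm_pos_iff.2 hne)
  obtain ⟨ε, hε, hball⟩ := Metric.continuousAt_iff.1 hp _ hpos
  -- The product of the bumps lives in the `ε`-ball, where `S` differs from `S p` by less than `‖S
  -- p‖ / 2`. Averaging then contradicts the vanishing of the integral.
  let f : ContDiffBump p.1 := ⟨ε / 4, ε / 2, by positivity, by linarith⟩
  let g : ContDiffBump p.2 := ⟨ε / 4, ε / 2, by positivity, by linarith⟩
  have htest : ∀ {c : ℝ} (b : ContDiffBump c), IsPosTest fun r => (b r : ℂ) := fun b =>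
    ⟨Complex.ofRealCLM.contDiff.comp b.contDiff,
      b.hasCompactSupport.comp_left (g := ((↑) : ℝ → ℂ)) Complex.ofReal_zero⟩
  have hfg : Integrable (fun q : ℝ × ℝ => f q.1 * g q.2) (volume.prod volume) :=
    f.integrable.mul_prod g.integrable
  have hI : 0 < ∫ q : ℝ × ℝ, f q.1 * g q.2 ∂(volume.prod volume) := by
    rw [integral_prod_mul (fun r => f r) (fun r => g r)]
    exact mul_pos f.integral_pos g.integral_pos
  have h1 := h0 _ _ (htest f) (htest g)
  have h2 : ∫ q : ℝ × ℝ, ((f q.1 * g q.2 : ℝ) : ℂ) * (S q - S p) ∂(volume.prod volume) =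
      -(((∫ q : ℝ × ℝ, f q.1 * g q.2 ∂(volume.prod volume) : ℝ) : ℂ) * S p) := by
    have e : ∀ q : ℝ × ℝ, ((f q.1 * g q.2 : ℝ) : ℂ) * (S q - S p) =
        (starRingEnd ℂ) (f q.1 : ℂ) * (g q.2 : ℂ) * S q - ((f q.1 * g q.2 : ℝ) : ℂ) * S p :=
      fun q => by
        rw [Complex.conj_ofReal]
        push_cast
        ring
    have hfgC : Integrable (fun q : ℝ × ℝ => ((f q.1 * g q.2 : ℝ) : ℂ)) (volume.prod volume) :=
      hfg.ofReal
    simp only [e]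
    rw [integral_sub (hS _ _ (htest f) (htest g)) (hfgC.mul_const _), h1, zero_sub,
      integral_mul_const, integral_complex_ofReal]
  have h3 : ‖∫ q : ℝ × ℝ, ((f q.1 * g q.2 : ℝ) : ℂ) * (S q - S p) ∂(volume.prod volume)‖ ≤
      ∫ q : ℝ × ℝ, f q.1 * g q.2 * (‖S p‖ / 2) ∂(volume.prod volume) := by
    refine norm_integral_le_of_norm_le (hfg.mul_const _) (Eventually.of_forall fun q => ?_)
    have hfg0 : 0 ≤ f q.1 * g q.2 := mul_nonneg f.nonneg g.nonneg
    rw [norm_mul, Complex.norm_real, Real.norm_eq_abs, abs_of_nonneg hfg0]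
    by_cases hq1 : f q.1 = 0
    · simp [hq1]
    · by_cases hq2 : g q.2 = 0
      · simp [hq2]
      · have m1 : q.1 ∈ Function.support f := hq1
        have m2 : q.2 ∈ Function.support g := hq2
        rw [f.support_eq] at m1
        rw [g.support_eq] at m2
        have m3 : dist q p < ε := by
          rw [Prod.dist_eq, max_lt_iff]
          exact ⟨m1.out.trans (half_lt_self hε), m2.out.trans (half_lt_self hε)⟩
        have := (hball m3).le
        rw [dist_eq_norm] at this
        gcongr
  rw [h2, norm_neg, norm_mul, Complex.norm_real, Real.norm_eq_abs, abs_of_pos hI,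
    integral_mul_const] at h3
  nlinarith [mul_pos hI hpos]

/-- The classes of test functions. -/
noncomputable def posTestSubmodule : Submodule ℂ PosSpace where
  carrier := {f | ∃ h, IsPosTest h ∧ (f : ℝ → ℂ) =ᵐ[volume] h}
  add_mem' := by
    rintro f g ⟨h, hh, hf⟩ ⟨k, hk, hg⟩
    exact ⟨h + k, ⟨hh.1.add hk.1, hh.2.add hk.2⟩, (Lp.coeFn_add f g).trans (hf.add hg)⟩
  zero_mem' := ⟨0, ⟨contDiff_const, HasCompactSupport.zero⟩, Lp.coeFn_zero _ _ _⟩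
  smul_mem' := by
    rintro c f ⟨h, hh, hf⟩
    exact ⟨c • h, ⟨contDiff_const.smul hh.1, hh.2.smul_left (f := fun _ => c)⟩,
      (Lp.coeFn_smul c f).trans (hf.const_smul c)⟩

theorem IsPosTest.memLp {h : ℝ → ℂ} (hh : IsPosTest h) : MemLp h 2 volume :=
  hh.1.continuous.memLp_of_hasCompactSupport hh.2

theorem IsPosTest.toLp_mem {h : ℝ → ℂ} (hh : IsPosTest h) :
    hh.memLp.toLp h ∈ posTestSubmodule :=
  ⟨h, hh, hh.memLp.coeFn_toLp⟩

theorem dense_posTestSubmodule : Dense (posTestSubmodule : Set PosSpace) :=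
  dense_of_forall_posTest fun _ hh => ⟨_, hh.toLp_mem, hh.memLp.coeFn_toLp⟩

/-- A closed operator that is isometric on a dense subspace of its domain is isometric. -/
theorem norm_eq_of_isClosed {E F : Type*} [NormedAddCommGroup E] [NormedSpace ℂ E]
    [NormedAddCommGroup F] [NormedSpace ℂ F] [CompleteSpace F] {A : E →ₗ.[ℂ] F} (hA : A.IsClosed)
    {D : Submodule ℂ E} (hD : Dense (D : Set E)) (J : D →ₗᵢ[ℂ] F)
    (hJ : ∀ x : D, ((x : E), J x) ∈ A.graph) (h : A.domain) : ‖A h‖ = ‖(h : E)‖ := by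
  obtain ⟨u, hu, hlim⟩ := mem_closure_iff_seq_limit.1 (hD (h : E))
  set x : ℕ → D := fun n => ⟨u n, hu n⟩ with hx
  -- Density is only in the norm of `E`, not in the graph norm. Isometry on `D` makes the images
  -- Cauchy, and closedness then forces their limit to be `A h`.
  have hcauchy : CauchySeq fun n => J (x n) := by
    rw [Metric.cauchySeq_iff]
    intro ε hε
    obtain ⟨N, hN⟩ := Metric.cauchySeq_iff.1 hlim.cauchySeq ε hε
    refine ⟨N, fun i hi j hj => ?_⟩
    rw [J.isometry.dist_eq]
    exact hN i hi j hj
  obtain ⟨y, hy⟩ := cauchySeq_tendsto_of_complete hcauchy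
  have hmem : ((h : E), y) ∈ (A.graph : Set (E × F)) :=
    hA.mem_of_tendsto (hlim.prodMk_nhds hy) (Eventually.of_forall fun n => hJ (x n))
  obtain ⟨z, hz, hzy⟩ := (LinearPMap.mem_graph_iff A).1 hmem
  have hzh : z = h := Subtype.ext hz
  rw [← hzh, hzy]
  simp only at hz
  rw [hz]
  refine tendsto_nhds_unique hy.norm (hlim.norm.congr fun n => ?_)
  rw [J.norm_map]
  rfl

section

variable {ρ γ : ℝ} {w : ℂ → ℂ} {m : ℤˣ → ℂ → ℂ → ℂ} {T R : ℝ → ℂ}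
  {κ γ' : ℝ} {v : ℂ → ℂ} {l : ℤˣ → ℝ → ℂ → ℂ} {C : ℂ → ℂ} {n : ℕ} {pole res : Fin n → ℂ}

theorem DualAdmissible.inner_adjoint (hA : Admissible ρ γ w m T R)
    (hB : DualAdmissible ρ w m κ γ' v l C) (hpole : IsPolePairing κ v pole res) {f g : ℝ → ℂ}
    (hf : IsPosTest f) (hg : IsPosTest g) (f' g' : (transform (waveFun w m)).adjoint.domain)
    (hf' : ((f' : PosSpace) : ℝ → ℂ) =ᵐ[volume] f)
    (hg' : ((g' : PosSpace) : ℝ → ℂ) =ᵐ[volume] g) :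
    ⟪(transform (waveFun w m)).adjoint f', (transform (waveFun w m)).adjoint g'⟫_ℂ =
      (∫ r, (starRingEnd ℂ) (f r) * g r) + Complex.I * ∑ j, res j * ∫ p : ℝ × ℝ,
        (starRingEnd ℂ) (f p.1) * g p.2 * residueKernel w κ l (pole j) p.1 p.2
          ∂(volume.prod volume) := by
  rw [← hB.integral_sum_conj_adjointFun_mul hA hpole hf hg, hB.adjoint_apply hA hf f' hf',
    hB.adjoint_apply hA hg g' hg', L2.inner_def]
  refine integral_congr_ae ?_
  filter_upwards [(hB.memLp_adjointVec hA hf).coeFn_toLp, (hB.memLp_adjointVec hA hg).coeFn_toLp]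
    with k h1 h2
  rw [h1, h2, PiLp.inner_apply]
  exact Finset.sum_congr rfl fun δ _ => by rw [RCLike.inner_apply, mul_comm]; rfl

theorem conj_mul_mul_residueSum (a b : ℂ) (r r' : ℝ) :
    a * b * residueSum w κ l pole res r r' =
      ∑ j, Complex.I * res j * (a * b * residueKernel w κ l (pole j) r r') := by
  rw [residueSum, Finset.mul_sum, Finset.mul_sum]
  exact Finset.sum_congr rfl fun j _ => by ring

theorem DualAdmissible.integrable_residueSum (hA : Admissible ρ γ w m T R)
    (hB : DualAdmissible ρ w m κ γ' v l C) (hpole : IsPolePairing κ v pole res) {f g : ℝ → ℂ}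
    (hf : IsPosTest f) (hg : IsPosTest g) :
    Integrable (fun p : ℝ × ℝ => (starRingEnd ℂ) (f p.1) * g p.2 *
      residueSum w κ l pole res p.1 p.2) (volume.prod volume) := by
  simp only [conj_mul_mul_residueSum]
  exact integrable_finsetSum _ fun j _ =>
    (hB.integrable_residueKernel hA (hpole.abs_im_lt j) hf hg).const_mul _

theorem DualAdmissible.integral_residueSum (hA : Admissible ρ γ w m T R)
    (hB : DualAdmissible ρ w m κ γ' v l C) (hpole : IsPolePairing κ v pole res) {f g : ℝ → ℂ}
    (hf : IsPosTest f) (hg : IsPosTest g) :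
    ∫ p : ℝ × ℝ, (starRingEnd ℂ) (f p.1) * g p.2 * residueSum w κ l pole res p.1 p.2
        ∂(volume.prod volume) =
      Complex.I * ∑ j, res j * ∫ p : ℝ × ℝ, (starRingEnd ℂ) (f p.1) * g p.2 *
        residueKernel w κ l (pole j) p.1 p.2 ∂(volume.prod volume) := by
  simp only [conj_mul_mul_residueSum]
  rw [integral_finsetSum _ fun j _ =>
    (hB.integrable_residueKernel hA (hpole.abs_im_lt j) hf hg).const_mul _, Finset.mul_sum]
  exact Finset.sum_congr rfl fun j _ => by rw [integral_const_mul, mul_assoc]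

theorem inner_posSpace_eq {f' g' : PosSpace} {f g : ℝ → ℂ} (hf' : (f' : ℝ → ℂ) =ᵐ[volume] f)
    (hg' : (g' : ℝ → ℂ) =ᵐ[volume] g) : ⟪f', g'⟫_ℂ = ∫ r, (starRingEnd ℂ) (f r) * g r := by
  rw [L2.inner_def]
  refine integral_congr_ae ?_
  filter_upwards [hf', hg'] with r h1 h2
  rw [h1, h2, RCLike.inner_apply, mul_comm]

theorem DualAdmissible.inner_adjoint_eq_add (hA : Admissible ρ γ w m T R)
    (hB : DualAdmissible ρ w m κ γ' v l C) (hpole : IsPolePairing κ v pole res) {f g : ℝ → ℂ}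
    (hf : IsPosTest f) (hg : IsPosTest g) (f' g' : (transform (waveFun w m)).adjoint.domain)
    (hf' : ((f' : PosSpace) : ℝ → ℂ) =ᵐ[volume] f)
    (hg' : ((g' : PosSpace) : ℝ → ℂ) =ᵐ[volume] g) :
    ⟪(transform (waveFun w m)).adjoint f', (transform (waveFun w m)).adjoint g'⟫_ℂ =
      ⟪(f' : PosSpace), (g' : PosSpace)⟫_ℂ + ∫ p : ℝ × ℝ, (starRingEnd ℂ) (f p.1) * g p.2 *
        residueSum w κ l pole res p.1 p.2 ∂(volume.prod volume) := by
  rw [hB.inner_adjoint hA hpole hf hg f' g' hf' hg', hB.integral_residueSum hA hpole hf hg,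
    inner_posSpace_eq hf' hg']

/-- The adjoint restricted to test functions. -/
noncomputable def adjointOnTest (Ψ : ℝ → ℝ → ℂ)
    (h : posTestSubmodule ≤ (transform Ψ).adjoint.domain) : posTestSubmodule →ₗ[ℂ] MomSpace :=
  (transform Ψ).adjoint.toFun ∘ₗ Submodule.inclusion h

theorem DualAdmissible.posTestSubmodule_le (hA : Admissible ρ γ w m T R)
    (hB : DualAdmissible ρ w m κ γ' v l C) :
    posTestSubmodule ≤ (transform (waveFun w m)).adjoint.domain := by
  rintro f ⟨h, hh, hf⟩
  exact hB.mem_adjoint_domain hA hh hf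

/-- Preservation of norms on the subspace of test functions gives preservation of inner products.
The residue sum therefore integrates to zero against all products, and it is continuous off the
diagonal. Conversely, the diagonal is a null set. -/
theorem DualAdmissible.isometric_iff (hA : Admissible ρ γ w m T R)
    (hB : DualAdmissible ρ w m κ γ' v l C) (hpole : IsPolePairing κ v pole res) :
    (∀ f : ℝ → ℂ, IsPosTest f → ∀ h : (transform (waveFun w m)).adjoint.domain,
        ((h : PosSpace) : ℝ → ℂ) =ᵐ[volume] f →
        ‖(transform (waveFun w m)).adjoint h‖ = ‖(h : PosSpace)‖) ↔
      ∀ r r' : ℝ, r ≠ r' → residueSum w κ l pole res r r' = 0 := by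
  constructor
  · intro hiso r r' hne
    let J : posTestSubmodule →ₗᵢ[ℂ] MomSpace :=
      ⟨adjointOnTest (waveFun w m) (hB.posTestSubmodule_le hA), fun x => by
        obtain ⟨h, hh, hx⟩ := x.2
        exact hiso h hh _ hx⟩
    refine eq_zero_of_forall_integral_eq_zero (S := fun p => residueSum w κ l pole res p.1 p.2)
      (p := (r, r')) (fun f g hf hg => hB.integrable_residueSum hA hpole hf hg)
      (fun f g hf hg => ?_) ?_
    · have h1 := hB.inner_adjoint_eq_add hA hpole hf hg
        ⟨_, hB.posTestSubmodule_le hA hf.toLp_mem⟩ ⟨_, hB.posTestSubmodule_le hA hg.toLp_mem⟩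
        hf.memLp.coeFn_toLp hg.memLp.coeFn_toLp
      have h2 := J.inner_map_map ⟨_, hf.toLp_mem⟩ ⟨_, hg.toLp_mem⟩
      exact left_eq_add.1 (h2.symm.trans h1)
    · exact continuousAt_const.mul (tendsto_finsetSum _ fun j _ => continuousAt_const.mul
        (hB.continuousAt_residueKernel hA (hpole.abs_im_lt j) (p := (r, r')) hne))
  · intro hres f hf h hhf
    have h1 := hB.inner_adjoint_eq_add hA hpole hf hf h h hhf hhf
    have h2 : ∫ p : ℝ × ℝ, (starRingEnd ℂ) (f p.1) * f p.2 *
        residueSum w κ l pole res p.1 p.2 ∂(volume.prod volume) = 0 := by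
      rw [← integral_zero (ℝ × ℝ) ℂ (μ := volume.prod volume)]
      refine integral_congr_ae ?_
      filter_upwards [ae_prod_ne] with p hp
      rw [hres _ _ hp, mul_zero]
    rw [h2, add_zero, inner_self_eq_norm_sq_to_K, inner_self_eq_norm_sq_to_K] at h1
    exact (sq_eq_sq₀ (norm_nonneg _) (norm_nonneg _)).1 (by exact_mod_cast h1)

/-- An adjoint of a densely defined operator is closed, so isometry on the dense space of test
functions spreads to the whole domain. -/
theorem DualAdmissible.isometric_iff_of_domain (hA : Admissible ρ γ w m T R)
    (hB : DualAdmissible ρ w m κ γ' v l C) (hpole : IsPolePairing κ v pole res) :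
    (∀ h : (transform (waveFun w m)).adjoint.domain,
        ‖(transform (waveFun w m)).adjoint h‖ = ‖(h : PosSpace)‖) ↔
      ∀ r r' : ℝ, r ≠ r' → residueSum w κ l pole res r r' = 0 := by
  rw [← hB.isometric_iff hA hpole]
  refine ⟨fun H f _ h _ => H h, fun H h => ?_⟩
  let J : posTestSubmodule →ₗᵢ[ℂ] MomSpace :=
    ⟨adjointOnTest (waveFun w m) (hB.posTestSubmodule_le hA), fun x => by
      obtain ⟨f, hf, hx⟩ := x.2
      exact H f hf _ hx⟩
  exact norm_eq_of_isClosed (LinearPMap.adjoint_isClosed hA.dense_transform_domain)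
    dense_posTestSubmodule J (fun x => LinearPMap.mem_graph _ (Submodule.inclusion
      (hB.posTestSubmodule_le hA) x)) h

end

end JostTransform

theorem theoremB1 (ρ γ : ℝ) (w : ℂ → ℂ) (m : ℤˣ → ℂ → ℂ → ℂ) (T R : ℝ → ℂ)
    (hA : Admissible ρ γ w m T R)
    (κ γ' : ℝ) (v : ℂ → ℂ) (l : ℤˣ → ℝ → ℂ → ℂ) (C : ℂ → ℂ)
    (hB : DualAdmissible ρ w m κ γ' v l C)
    (n : ℕ) (pole res : Fin n → ℂ) (hpole : IsPolePairing κ v pole res) :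
    -- the transform is densely defined on all test functions
    ((∀ φ : ℝ → EuclideanSpace ℂ ℤˣ, IsMomTest φ →
        ∃ f : (transform (waveFun w m)).domain,
          ((f : MomSpace) : ℝ → EuclideanSpace ℂ ℤˣ) =ᵐ[volume.restrict (Ioi (0 : ℝ))] φ) ∧
      Dense ((transform (waveFun w m)).domain : Set MomSpace)) ∧
    -- its adjoint is defined on test functions, and given there by the expected integral
    (∀ h : ℝ → ℂ, IsPosTest h →
      ∃ h' : (transform (waveFun w m)).adjoint.domain,
        ((h' : PosSpace) : ℝ → ℂ) =ᵐ[volume] h ∧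
        ∀ δ : ℤˣ, ∀ᵐ k ∂(volume.restrict (Ioi (0 : ℝ))),
          ((transform (waveFun w m)).adjoint h' : ℝ → EuclideanSpace ℂ ℤˣ) k δ =
            adjointFun (waveFun w m) h δ k) ∧
    -- the residue integrals converge absolutely
    (∀ f g : ℝ → ℂ, IsPosTest f → IsPosTest g → ∀ j,
      Integrable (fun p : ℝ × ℝ =>
        (starRingEnd ℂ) (f p.1) * g p.2 * residueKernel w κ l (pole j) p.1 p.2)
        (volume.prod volume)) ∧
    -- the adjoint identity
    (∀ f g : ℝ → ℂ, IsPosTest f → IsPosTest g →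
      ∀ f' g' : (transform (waveFun w m)).adjoint.domain,
        ((f' : PosSpace) : ℝ → ℂ) =ᵐ[volume] f → ((g' : PosSpace) : ℝ → ℂ) =ᵐ[volume] g →
        ⟪(transform (waveFun w m)).adjoint f', (transform (waveFun w m)).adjoint g'⟫_ℂ =
          (∫ r : ℝ, (starRingEnd ℂ) (f r) * g r) +
            Complex.I * ∑ j, res j * ∫ r : ℝ, (starRingEnd ℂ) (f r) *
              ∫ r' : ℝ, g r' * residueKernel w κ l (pole j) r r') ∧
    -- the adjoint is isometric on test functions if and only if the residue sum vanishes
    ((∀ f : ℝ → ℂ, IsPosTest f → ∀ h : (transform (waveFun w m)).adjoint.domain,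
        ((h : PosSpace) : ℝ → ℂ) =ᵐ[volume] f →
        ‖(transform (waveFun w m)).adjoint h‖ = ‖(h : PosSpace)‖) ↔
      ∀ r r' : ℝ, r ≠ r' → residueSum w κ l pole res r r' = 0) ∧
    -- the adjoint is isometric on its whole domain if and only if the residue sum vanishes
    ((∀ h : (transform (waveFun w m)).adjoint.domain,
        ‖(transform (waveFun w m)).adjoint h‖ = ‖(h : PosSpace)‖) ↔
      ∀ r r' : ℝ, r ≠ r' → residueSum w κ l pole res r r' = 0) := by
  refine ⟨⟨fun φ hφ => ?_, hA.dense_transform_domain⟩, fun h hh => ?_, fun f g hf hg j =>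
    hB.integrable_residueKernel hA (hpole.abs_im_lt j) hf hg, fun f g hf hg f' g' hf' hg' => ?_,
    hB.isometric_iff hA hpole, hB.isometric_iff_of_domain hA hpole⟩
  · obtain ⟨f, hf, hfφ⟩ := hA.exists_mem_transform_domain hφ
    exact ⟨⟨f, hf⟩, hfφ⟩
  · have hy := hh.memLp.coeFn_toLp
    refine ⟨⟨hh.memLp.toLp h, hB.mem_adjoint_domain hA hh hy⟩, hy, fun δ => ?_⟩
    rw [hB.adjoint_apply hA hh _ hy]
    filter_upwards [(hB.memLp_adjointVec hA hh).coeFn_toLp] with k hk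
    rw [hk]
    rfl
  · rw [hB.inner_adjoint hA hpole hf hg f' g' hf' hg']
    congr 2
    exact Finset.sum_congr rfl fun j _ => by
      rw [hB.integral_prod_residueKernel hA (hpole.abs_im_lt j) hf hg]
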